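/- Let $(X_j)_{j\in\mathbb Z}$ be a sequence of centered (integrable, mean zero) real random variables on a probability space. For a $\sigma$-algebra $\mathcal M$ and an integrable real random variable $Y$, let $$\tau(\mathcal M,Y)=\Big\|\sup_{f}\Big|\int f\,dP_{Y|\mathcal M}-\int f\,dP_Y\Big|\Big\|_1,$$ where $f$ runs over the $1$-Lipschitz functions $\mathbb R\to\mathbb R$ and $P_{Y|\mathcal M}$ is a regular conditional distribution of $Y$ given $\mathcal M$. For a random vector $Y$ with values in $\mathbb R^\ell$ let $\tau(\mathcal M,Y)=\sup_f\tau(\mathcal M,f(Y))$, where $f$ runs over the functions $\mathbb R^\ell\to\mathbb R$ that are $1$-Lipschitz for the distance $\sum_r|x_r-y_r|$. With $\mathcal M_p=\sigma(X_j,\ j\le p)$, put, for every integer $i\ge 1$, $$\tau(i)=\sup_{k}\max_{1\le\ell\le k}\frac1\ell\,\sup\big\{\tau(\mathcal M_p,(X_{j_1},\dots,X_{j_\ell})):\ p\in\mathbb Z,\ p+i\le j_1<\dots<j_\ell\big\},$$ and $\tau(x)=\tau(\lfloor x\rfloor)$ for real $x\ge1$. Let $c,\gamma_1>0$, $\gamma_2\in(0,\infty]$,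 let $\gamma$ be defined by $1/\gamma=1/\gamma_1+1/\gamma_2$ (with $1/\infty=0$), and assume that $\gamma<1$, that $$\tau(x)\le\exp(-cx^{\gamma_1})\quad\text{for all real }x\ge 1,$$ and that $$\sup_{k>0}P(|X_k|>t)\le\exp(1-t^{\gamma_2})\quad\text{for all }t>0$$ (for $\gamma_2=\infty$ the last condition means that $|X_k|\le1$ almost surely for all $k>0$). Put $\varphi_M(x)=(x\wedge M)\vee(-M)$, $S_j=X_1+\dots+X_j$ and $$V=\sup_{M\ge1}\ \sup_{i>0}\Big(\operatorname{Var}(\varphi_M(X_i))+2\sum_{j>i}|\operatorname{Cov}(\varphi_M(X_i),\varphi_M(X_j))|\Big).$$ Then $V$ is finite, and there are positive constants $C_1,C_2,C_3,C_4$ depending only on $c$, $\gamma$ and $\gamma_1$ such that, for every integer $n\ge4$ and every real $x>0$, $$P\Big(\max_{1\le j\le n}|S_j|\ge x\Big)\le n\exp\Big(-\frac{x^\gamma}{C_1}\Big)+2\exp\Big(-\frac{x^2}{C_2(1+nV)}\Big)+\exp\Big(-\frac{x^2}{C_3n}\exp\Big(\frac{x^{\gamma(1-\gamma)}}{C_4(\log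 x)^\gamma}\Big)\Big),$$ where the last of the three terms is read as $0$ when $x\le1$. -/

import Mathlib

open MeasureTheory ProbabilityTheory
open scoped ENNReal

namespace TauMixing

noncomputable section

/-- The coefficient `τ(𝓜, Y)` of a real random variable `Y` and a sub-σ-algebra `𝓜`: the `L¹`-norm
of `ω ↦ sup_f |∫ f dP_{Y|𝓜}(ω) - ∫ f dP_Y|`, where `f` runs over the `1`-Lipschitz functions
`ℝ → ℝ` and `P_{Y|𝓜}` is a regular conditional distribution of `Y` given `𝓜` (conditioning on `𝓜`
is conditioning on the identity map from `Ω` to `(Ω, 𝓜)`). It takes values in `[0, ∞]`. -/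
def tauReal {Ω : Type*} (𝓜 : MeasurableSpace Ω) [mΩ : MeasurableSpace Ω] (P : Measure Ω)
    [IsFiniteMeasure P] (Y : Ω → ℝ) : ℝ≥0∞ :=
  ∫⁻ ω, ⨆ (f : ℝ → ℝ) (_ : ∀ x y, |f x - f y| ≤ |x - y|),
    ENNReal.ofReal |(∫ y, f y ∂(@condDistrib Ω Ω ℝ _ _ _ mΩ 𝓜 Y id P _ ω)) -
      ∫ y, f y ∂(P.map Y)| ∂P

/-- The coefficient `τ(𝓜, Y)` of a random vector `Y` with values in `ℝ^ℓ`: the supremum of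
`τ(𝓜, f(Y))` over the functions `f : ℝ^ℓ → ℝ` that are `1`-Lipschitz for the distance
`∑ r, |x r - y r|`. -/
def tauVec {Ω : Type*} (𝓜 : MeasurableSpace Ω) [mΩ : MeasurableSpace Ω] (P : Measure Ω)
    [IsFiniteMeasure P] {ℓ : ℕ} (Y : Ω → Fin ℓ → ℝ) : ℝ≥0∞ :=
  ⨆ (f : (Fin ℓ → ℝ) → ℝ) (_ : ∀ x y, |f x - f y| ≤ ∑ r, |x r - y r|),
    tauReal 𝓜 P (fun ω => f (Y ω))

/-- The past `𝓜_p = σ(X_j, j ≤ p)`. -/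
abbrev past {Ω : Type*} (X : ℤ → Ω → ℝ) (p : ℤ) : MeasurableSpace Ω :=
  ⨆ (j : ℤ) (_ : j ≤ p), MeasurableSpace.comap (X j) inferInstance

/-- `τ_k(i) = max_{1 ≤ ℓ ≤ k} (1/ℓ) sup τ(𝓜_p, (X_{j_1}, …, X_{j_ℓ}))`, the supremum being over all
`p` and all `p + i ≤ j_1 < ⋯ < j_ℓ`. -/
def tauCoeffUpTo {Ω : Type*} [MeasurableSpace Ω] (P : Measure Ω) [IsFiniteMeasure P]
    (X : ℤ → Ω → ℝ) (k i : ℕ) : ℝ≥0∞ :=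
  ⨆ ℓ ∈ Finset.Icc 1 k, (ℓ : ℝ≥0∞)⁻¹ *
    ⨆ (p : ℤ) (j : Fin ℓ → ℤ) (_ : StrictMono j) (_ : ∀ r, p + (i : ℤ) ≤ j r),
      tauVec (past X p) P (fun ω r => X (j r) ω)

/-- The `τ`-mixing coefficients `τ(i) = sup_k τ_k(i)` of the sequence `X`. -/
def tauCoeff {Ω : Type*} [MeasurableSpace Ω] (P : Measure Ω) [IsFiniteMeasure P]
    (X : ℤ → Ω → ℝ) (i : ℕ) : ℝ≥0∞ :=
  ⨆ k : ℕ, tauCoeffUpTo P X k i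

/-- The truncation `φ_M(x) = (x ∧ M) ∨ (-M)`. -/
def trunc (M x : ℝ) : ℝ := max (min x M) (-M)

/-- `V = sup_{M ≥ 1} sup_{i > 0} (Var φ_M(X_i) + 2 ∑_{j > i} |Cov(φ_M(X_i), φ_M(X_j))|)`, as an
element of `[0, ∞]`. -/
def truncVar {Ω : Type*} [MeasurableSpace Ω] (P : Measure Ω) (X : ℤ → Ω → ℝ) : ℝ≥0∞ :=
  ⨆ (M : ℝ) (_ : 1 ≤ M) (i : ℤ) (_ : 0 < i),
    (ENNReal.ofReal (variance (fun ω => trunc M (X i ω)) P) +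
      2 * ∑' j : {j : ℤ // i < j},
        ENNReal.ofReal |covariance (fun ω => trunc M (X i ω)) (fun ω => trunc M (X j ω)) P|)

/-- The tail condition `sup_{k > 0} P(|X_k| > t) ≤ exp(1 - t^γ₂)` for all `t > 0`; for `γ₂ = ∞` it
means that `‖X_k‖_∞ ≤ 1` for all `k > 0`. -/
def TailBound {Ω : Type*} [MeasurableSpace Ω] (P : Measure Ω) (X : ℤ → Ω → ℝ)
    (γ₂ : ℝ≥0∞) : Prop :=
  (γ₂ = ∞ → ∀ k : ℤ, 0 < k → ∀ᵐ ω ∂P, |X k ω| ≤ 1) ∧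
  (γ₂ ≠ ∞ → ∀ t : ℝ, 0 < t → ∀ k : ℤ, 0 < k →
    P.real {ω | t < |X k ω|} ≤ Real.exp (1 - t ^ γ₂.toReal))

/-- The partial sum `S_j = X_1 + ⋯ + X_j`. -/
def partialSum {Ω : Type*} (X : ℤ → Ω → ℝ) (j : ℕ) (ω : Ω) : ℝ := ∑ i ∈ Finset.Icc 1 j, X (i : ℤ) ω

end

end TauMixing

namespace TauMixing

/-! Write `b` for `1 / γ₂`, so that the tail condition reads `P(|X_k| > s ^ b) ≤ exp(1 - s)` for
every `s > 0`, also when `γ₂ = ∞`, and `γ₁ * b + 1 = γ₁ / γ`. The only use of mixing is decoupling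
(`abs_integral_mul_sub_le_of_tauCoeff_le`): a bounded function of the past is almost uncorrelated
with a Lipschitz function of the sum of a distant block. Applied to two variables it makes `V`
finite.

The core is a Laplace transform bound for sums of about `B` variables, with `|t|` up to order `B ^
(-γ₁ * (1 / γ - 1))`. Blocks that large cannot be decoupled in a single step. Instead, sums over
Cantor-like sets are built from pieces of size about `B ^ (1 - γ)` by successive doubling
(`IsMixing.integral_exp_le_of_isCantor`). The truncation level and the gap grow with the size of the
set, so that each merging costs only a stretched exponential error. Since `γ < 1`, the gaps take up
only a fixed proportion of the whole, and an interval is an average of pieces of translates of one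
Cantor-like set. By convexity of `exp` the bound passes to intervals (`exp_sum_le_average`,
`exists_integral_exp_block_le`). The error is additive in the exponent; after centering, an
interpolation between `-s` and `s` gives it a factor `t ^ 2`, so that `V` is merely replaced by `V`
plus a stretched exponential term (`exists_integral_exp_centered_le`).

Next, `[1, n]` is cut into blocks of length `A` of order `x ^ (γ / γ₁)`, and the even and the odd
blocks are treated separately, so that one block always serves as a gap. A first-entry argument
(`measureReal_exists_mem_le`) bounds the maximum over blocks, both with exponentials and with
squares. This gives an exponential bound with leading factor 4 and a Chebyshev bound;
`le_add_exp_add_exp_of_bounds` combines them into the factors 2 and 1. The third term is obtained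
even without the logarithm. -/

/-! ### Decoupling by the `τ` coefficients. -/

/-- The identity is one of the Lipschitz functions in the supremum, and its integral against the
conditional distribution is the conditional expectation. -/
theorem lintegral_condExp_sub_le_tauReal {Ω : Type*} {𝓜 : MeasurableSpace Ω}
    [mΩ : MeasurableSpace Ω] (h𝓜 : 𝓜 ≤ mΩ) (P : Measure Ω) [IsProbabilityMeasure P] {Y : Ω → ℝ}
    (hY : Measurable Y) (hint : Integrable Y P) :
    ∫⁻ ω, ENNReal.ofReal |(P[Y | 𝓜]) ω - ∫ ω', Y ω' ∂P| ∂P ≤ tauReal 𝓜 P Y := by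
  unfold tauReal
  have hid : @Measurable Ω Ω mΩ 𝓜 id := measurable_id'' h𝓜
  have h1 := condExp_ae_eq_integral_condDistrib' (mβ := 𝓜) (X := id) (μ := P) hid hint
  rw [MeasurableSpace.comap_id] at h1
  have h2 : ∫ y, y ∂(P.map Y) = ∫ ω', Y ω' ∂P :=
    integral_map hY.aemeasurable aestronglyMeasurable_id
  refine lintegral_mono_ae ?_
  filter_upwards [h1] with ω hω
  refine le_trans (le_of_eq ?_) (le_iSup₂ (f := fun (f : ℝ → ℝ)
    (_ : ∀ x y, |f x - f y| ≤ |x - y|) => ENNReal.ofReal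
      |(∫ y, f y ∂(@condDistrib Ω Ω ℝ _ _ _ mΩ 𝓜 Y id P _ ω)) - ∫ y, f y ∂(P.map Y)|)
      (fun x => x) (fun x y => le_rfl))
  rw [h2, hω]
  rfl

/-- Since `G` is `𝓜`-measurable, `Y` may be replaced by `P[Y | 𝓜]`; the covariance is then the
integral of `G` times `P[Y | 𝓜] - E Y`, whose `L¹` norm is at most `ρ`. -/
theorem abs_integral_mul_sub_le_of_tauReal_le {Ω : Type*} {𝓜 : MeasurableSpace Ω}
    [mΩ : MeasurableSpace Ω] (h𝓜 : 𝓜 ≤ mΩ) (P : Measure Ω) [IsProbabilityMeasure P] {Y G : Ω → ℝ}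
    (hY : Measurable Y) (hint : Integrable Y P) {ρ B : ℝ} (hρ : 0 ≤ ρ)
    (hτ : tauReal 𝓜 P Y ≤ ENNReal.ofReal ρ) (hG : Measurable[𝓜] G) (hB : ∀ ω, |G ω| ≤ B) :
    |∫ ω, G ω * Y ω ∂P - (∫ ω, G ω ∂P) * ∫ ω, Y ω ∂P| ≤ B * ρ := by
  set m := ∫ ω, Y ω ∂P with hm
  have hG' : Measurable G := hG.mono h𝓜 le_rfl
  have hGs : StronglyMeasurable[𝓜] G := hG.stronglyMeasurable
  have hGi : Integrable G P := Integrable.of_bound hG'.aestronglyMeasurable B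
    (Filter.Eventually.of_forall hB)
  have hGY : Integrable (fun ω => G ω * Y ω) P :=
    hint.bdd_mul hG'.aestronglyMeasurable (Filter.Eventually.of_forall hB)
  have hB0 : 0 ≤ B := by
    obtain ⟨ω⟩ : Nonempty Ω := by
      by_contra h
      rw [not_nonempty_iff] at h
      exact IsProbabilityMeasure.ne_zero P (Subsingleton.elim _ _)
    exact (abs_nonneg _).trans (hB ω)
  have hce : Integrable (P[Y | 𝓜]) P := integrable_condExp
  have hGce : Integrable (fun ω => G ω * (P[Y | 𝓜]) ω) P :=
    hce.bdd_mul hG'.aestronglyMeasurable (Filter.Eventually.of_forall hB)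
  have h1 : ∫ ω, G ω * Y ω ∂P = ∫ ω, G ω * (P[Y | 𝓜]) ω ∂P := by
    have := condExp_mul_of_stronglyMeasurable_left hGs hGY hint
    rw [← integral_condExp h𝓜 (f := fun ω => G ω * Y ω)]
    exact integral_congr_ae this
  have h2 : ∫ ω, G ω * Y ω ∂P - (∫ ω, G ω ∂P) * m = ∫ ω, G ω * ((P[Y | 𝓜]) ω - m) ∂P := by
    rw [h1, ← integral_mul_const, ← integral_sub hGce (hGi.mul_const _)]
    congr 1; ext ω; ring
  rw [h2]
  have hi : Integrable (fun ω => |(P[Y | 𝓜]) ω - m|) P := (hce.sub (integrable_const m)).abs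
  have h3 : ∫ ω, |(P[Y | 𝓜]) ω - m| ∂P ≤ ρ := by
    rw [integral_eq_lintegral_of_nonneg_ae (Filter.Eventually.of_forall fun _ => abs_nonneg _)
      hi.aestronglyMeasurable]
    exact ENNReal.toReal_le_of_le_ofReal hρ
      ((lintegral_condExp_sub_le_tauReal h𝓜 P hY hint).trans hτ)
  calc |∫ ω, G ω * ((P[Y | 𝓜]) ω - m) ∂P| ≤ ∫ ω, |G ω * ((P[Y | 𝓜]) ω - m)| ∂P :=
        abs_integral_le_integral_abs
    _ ≤ ∫ ω, B * |(P[Y | 𝓜]) ω - m| ∂P := by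
        refine integral_mono_of_nonneg (Filter.Eventually.of_forall fun _ => abs_nonneg _)
          (hi.const_mul B) (Filter.Eventually.of_forall fun ω => ?_)
        simp only [abs_mul]
        exact mul_le_mul_of_nonneg_right (hB ω) (abs_nonneg _)
    _ ≤ B * ρ := by
        rw [integral_const_mul]
        exact mul_le_mul_of_nonneg_left h3 hB0

theorem past_le {Ω : Type*} [mΩ : MeasurableSpace Ω] {X : ℤ → Ω → ℝ}
    (hX : ∀ j, Measurable (X j)) (p : ℤ) : past X p ≤ mΩ :=
  iSup₂_le fun j _ => (hX j).comap_le

theorem measurable_past {Ω : Type*} {X : ℤ → Ω → ℝ} {p j : ℤ} (h : j ≤ p) :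
    Measurable[past X p] (X j) := by
  have h1 : MeasurableSpace.comap (X j) inferInstance ≤ past X p :=
    le_iSup₂ (f := fun (j : ℤ) (_ : j ≤ p) => MeasurableSpace.comap (X j) inferInstance) j h
  exact (comap_measurable (X j)).mono h1 le_rfl

theorem tauVec_le_of_tauCoeff_le {Ω : Type*} [MeasurableSpace Ω] {P : Measure Ω}
    [IsFiniteMeasure P] {X : ℤ → Ω → ℝ} {i ℓ : ℕ} {ρ : ℝ}
    (hτ : tauCoeff P X i ≤ ENNReal.ofReal ρ) (hℓ : 1 ≤ ℓ) {p : ℤ} {j : Fin ℓ → ℤ}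
    (hj : StrictMono j) (hp : ∀ r, p + (i : ℤ) ≤ j r) :
    tauVec (past X p) P (fun ω r => X (j r) ω) ≤ ENNReal.ofReal (ℓ * ρ) := by
  have h1 : (ℓ : ℝ≥0∞)⁻¹ * tauVec (past X p) P (fun ω r => X (j r) ω) ≤ tauCoeff P X i := by
    unfold tauCoeff
    refine le_trans ?_ (le_iSup _ ℓ)
    unfold tauCoeffUpTo
    refine le_trans ?_ (le_iSup₂ (f := fun ℓ' (_ : ℓ' ∈ Finset.Icc 1 ℓ) => (ℓ' : ℝ≥0∞)⁻¹ *
      ⨆ (p : ℤ) (j : Fin ℓ' → ℤ) (_ : StrictMono j) (_ : ∀ r, p + (i : ℤ) ≤ j r),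
      tauVec (past X p) P (fun ω r => X (j r) ω)) ℓ (Finset.mem_Icc.2 ⟨hℓ, le_rfl⟩))
    refine mul_le_mul_right ?_ _
    exact le_iSup_of_le p (le_iSup_of_le j (le_iSup_of_le hj (le_iSup_of_le hp le_rfl)))
  have h0 : (ℓ : ℝ≥0∞) ≠ 0 := by exact_mod_cast (by omega : ℓ ≠ 0)
  have ht : (ℓ : ℝ≥0∞) ≠ ∞ := ENNReal.natCast_ne_top ℓ
  calc tauVec (past X p) P (fun ω r => X (j r) ω)
      = ℓ * ((ℓ : ℝ≥0∞)⁻¹ * tauVec (past X p) P (fun ω r => X (j r) ω)) := by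
        rw [← mul_assoc, ENNReal.mul_inv_cancel h0 ht, one_mul]
    _ ≤ ℓ * ENNReal.ofReal ρ := by gcongr; exact h1.trans hτ
    _ = ENNReal.ofReal (ℓ * ρ) := by
        rw [ENNReal.ofReal_mul (by positivity), ENNReal.ofReal_natCast]

/-- Decoupling of a function of the past from a Lipschitz function of the future. -/
theorem abs_integral_mul_sub_le_of_tauCoeff_le {Ω : Type*} [mΩ : MeasurableSpace Ω] {P : Measure Ω}
    [IsProbabilityMeasure P] {X : ℤ → Ω → ℝ} (hX : ∀ j, Measurable (X j))
    (hint : ∀ j, Integrable (X j) P) {i : ℕ} {ρ : ℝ} (hρ : 0 ≤ ρ)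
    (hτ : tauCoeff P X i ≤ ENNReal.ofReal ρ) {p : ℤ} {J : Finset ℤ}
    (hJ : ∀ j ∈ J, p + (i : ℤ) ≤ j) {ψ : ℤ → ℝ → ℝ} (hψ : ∀ j x y, |ψ j x - ψ j y| ≤ |x - y|)
    {H : ℝ → ℝ} {Λ : ℝ} (hΛ : 0 ≤ Λ) (hH : ∀ x y, |H x - H y| ≤ Λ * |x - y|)
    {G : Ω → ℝ} {B : ℝ} (hG : Measurable[past X p] G) (hB : ∀ ω, |G ω| ≤ B) :
    |∫ ω, G ω * H (∑ j ∈ J, ψ j (X j ω)) ∂P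
      - (∫ ω, G ω ∂P) * ∫ ω, H (∑ j ∈ J, ψ j (X j ω)) ∂P| ≤ B * Λ * J.card * ρ := by
  rcases J.eq_empty_or_nonempty with rfl | hne
  · simp [integral_mul_const]
  rcases hΛ.eq_or_lt with rfl | hΛ
  · have hc : ∀ x, H x = H 0 := fun x => by
      have := hH x 0
      rw [zero_mul] at this
      exact sub_eq_zero.1 (abs_nonpos_iff.1 this)
    have hc' : ∀ ω, H (∑ j ∈ J, ψ j (X j ω)) = H 0 := fun ω => hc _
    simp [hc', integral_mul_const]
  have hψc : ∀ j, Measurable (ψ j) := fun j => by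
    refine (LipschitzWith.of_dist_le_mul (K := 1) fun x y => ?_).continuous.measurable
    simpa [Real.dist_eq] using hψ j x y
  have hHc : Measurable H := by
    refine (LipschitzWith.of_dist_le_mul (K := ⟨Λ, hΛ.le⟩) fun x y => ?_).continuous.measurable
    simpa [Real.dist_eq] using! hH x y
  set e := J.orderEmbOfFin rfl with he
  have hsum : ∀ x : ℤ → ℝ, ∑ r, ψ (e r) (x (e r)) = ∑ j ∈ J, ψ j (x j) := fun x => by
    have h1 : Finset.univ.image e = J := Finset.image_orderEmbOfFin_univ J rfl
    conv_rhs => rw [← h1]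
    rw [Finset.sum_image (fun a _ b _ h => e.injective h)]
  -- Division by `Λ` makes this function 1-Lipschitz for the `ℓ¹` distance, as `tauVec` requires;
  -- this is why `Λ = 0` was treated apart.
  set f : (Fin J.card → ℝ) → ℝ := fun y => Λ⁻¹ * H (∑ r, ψ (e r) (y r)) with hf
  have hfl : ∀ x y, |f x - f y| ≤ ∑ r, |x r - y r| := fun x y => by
    simp only [hf]
    rw [← mul_sub, abs_mul, abs_of_pos (inv_pos.2 hΛ), inv_mul_le_iff₀ hΛ]
    refine (hH _ _).trans (mul_le_mul_of_nonneg_left ?_ hΛ.le)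
    rw [← Finset.sum_sub_distrib]
    exact (Finset.abs_sum_le_sum_abs _ _).trans (Finset.sum_le_sum fun r _ => hψ _ _ _)
  set Y : Ω → ℝ := fun ω => f (fun r => X (e r) ω) with hYdef
  have hYeq : ∀ ω, H (∑ j ∈ J, ψ j (X j ω)) = Λ * Y ω := fun ω => by
    simp only [hYdef, hf]
    rw [hsum (fun j => X j ω)]
    field_simp
  have hYm : Measurable Y := by
    simp only [hYdef, hf]
    exact (hHc.comp (Finset.measurable_sum _ fun r _ => (hψc _).comp (hX _))).const_mul _
  have hYint : Integrable Y P := by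
    refine Integrable.mono' (g := fun ω => |f 0| + ∑ r, |X (e r) ω|)
      ((integrable_const _).add (integrable_finsetSum _ fun r _ => (hint _).abs))
      hYm.aestronglyMeasurable (Filter.Eventually.of_forall fun ω => ?_)
    have := hfl (fun r => X (e r) ω) 0
    simp only [Pi.zero_apply, sub_zero] at this
    rw [Real.norm_eq_abs]
    calc |Y ω| = |f 0 + (Y ω - f 0)| := by ring_nf
      _ ≤ |f 0| + |Y ω - f 0| := abs_add_le _ _
      _ ≤ _ := by gcongr
  have hτY : tauReal (past X p) P Y ≤ ENNReal.ofReal (J.card * ρ) := by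
    refine le_trans ?_ (tauVec_le_of_tauCoeff_le hτ (Finset.card_pos.2 hne) (p := p) (j := e)
      e.strictMono (fun r => hJ _ (J.orderEmbOfFin_mem rfl r)))
    exact le_iSup₂ (f := fun (f : (Fin J.card → ℝ) → ℝ)
      (_ : ∀ x y, |f x - f y| ≤ ∑ r, |x r - y r|) =>
        tauReal (past X p) P (fun ω => f (fun r => X (e r) ω))) f hfl
  have key := abs_integral_mul_sub_le_of_tauReal_le (past_le hX p) P hYm hYint (by positivity)
    hτY hG hB
  simp only [hYeq]
  have h1 : ∀ ω, G ω * (Λ * Y ω) = Λ * (G ω * Y ω) := fun ω => by ring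
  simp only [h1, integral_const_mul]
  rw [show Λ * ∫ ω, G ω * Y ω ∂P - (∫ ω, G ω ∂P) * (Λ * ∫ ω, Y ω ∂P)
    = Λ * (∫ ω, G ω * Y ω ∂P - (∫ ω, G ω ∂P) * ∫ ω, Y ω ∂P) by ring, abs_mul, abs_of_pos hΛ]
  calc Λ * _ ≤ Λ * (B * (J.card * ρ)) := by gcongr
    _ = _ := by ring

/-! ### Tails and moments. -/

/-- With `y = c * x ^ δ`, one term `y ^ N / N!` of the exponential series, `N > p / δ`, already
dominates the power. -/
theorem exists_rpow_mul_exp_neg_le (p : ℝ) {c δ : ℝ} (hc : 0 < c) (hδ : 0 < δ) :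
    ∃ C : ℝ, 0 < C ∧ ∀ x : ℝ, 1 ≤ x → x ^ p * Real.exp (-(c * x ^ δ)) ≤ C := by
  obtain ⟨N, hN⟩ := exists_nat_gt (p / δ)
  refine ⟨N.factorial / c ^ N, by positivity, fun x hx => ?_⟩
  have hx0 : 0 < x := by linarith
  have hy : 0 < c * x ^ δ := by positivity
  have h1 := Real.pow_div_factorial_le_exp (c * x ^ δ) hy.le N
  have h2 : x ^ p ≤ (x ^ δ) ^ N := by
    rw [← Real.rpow_natCast, ← Real.rpow_mul hx0.le]
    refine Real.rpow_le_rpow_of_exponent_le hx ?_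
    rw [div_lt_iff₀ hδ] at hN
    linarith
  rw [Real.exp_neg, ← div_eq_mul_inv, div_le_div_iff₀ (Real.exp_pos _) (by positivity)]
  rw [div_le_iff₀ (by positivity)] at h1
  calc x ^ p * c ^ N ≤ (x ^ δ) ^ N * c ^ N := by gcongr
    _ = (c * x ^ δ) ^ N := by rw [mul_pow]; ring
    _ ≤ _ := by linarith

/-- The hypotheses on the sequence, with the tail condition in a form that covers `γ₂ = ∞`:
`b = 1 / γ₂`. -/
structure IsMixing {Ω : Type*} [MeasurableSpace Ω] (P : Measure Ω) [IsFiniteMeasure P]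
    (X : ℤ → Ω → ℝ) (c γ₁ b : ℝ) : Prop where
  meas : ∀ j, Measurable (X j)
  integrable : ∀ j, Integrable (X j) P
  mean : ∀ j, ∫ ω, X j ω ∂P = 0
  tau : ∀ i : ℕ, 1 ≤ i → tauCoeff P X i ≤ ENNReal.ofReal (Real.exp (-(c * (i : ℝ) ^ γ₁)))
  tail : ∀ k : ℤ, 0 < k → ∀ s : ℝ, 0 < s → P.real {ω | s ^ b < |X k ω|} ≤ Real.exp (1 - s)

/-- A bound for the fourth moments of the sequence. -/
noncomputable def momentBound (b : ℝ) : ℝ := 1 + ∑' k : ℕ, ((k : ℝ) + 2) ^ (4 * b) * Real.exp (-k)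

theorem summable_moment (b : ℝ) :
    Summable fun k : ℕ => ((k : ℝ) + 2) ^ (4 * b) * Real.exp (-k) := by
  obtain ⟨C, hC, h⟩ := exists_rpow_mul_exp_neg_le (4 * b) (c := 1 / 2) (δ := 1) (by norm_num)
    one_pos
  have hs : Summable fun k : ℕ => C * Real.exp 1 * Real.exp (-(1 / 2 : ℝ)) ^ k :=
    (summable_geometric_of_lt_one (Real.exp_pos _).le (by
      rw [Real.exp_lt_one_iff]; norm_num)).mul_left _
  refine Summable.of_nonneg_of_le (fun k => by positivity) (fun k => ?_) hs
  have h1 := h ((k : ℝ) + 2) (by linarith [(Nat.cast_nonneg k : (0 : ℝ) ≤ k)])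
  rw [Real.rpow_one] at h1
  rw [← Real.exp_nat_mul]
  calc ((k : ℝ) + 2) ^ (4 * b) * Real.exp (-k)
      = (((k : ℝ) + 2) ^ (4 * b) * Real.exp (-(1 / 2 * ((k : ℝ) + 2)))) *
        (Real.exp 1 * Real.exp (k * -(1 / 2))) := by
        rw [← Real.exp_add, mul_assoc, ← Real.exp_add]; ring_nf
    _ ≤ C * (Real.exp 1 * Real.exp (k * -(1 / 2))) := by gcongr
    _ = _ := by ring

theorem one_le_momentBound (b : ℝ) : 1 ≤ momentBound b := by
  have : 0 ≤ ∑' k : ℕ, ((k : ℝ) + 2) ^ (4 * b) * Real.exp (-k) :=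
    tsum_nonneg fun k => by positivity
  unfold momentBound
  linarith

section

variable {Ω : Type*} [mΩ : MeasurableSpace Ω] {P : Measure Ω} [IsProbabilityMeasure P]
  {X : ℤ → Ω → ℝ} {c γ₁ b : ℝ}

/-- The levels need not tend to infinity (`b = 0` is the case `γ₂ = ∞`), so this rests on the tail
bound: exceeding all levels has probability at most `exp(-m)` for every `m`. -/
theorem IsMixing.ae_exists_le (h : IsMixing P X c γ₁ b) {k : ℤ} (hk : 0 < k) :
    ∀ᵐ ω ∂P, ∃ m : ℕ, |X k ω| ≤ ((m : ℝ) + 1) ^ b := by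
  rw [ae_iff]
  have hle : ∀ m : ℕ, P {ω | ¬ ∃ m : ℕ, |X k ω| ≤ ((m : ℝ) + 1) ^ b} ≤
      ENNReal.ofReal (Real.exp (-(m : ℝ))) := fun m => by
    have h1 := h.tail k hk ((m : ℝ) + 1) (by positivity)
    rw [show (1 : ℝ) - (m + 1) = -m by ring] at h1
    refine (measure_mono (t := {ω | ((m : ℝ) + 1) ^ b < |X k ω|}) fun ω hω => ?_).trans ?_
    · simp only [Set.mem_ofPred_eq, not_exists, not_le] at hω ⊢
      exact hω m
    · exact (ENNReal.le_ofReal_iff_toReal_le (measure_ne_top _ _) (Real.exp_pos _).le).2 h1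
  have : Filter.Tendsto (fun m : ℕ => ENNReal.ofReal (Real.exp (-(m : ℝ)))) Filter.atTop
      (nhds (ENNReal.ofReal 0)) := by
    refine ENNReal.tendsto_ofReal ?_
    exact Real.tendsto_exp_neg_atTop_nhds_zero.comp tendsto_natCast_atTop_atTop
  rw [ENNReal.ofReal_zero] at this
  exact le_antisymm (ge_of_tendsto' this hle) zero_le

theorem IsMixing.lintegral_pow_four_le (h : IsMixing P X c γ₁ b) {k : ℤ}
    (hk : 0 < k) :
    ∫⁻ ω, ENNReal.ofReal (|X k ω| ^ 4) ∂P ≤ ENNReal.ofReal (momentBound b) := by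
  set S : ℕ → Set Ω := fun m => {ω | ((m : ℝ) + 1) ^ b < |X k ω|} with hS
  have hSm : ∀ m, MeasurableSet (S m) := fun m =>
    measurableSet_lt measurable_const (h.meas k).abs
  have hpt : ∀ᵐ ω ∂P, ENNReal.ofReal (|X k ω| ^ 4) ≤
      1 + ∑' m : ℕ, (S m).indicator (fun _ => ENNReal.ofReal (((m : ℝ) + 2) ^ (4 * b))) ω := by
    filter_upwards [h.ae_exists_le hk] with ω hω
    rcases le_or_gt |X k ω| 1 with h1 | h1
    · refine le_trans ?_ le_self_add
      exact ENNReal.ofReal_le_one.2 (pow_le_one₀ (abs_nonneg _) h1)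
    -- The least level that dominates `|X k ω|` locates its shell: `(m + 1) ^ b < |X k ω| ≤ (m + 2)
    -- ^ b`.
    · classical
      have hf := Nat.find_spec hω
      have hpos : Nat.find hω ≠ 0 := fun h0 => by
        rw [h0] at hf
        simp at hf
        linarith
      obtain ⟨m, hm⟩ := Nat.exists_eq_succ_of_ne_zero hpos
      have hmin := Nat.find_min hω (m := m) (by omega)
      rw [hm] at hf
      push_cast at hf
      refine le_trans ?_ le_add_self
      refine le_trans ?_ (ENNReal.le_tsum m)
      rw [Set.indicator_of_mem (by simpa [hS] using hmin)]
      refine ENNReal.ofReal_le_ofReal ?_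
      rw [show 4 * b = b * (4 : ℕ) by push_cast; ring, Real.rpow_mul (by positivity),
        Real.rpow_natCast]
      refine pow_le_pow_left₀ (abs_nonneg _) (hf.trans (le_of_eq ?_)) 4
      congr 1; ring
  calc ∫⁻ ω, ENNReal.ofReal (|X k ω| ^ 4) ∂P
      ≤ ∫⁻ ω, (1 + ∑' m : ℕ,
        (S m).indicator (fun _ => ENNReal.ofReal (((m : ℝ) + 2) ^ (4 * b))) ω) ∂P :=
        lintegral_mono_ae hpt
    _ = 1 + ∑' m : ℕ, ENNReal.ofReal (((m : ℝ) + 2) ^ (4 * b)) * P (S m) := by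
        rw [lintegral_add_left measurable_const, lintegral_tsum
          (fun m => (measurable_const.indicator (hSm m)).aemeasurable)]
        simp [lintegral_indicator_const (hSm _)]
    _ ≤ 1 + ∑' m : ℕ, ENNReal.ofReal (((m : ℝ) + 2) ^ (4 * b) * Real.exp (-m)) := by
        gcongr with m
        rw [ENNReal.ofReal_mul (by positivity)]
        gcongr
        have h1 := h.tail k hk ((m : ℝ) + 1) (by positivity)
        rw [show (1 : ℝ) - (m + 1) = -m by ring] at h1
        exact (ENNReal.le_ofReal_iff_toReal_le (measure_ne_top _ _) (Real.exp_pos _).le).2 h1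
    _ = ENNReal.ofReal (momentBound b) := by
        rw [← ENNReal.ofReal_tsum_of_nonneg (fun m => by positivity) (summable_moment b),
          momentBound, ENNReal.ofReal_add zero_le_one (tsum_nonneg fun m => by positivity),
          ENNReal.ofReal_one]

theorem IsMixing.integrable_pow_four (h : IsMixing P X c γ₁ b) {k : ℤ}
    (hk : 0 < k) : Integrable (fun ω => X k ω ^ 4) P := by
  refine ⟨((h.meas k).pow_const 4).aestronglyMeasurable, ?_⟩
  rw [hasFiniteIntegral_iff_norm]
  refine lt_of_le_of_lt ?_ ((h.lintegral_pow_four_le hk).trans_lt ENNReal.ofReal_lt_top)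
  simp

theorem IsMixing.integral_pow_four_le (h : IsMixing P X c γ₁ b) {k : ℤ}
    (hk : 0 < k) : ∫ ω, X k ω ^ 4 ∂P ≤ momentBound b := by
  rw [integral_eq_lintegral_of_nonneg_ae (Filter.Eventually.of_forall fun ω => by
    simp only [Pi.zero_apply]; positivity) (h.integrable_pow_four hk).aestronglyMeasurable]
  refine ENNReal.toReal_le_of_le_ofReal (by linarith [one_le_momentBound b]) ?_
  refine le_trans (le_of_eq ?_) (h.lintegral_pow_four_le hk)
  congr 1; ext ω
  rw [← abs_pow, abs_of_nonneg (by positivity : 0 ≤ X k ω ^ 4)]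

/-- The part of `|X_k|` above the level `s ^ b` is exponentially small, even after multiplication
with a variable with the same moments. -/
theorem IsMixing.integral_indicator_mul_le (h : IsMixing P X c γ₁ b) {k : ℤ}
    (hk : 0 < k) {s : ℝ} (hs : 0 < s) {Y : Ω → ℝ} {K : ℝ} (hY : Measurable Y)
    (hYi : Integrable (fun ω => X k ω ^ 2 * Y ω ^ 2) P)
    (hYK : ∫ ω, X k ω ^ 2 * Y ω ^ 2 ∂P ≤ K) :
    Integrable ({ω | s ^ b < |X k ω|}.indicator fun ω => |X k ω| * |Y ω|) P ∧
    ∫ ω, {ω | s ^ b < |X k ω|}.indicator (fun ω => |X k ω| * |Y ω|) ω ∂P ≤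
      (2 + K) * Real.exp (-(s / 2)) := by
  set S := {ω | s ^ b < |X k ω|} with hS
  have hSm : MeasurableSet S := measurableSet_lt measurable_const (h.meas k).abs
  have hdom : Integrable (fun ω => Real.exp (-(s / 2)) / 2 * (X k ω ^ 2 * Y ω ^ 2) +
      S.indicator (fun _ => Real.exp (s / 2) / 2) ω) P :=
    (hYi.const_mul _).add ((integrable_const _).indicator hSm)
  -- The weights in `2uv ≤ u² + v²` are chosen so that both terms end up of order `exp(-s / 2)`: the
  -- constant `exp(s / 2) / 2` is only integrated over a set of measure at most `exp(1 - s)`.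
  have hpt : ∀ ω, S.indicator (fun ω => |X k ω| * |Y ω|) ω ≤
      Real.exp (-(s / 2)) / 2 * (X k ω ^ 2 * Y ω ^ 2) +
      S.indicator (fun _ => Real.exp (s / 2) / 2) ω := fun ω => by
    by_cases hω : ω ∈ S
    · rw [Set.indicator_of_mem hω, Set.indicator_of_mem hω]
      set e := Real.exp (-(s / 4)) with he
      have he0 : 0 < e := Real.exp_pos _
      have h1 : Real.exp (-(s / 2)) = e ^ 2 := by rw [he, ← Real.exp_nat_mul]; ring_nf
      have h2 : Real.exp (s / 2) = (e⁻¹) ^ 2 := by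
        rw [he, ← Real.exp_neg, ← Real.exp_nat_mul]; ring_nf
      have h3 := two_mul_le_add_sq (e * (|X k ω| * |Y ω|)) e⁻¹
      have h4 : e * (|X k ω| * |Y ω|) * e⁻¹ = |X k ω| * |Y ω| := by field_simp
      have h5 : (e * (|X k ω| * |Y ω|)) ^ 2 = e ^ 2 * (X k ω ^ 2 * Y ω ^ 2) := by
        rw [mul_pow, mul_pow, sq_abs, sq_abs]
      rw [h1, h2]
      rw [h5, mul_assoc 2, h4] at h3
      linarith
    · rw [Set.indicator_of_notMem hω, Set.indicator_of_notMem hω]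
      positivity
  have hm : AEStronglyMeasurable (S.indicator fun ω => |X k ω| * |Y ω|) P :=
    (((h.meas k).abs.mul hY.abs).indicator hSm).aestronglyMeasurable
  have h0 : ∀ ω, 0 ≤ S.indicator (fun ω => |X k ω| * |Y ω|) ω := fun ω =>
    Set.indicator_nonneg (fun _ _ => by positivity) _
  have hi : Integrable (S.indicator fun ω => |X k ω| * |Y ω|) P := by
    refine hdom.mono' hm (Filter.Eventually.of_forall fun ω => ?_)
    rw [Real.norm_of_nonneg (h0 ω)]
    exact hpt ω
  refine ⟨hi, (integral_mono hi hdom hpt).trans ?_⟩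
  rw [integral_add (hYi.const_mul _) ((integrable_const _).indicator hSm), integral_const_mul,
    integral_indicator_const _ hSm, smul_eq_mul]
  have ht := h.tail k hk s hs
  have he1 : Real.exp 1 ≤ 4 := by have := Real.exp_one_lt_d9; linarith
  calc Real.exp (-(s / 2)) / 2 * ∫ ω, X k ω ^ 2 * Y ω ^ 2 ∂P + P.real S * (Real.exp (s / 2) / 2)
      ≤ Real.exp (-(s / 2)) / 2 * K + Real.exp (1 - s) * (Real.exp (s / 2) / 2) := by gcongr
    _ = Real.exp (-(s / 2)) * (K / 2 + Real.exp 1 / 2) := by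
        rw [show Real.exp (1 - s) * (Real.exp (s / 2) / 2) =
          (Real.exp (1 - s) * Real.exp (s / 2)) / 2 by ring, ← Real.exp_add,
          show 1 - s + s / 2 = -(s / 2) + 1 by ring, Real.exp_add]
        ring
    _ ≤ Real.exp (-(s / 2)) * (2 + K) := by
        have hK0 : 0 ≤ K := (integral_nonneg fun ω => by positivity).trans hYK
        refine mul_le_mul_of_nonneg_left ?_ (Real.exp_pos _).le
        linarith
    _ = _ := by ring

theorem IsMixing.integrable_sq (h : IsMixing P X c γ₁ b) {k : ℤ}
    (hk : 0 < k) : Integrable (fun ω => X k ω ^ 2) P := by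
  refine Integrable.mono' ((integrable_const (1 : ℝ)).add (h.integrable_pow_four hk))
    ((h.meas k).pow_const 2).aestronglyMeasurable (Filter.Eventually.of_forall fun ω => ?_)
  rw [Real.norm_of_nonneg (by positivity)]
  simp only [Pi.add_apply]
  nlinarith [sq_nonneg (X k ω ^ 2 - 1)]

theorem IsMixing.integral_sq_le (h : IsMixing P X c γ₁ b) {k : ℤ}
    (hk : 0 < k) : ∫ ω, X k ω ^ 2 ∂P ≤ 1 + momentBound b := by
  calc ∫ ω, X k ω ^ 2 ∂P ≤ ∫ ω, (1 + X k ω ^ 4) ∂P := by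
        refine integral_mono (h.integrable_sq hk)
          ((integrable_const (1 : ℝ)).add (h.integrable_pow_four hk)) fun ω => ?_
        simp only
        nlinarith [sq_nonneg (X k ω ^ 2 - 1)]
    _ = 1 + ∫ ω, X k ω ^ 4 ∂P := by
        rw [integral_add (integrable_const _) (h.integrable_pow_four hk)]; simp
    _ ≤ _ := by gcongr; exact h.integral_pow_four_le hk

/-! ### Truncation errors. -/

/-- The constant in the bound for the truncation error. -/
noncomputable def truncErr (b : ℝ) : ℝ := 3 + momentBound b

theorem truncErr_pos (b : ℝ) : 0 < truncErr b := by
  have := one_le_momentBound b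
  unfold truncErr
  linarith

theorem IsMixing.integrable_indicator_abs (h : IsMixing P X c γ₁ b) (k : ℤ) (s : ℝ) :
    Integrable ({ω | s ^ b < |X k ω|}.indicator fun ω => |X k ω|) P :=
  (h.integrable k).abs.indicator (measurableSet_lt measurable_const (h.meas k).abs)

theorem IsMixing.integral_indicator_abs_le (h : IsMixing P X c γ₁ b) {k : ℤ}
    (hk : 0 < k) {s : ℝ} (hs : 0 < s) :
    ∫ ω, {ω | s ^ b < |X k ω|}.indicator (fun ω => |X k ω|) ω ∂P ≤
      truncErr b * Real.exp (-(s / 2)) := by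
  have := (h.integral_indicator_mul_le hk hs (Y := fun _ => 1) (K := 1 + momentBound b)
    measurable_const (by simpa using h.integrable_sq hk)
    (by simpa using h.integral_sq_le hk)).2
  simp only [abs_one, mul_one] at this
  refine this.trans (le_of_eq ?_)
  unfold truncErr
  ring

theorem measurable_trunc (M : ℝ) : Measurable (trunc M) := by
  unfold trunc
  fun_prop

theorem abs_trunc_le {M : ℝ} (hM : 0 ≤ M) (x : ℝ) : |trunc M x| ≤ M := by
  unfold trunc
  rw [abs_le]
  exact ⟨le_max_right _ _, max_le (min_le_right _ _) (by linarith)⟩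

theorem abs_trunc_le_abs {M : ℝ} (hM : 0 ≤ M) (x : ℝ) : |trunc M x| ≤ |x| := by
  unfold trunc
  rw [abs_le]
  refine ⟨?_, max_le ((min_le_left _ _).trans (le_abs_self x)) (by linarith [abs_nonneg x])⟩
  rcases le_total x M with h | h
  · rw [min_eq_left h]
    exact (neg_abs_le x).trans (le_max_left _ _)
  · rw [min_eq_right h]
    exact le_trans (by linarith [abs_nonneg x]) (le_max_left _ _)

theorem trunc_eq_self {M x : ℝ} (h : |x| ≤ M) : trunc M x = x := by
  rw [abs_le] at h
  unfold trunc
  rw [min_eq_left h.2, max_eq_left h.1]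

theorem abs_trunc_sub_trunc_le (M x y : ℝ) : |trunc M x - trunc M y| ≤ |x - y| := by
  unfold trunc
  refine (abs_max_sub_max_le_abs _ _ _).trans ?_
  exact (abs_min_sub_min_le_max _ _ _ _).trans (by simp)

theorem abs_sub_trunc_le {M : ℝ} (hM : 0 ≤ M) (x : ℝ) :
    |x - trunc M x| ≤ {x : ℝ | M < |x|}.indicator (fun x => |x|) x := by
  rcases le_or_gt |x| M with h | h
  · rw [trunc_eq_self h]; simp only [sub_self, abs_zero]
    exact Set.indicator_nonneg (fun _ _ => abs_nonneg _) _
  · rw [Set.indicator_of_mem (by exact h)]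
    rcases le_total 0 x with hx | hx
    · rw [abs_of_nonneg hx] at h ⊢
      have : trunc M x = M := by
        unfold trunc; rw [min_eq_right h.le, max_eq_left (by linarith)]
      rw [this, abs_of_nonneg (by linarith)]
      linarith
    · rw [abs_of_nonpos hx] at h ⊢
      have : trunc M x = -M := by
        unfold trunc; rw [min_eq_left (by linarith), max_eq_right (by linarith)]
      rw [this, abs_of_nonpos (by linarith)]
      linarith

theorem trunc_trunc {m M : ℝ} (hm : 0 ≤ m) (hmM : m ≤ M) (x : ℝ) :
    trunc m (trunc M x) = trunc m x := by
  unfold trunc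
  rcases le_total x M with h1 | h1 <;> rcases le_total x m with h2 | h2 <;>
    rcases le_total x (-M) with h3 | h3 <;> rcases le_total x (-m) with h4 | h4 <;>
    simp_all <;> grind

theorem abs_trunc_sub_trunc_level_le {m M : ℝ} (hm : 0 ≤ m) (hmM : m ≤ M) (x : ℝ) :
    |trunc M x - trunc m x| ≤ {x : ℝ | m < |x|}.indicator (fun x => |x|) x := by
  have h1 := abs_sub_trunc_le hm (trunc M x)
  rw [trunc_trunc hm hmM] at h1
  refine h1.trans ?_
  have h2 := abs_trunc_le_abs (hm.trans hmM) x
  by_cases h3 : m < |trunc M x|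
  · rw [Set.indicator_of_mem (show trunc M x ∈ {x : ℝ | m < |x|} from h3),
      Set.indicator_of_mem (show x ∈ {x : ℝ | m < |x|} from h3.trans_le h2)]
    exact h2
  · rw [Set.indicator_of_notMem (show trunc M x ∉ {x : ℝ | m < |x|} from h3)]
    exact Set.indicator_nonneg (fun _ _ => abs_nonneg _) _

theorem IsMixing.measurable_trunc (h : IsMixing P X c γ₁ b) (k : ℤ) (M : ℝ) :
    Measurable (fun ω => trunc M (X k ω)) := (TauMixing.measurable_trunc M).comp (h.meas k)

theorem IsMixing.memLp_trunc (h : IsMixing P X c γ₁ b) (k : ℤ) {M : ℝ} (hM : 0 ≤ M)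
    (p : ℝ≥0∞) : MemLp (fun ω => trunc M (X k ω)) p P :=
  MemLp.of_bound (h.measurable_trunc k M).aestronglyMeasurable M
    (Filter.Eventually.of_forall fun _ => abs_trunc_le hM _)

theorem IsMixing.integrable_trunc (h : IsMixing P X c γ₁ b) (k : ℤ) {M : ℝ} (hM : 0 ≤ M) :
    Integrable (fun ω => trunc M (X k ω)) P := (h.memLp_trunc k hM 1).integrable le_rfl

/-- As `X k` is centered, the mean of its truncation is minus the mean of the part cut off. -/
theorem IsMixing.abs_integral_trunc_le (h : IsMixing P X c γ₁ b) {k : ℤ}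
    (hk : 0 < k) {s : ℝ} (hs : 0 < s) :
    |∫ ω, trunc (s ^ b) (X k ω) ∂P| ≤ truncErr b * Real.exp (-(s / 2)) := by
  have hM : 0 ≤ s ^ b := by positivity
  have h1 : ∫ ω, trunc (s ^ b) (X k ω) ∂P = -∫ ω, (X k ω - trunc (s ^ b) (X k ω)) ∂P := by
    rw [integral_sub (h.integrable k) (h.integrable_trunc k hM), h.mean k]
    ring
  rw [h1, abs_neg]
  refine abs_integral_le_integral_abs.trans (le_trans ?_ (h.integral_indicator_abs_le hk hs))
  exact integral_mono ((h.integrable k).sub (h.integrable_trunc k hM)).abs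
    (h.integrable_indicator_abs k s) fun _ => abs_sub_trunc_le hM _

theorem IsMixing.integral_abs_trunc_sub_trunc_le (h : IsMixing P X c γ₁ b) {k : ℤ}
    (hk : 0 < k) {s M : ℝ} (hs : 0 < s) (hM : s ^ b ≤ M) :
    ∫ ω, |trunc M (X k ω) - trunc (s ^ b) (X k ω)| ∂P ≤ truncErr b * Real.exp (-(s / 2)) := by
  have hM0 : 0 ≤ s ^ b := by positivity
  refine le_trans ?_ (h.integral_indicator_abs_le hk hs)
  exact integral_mono ((h.integrable_trunc k (hM0.trans hM)).sub (h.integrable_trunc k hM0)).abs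
    (h.integrable_indicator_abs k s) fun ω => abs_trunc_sub_trunc_level_le hM0 hM _

theorem IsMixing.integral_abs_le (h : IsMixing P X c γ₁ b) {k : ℤ} (hk : 0 < k) :
    ∫ ω, |X k ω| ∂P ≤ truncErr b := by
  calc ∫ ω, |X k ω| ∂P ≤ ∫ ω, (1 + X k ω ^ 2) ∂P := by
        refine integral_mono (h.integrable k).abs
          ((integrable_const (1 : ℝ)).add (h.integrable_sq hk)) fun ω => ?_
        simp only
        nlinarith [sq_abs (X k ω), sq_nonneg (|X k ω| - 1)]
    _ = 1 + ∫ ω, X k ω ^ 2 ∂P := by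
        rw [integral_add (integrable_const _) (h.integrable_sq hk)]; simp
    _ ≤ _ := by
        have := h.integral_sq_le hk
        unfold truncErr
        linarith

/-! ### Covariances, finiteness of `V` and variances of sums. -/

/-- The bound is free of `M` because the earlier variable is cut again at a level `k ^ b` tied to
the lag `k`. Below this level decoupling costs `k ^ b * exp(-c k ^ γ₁)`; the part above is
exponentially small, even when multiplied with the later variable. -/
theorem IsMixing.abs_covariance_trunc_le (h : IsMixing P X c γ₁ b) {M : ℝ}
    (hM : 1 ≤ M) {i : ℤ} (hi : 0 < i) {k : ℕ} (hk : 1 ≤ k) :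
    |covariance (fun ω => trunc M (X i ω)) (fun ω => trunc M (X (i + k) ω)) P| ≤
      (k : ℝ) ^ b * Real.exp (-(c * (k : ℝ) ^ γ₁)) +
        truncErr b * (1 + truncErr b) * Real.exp (-((k : ℝ) / 2)) := by
  have hM0 : 0 ≤ M := by linarith
  have hk0 : (0 : ℝ) < k := by exact_mod_cast hk
  set m := min M ((k : ℝ) ^ b) with hm
  have hm0 : 0 ≤ m := le_min hM0 (by positivity)
  set U := fun ω => trunc M (X i ω) with hU
  set W := fun ω => trunc M (X (i + k) ω) with hW
  set G := fun ω => trunc m (X i ω) with hG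
  have hj : 0 < i + k := by omega
  have hUi : Integrable U P := h.integrable_trunc i hM0
  have hWi : Integrable W P := h.integrable_trunc _ hM0
  have hGi : Integrable G P := h.integrable_trunc i hm0
  have hbd : ∀ {F : Ω → ℝ}, Integrable F P → Integrable (fun ω => F ω * W ω) P := fun hF =>
    hF.mul_bdd (h.measurable_trunc _ M).aestronglyMeasurable
      (Filter.Eventually.of_forall fun ω => abs_trunc_le hM0 _)
  rw [covariance_eq_sub (h.memLp_trunc i hM0 2) (h.memLp_trunc _ hM0 2)]
  have hdec : |∫ ω, G ω * W ω ∂P - (∫ ω, G ω ∂P) * ∫ ω, W ω ∂P| ≤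
      (k : ℝ) ^ b * Real.exp (-(c * (k : ℝ) ^ γ₁)) := by
    have := abs_integral_mul_sub_le_of_tauCoeff_le h.meas h.integrable (Real.exp_pos _).le
      (h.tau k hk) (p := i) (J := {i + (k : ℤ)}) (by simp) (ψ := fun _ => trunc M)
      (fun _ => abs_trunc_sub_trunc_le M) (H := fun x => x) zero_le_one (by simp) (G := G) (B := m)
      ((TauMixing.measurable_trunc m).comp (measurable_past le_rfl)) (fun ω => abs_trunc_le hm0 _)
    simp only [Finset.sum_singleton, Finset.card_singleton, mul_one, Nat.cast_one] at this
    refine this.trans ?_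
    gcongr
    exact min_le_right _ _
  set S := {ω | (k : ℝ) ^ b < |X i ω|} with hS
  have hUG : ∀ ω, |U ω - G ω| ≤ S.indicator (fun ω => |X i ω|) ω := fun ω => by
    rcases le_total M ((k : ℝ) ^ b) with h1 | h1
    · rw [hU, hG, hm, min_eq_left h1]
      simp only [sub_self, abs_zero]
      exact Set.indicator_nonneg (fun _ _ => abs_nonneg _) _
    · rw [hU, hG, hm, min_eq_right h1]
      exact abs_trunc_sub_trunc_level_le (by positivity) h1 _
  have h44 : Integrable (fun ω => X i ω ^ 2 * X (i + k) ω ^ 2) P ∧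
      ∫ ω, X i ω ^ 2 * X (i + k) ω ^ 2 ∂P ≤ 1 + momentBound b := by
    have hd := ((h.integrable_pow_four hi).add (h.integrable_pow_four hj)).const_mul (1 / 2)
    have hle : ∀ ω, X i ω ^ 2 * X (i + k) ω ^ 2 ≤
        1 / 2 * ((fun ω => X i ω ^ 4) + fun ω => X (i + k) ω ^ 4) ω := fun ω => by
      simp only [Pi.add_apply]
      nlinarith [sq_nonneg (X i ω ^ 2 - X (i + k) ω ^ 2)]
    have hii : Integrable (fun ω => X i ω ^ 2 * X (i + k) ω ^ 2) P :=
      hd.mono' (((h.meas i).pow_const 2).mul ((h.meas _).pow_const 2)).aestronglyMeasurable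
        (Filter.Eventually.of_forall fun ω => by
          rw [Real.norm_of_nonneg (by positivity)]; exact hle ω)
    refine ⟨hii, (integral_mono hii hd hle).trans ?_⟩
    rw [integral_const_mul, integral_add' (h.integrable_pow_four hi)
      (h.integrable_pow_four hj)]
    have h1 := h.integral_pow_four_le hi
    have h2 := h.integral_pow_four_le hj
    linarith
  have hcross : |∫ ω, (U ω - G ω) * W ω ∂P| ≤ truncErr b * Real.exp (-((k : ℝ) / 2)) := by
    have h1 := h.integral_indicator_mul_le hi hk0 (Y := X (i + k)) (h.meas _) h44.1 h44.2
    refine abs_integral_le_integral_abs.trans ((integral_mono (hbd (hUi.sub hGi)).abs h1.1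
      fun ω => ?_).trans (h1.2.trans (le_of_eq (by unfold truncErr; ring))))
    simp only [abs_mul, Pi.sub_apply]
    by_cases hω : ω ∈ S
    · have := hUG ω
      rw [Set.indicator_of_mem hω] at this ⊢
      exact mul_le_mul this (abs_trunc_le_abs hM0 _) (abs_nonneg _) (abs_nonneg _)
    · have := hUG ω
      rw [Set.indicator_of_notMem hω] at this ⊢
      rw [le_antisymm this (abs_nonneg _), zero_mul]
  have hmeanU : |∫ ω, (U ω - G ω) ∂P| ≤ truncErr b * Real.exp (-((k : ℝ) / 2)) :=
    abs_integral_le_integral_abs.trans ((integral_mono (hUi.sub hGi).abs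
      (h.integrable_indicator_abs i k) hUG).trans (h.integral_indicator_abs_le hi hk0))
  have hmeanW : |∫ ω, W ω ∂P| ≤ truncErr b :=
    abs_integral_le_integral_abs.trans ((integral_mono hWi.abs (h.integrable _).abs
      fun ω => abs_trunc_le_abs hM0 _).trans (h.integral_abs_le hj))
  have e1 : ∫ ω, (U ω - G ω) * W ω ∂P = ∫ ω, U ω * W ω ∂P - ∫ ω, G ω * W ω ∂P := by
    rw [← integral_sub (hbd hUi) (hbd hGi)]
    congr 1; ext ω; ring
  have e2 : ∫ ω, (U ω - G ω) ∂P = ∫ ω, U ω ∂P - ∫ ω, G ω ∂P := integral_sub hUi hGi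
  have e3 : (P[U * W]) - (P[U]) * (P[W]) =
      (∫ ω, G ω * W ω ∂P - (∫ ω, G ω ∂P) * ∫ ω, W ω ∂P) + ∫ ω, (U ω - G ω) * W ω ∂P
        - (∫ ω, (U ω - G ω) ∂P) * ∫ ω, W ω ∂P := by
    rw [e1, e2]
    simp only [Pi.mul_apply]
    ring
  rw [e3]
  have h5 : |(∫ ω, (U ω - G ω) ∂P) * ∫ ω, W ω ∂P| ≤
      truncErr b * Real.exp (-((k : ℝ) / 2)) * truncErr b := by
    rw [abs_mul]
    exact mul_le_mul hmeanU hmeanW (abs_nonneg _) (by have := truncErr_pos b; positivity)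
  calc _ ≤ |∫ ω, G ω * W ω ∂P - (∫ ω, G ω ∂P) * ∫ ω, W ω ∂P| + |∫ ω, (U ω - G ω) * W ω ∂P|
        + |(∫ ω, (U ω - G ω) ∂P) * ∫ ω, W ω ∂P| := by
        refine (abs_sub _ _).trans ?_
        gcongr
        exact abs_add_le _ _
    _ ≤ _ := by linarith

theorem IsMixing.truncVar_lt_top (h : IsMixing P X c γ₁ b) (hc : 0 < c)
    (hγ₁ : 0 < γ₁) : truncVar P X < ∞ := by
  set g : ℕ → ℝ := fun k => (k : ℝ) ^ b * Real.exp (-(c * (k : ℝ) ^ γ₁)) +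
    truncErr b * (1 + truncErr b) * Real.exp (-((k : ℝ) / 2)) with hg
  have hte := truncErr_pos b
  have hg0 : ∀ k, 0 ≤ g k := fun k => by positivity
  have hgs : Summable g := by
    refine Summable.add ?_ ?_
    · obtain ⟨C, hC, hp⟩ := exists_rpow_mul_exp_neg_le (b + 2) hc hγ₁
      rw [← summable_nat_add_iff 1]
      have hs : Summable fun k : ℕ => C * (1 / ((k + 1 : ℕ) : ℝ) ^ 2) :=
        ((summable_nat_add_iff 1).2 (Real.summable_one_div_nat_pow.2 one_lt_two)).mul_left C
      refine Summable.of_nonneg_of_le (fun k => by positivity) (fun k => ?_) hs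
      have hk : (1 : ℝ) ≤ ((k + 1 : ℕ) : ℝ) := by push_cast; linarith [k.cast_nonneg (α := ℝ)]
      have := hp _ hk
      rw [mul_one_div, le_div_iff₀ (by positivity)]
      rw [Real.rpow_add (by linarith), show (2 : ℝ) = ((2 : ℕ) : ℝ) by norm_num,
        Real.rpow_natCast] at this
      nlinarith [this]
    · refine Summable.mul_left _ ?_
      have hs : Summable fun k : ℕ => Real.exp (-(1 / 2 : ℝ)) ^ k :=
        summable_geometric_of_lt_one (Real.exp_pos _).le (by
          rw [Real.exp_lt_one_iff]; norm_num)
      refine hs.congr fun k => ?_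
      rw [← Real.exp_nat_mul]
      ring_nf
  have hfin : ENNReal.ofReal (1 + momentBound b) + 2 * ∑' k, ENNReal.ofReal (g k) < ∞ := by
    refine ENNReal.add_lt_top.2 ⟨ENNReal.ofReal_lt_top, ENNReal.mul_lt_top (by simp) ?_⟩
    exact lt_top_iff_ne_top.2 hgs.tsum_ofReal_ne_top
  refine lt_of_le_of_lt ?_ hfin
  unfold truncVar
  refine iSup_le fun M => iSup_le fun hM => iSup_le fun i => iSup_le fun hi => ?_
  have hM0 : 0 ≤ M := by linarith
  refine add_le_add (ENNReal.ofReal_le_ofReal ?_) (mul_le_mul_right ?_ _)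
  · refine (variance_le_expectation_sq (h.measurable_trunc i M).aestronglyMeasurable).trans
      (le_trans ?_ (h.integral_sq_le hi))
    refine integral_mono (h.memLp_trunc i hM0 2).integrable_sq (h.integrable_sq hi) fun _ => ?_
    exact sq_le_sq.2 (abs_trunc_le_abs hM0 _)
  · have hinj : Function.Injective fun j : {j : ℤ // i < j} => (j.1 - i).toNat :=
      fun j j' hjj' => by
        have h1 := j.2
        have h2 := j'.2
        simp only at hjj'
        exact Subtype.ext (by omega)
    refine le_trans (ENNReal.tsum_le_tsum fun j => ?_)
      (ENNReal.tsum_comp_le_tsum_of_injective hinj fun k => ENNReal.ofReal (g k))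
    refine ENNReal.ofReal_le_ofReal ?_
    have hj := j.2
    have := h.abs_covariance_trunc_le hM hi (k := (j.1 - i).toNat) (by omega)
    rwa [show i + ((j.1 - i).toNat : ℤ) = j.1 by omega] at this

/-- In the double sum of covariances, each pair of distinct indices is charged twice to its smaller
index; every row is then at most `V`. -/
theorem IsMixing.variance_sum_trunc_le (h : IsMixing P X c γ₁ b) (hV : truncVar P X < ∞) {M : ℝ}
    (hM : 1 ≤ M) {K : Finset ℤ} (hK : ∀ i ∈ K, 0 < i) :
    variance (fun ω => ∑ i ∈ K, trunc M (X i ω)) P ≤ K.card * (truncVar P X).toReal := by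
  have hM0 : 0 ≤ M := by linarith
  set cv : ℤ → ℤ → ℝ := fun i j =>
    |covariance (fun ω => trunc M (X i ω)) (fun ω => trunc M (X j ω)) P| with hcv
  have hsymm : ∀ i j, cv i j = cv j i := fun i j => by simp only [hcv]; rw [covariance_comm]
  have hcv0 : ∀ i j, 0 ≤ cv i j := fun i j => abs_nonneg _
  have hrow : ∀ i ∈ K, cv i i + 2 * ∑ j ∈ K with i < j, cv i j ≤ (truncVar P X).toReal := by
    intro i hi
    have h1 : ENNReal.ofReal (variance (fun ω => trunc M (X i ω)) P) +
        2 * ∑' j : {j : ℤ // i < j}, ENNReal.ofReal (cv i j) ≤ truncVar P X := by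
      unfold truncVar
      exact le_iSup_of_le M (le_iSup_of_le hM (le_iSup_of_le i (le_iSup_of_le (hK i hi) le_rfl)))
    have h2 : ∑ j ∈ K with i < j, ENNReal.ofReal (cv i j) ≤
        ∑' j : {j : ℤ // i < j}, ENNReal.ofReal (cv i j) := by
      rw [← Finset.sum_subtype_of_mem (p := fun j => i < j) (fun j => ENNReal.ofReal (cv i j))
        (fun x hx => (Finset.mem_filter.1 hx).2)]
      exact ENNReal.sum_le_tsum _
    have hv : variance (fun ω => trunc M (X i ω)) P = cv i i := by
      simp only [hcv]
      rw [covariance_self (h.measurable_trunc i M).aemeasurable,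
        abs_of_nonneg (variance_nonneg _ _)]
    have h3 : ENNReal.ofReal (cv i i + 2 * ∑ j ∈ K with i < j, cv i j) ≤ truncVar P X := by
      rw [ENNReal.ofReal_add (hcv0 _ _) (mul_nonneg zero_le_two
        (Finset.sum_nonneg fun _ _ => hcv0 _ _)), ENNReal.ofReal_mul zero_le_two,
        ENNReal.ofReal_sum_of_nonneg fun _ _ => hcv0 _ _, ← hv]
      refine le_trans ?_ h1
      gcongr
      simp
    exact (ENNReal.ofReal_le_iff_le_toReal hV.ne).1 h3
  rw [show (fun ω => ∑ i ∈ K, trunc M (X i ω)) = ∑ i ∈ K, fun ω => trunc M (X i ω) by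
    ext ω; simp, variance_sum' fun i _ => h.memLp_trunc i hM0 2]
  calc _ ≤ ∑ i ∈ K, ∑ j ∈ K, cv i j :=
        Finset.sum_le_sum fun i _ => Finset.sum_le_sum fun j _ => le_abs_self _
    _ = ∑ i ∈ K, (cv i i + ∑ j ∈ K with i < j, cv i j + ∑ j ∈ K with j < i, cv i j) := by
        refine Finset.sum_congr rfl fun i hi => ?_
        rw [← Finset.sum_filter_add_sum_filter_not K (fun j => i < j),
          ← Finset.sum_filter_add_sum_filter_not (K.filter fun j => ¬ i < j) (fun j => j < i)]
        have e1 : (K.filter fun j => ¬ i < j).filter (fun j => j < i) = K.filter fun j => j < i := by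
          ext j; simp only [Finset.mem_filter]; grind
        have e2 : (K.filter fun j => ¬ i < j).filter (fun j => ¬ j < i) = {i} := by
          ext j; simp only [Finset.mem_filter, Finset.mem_singleton]; grind
        rw [e1, e2, Finset.sum_singleton]
        ring
    _ = ∑ i ∈ K, (cv i i + 2 * ∑ j ∈ K with i < j, cv i j) := by
        have : ∑ i ∈ K, ∑ j ∈ K with j < i, cv i j = ∑ i ∈ K, ∑ j ∈ K with i < j, cv i j := by
          simp only [Finset.sum_filter]
          rw [Finset.sum_comm]
          refine Finset.sum_congr rfl fun i _ => Finset.sum_congr rfl fun j _ => ?_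
          rw [hsymm]
        rw [Finset.sum_add_distrib, Finset.sum_add_distrib, this, Finset.sum_add_distrib,
          ← Finset.mul_sum]
        ring
    _ ≤ ∑ i ∈ K, (truncVar P X).toReal := Finset.sum_le_sum hrow
    _ = _ := by rw [Finset.sum_const, nsmul_eq_mul]

end

/-! ### Cantor-like sets. -/

/-- Finite sets of integers that arise from `2 ^ k` sets with at most `r` elements by `k` mergings,
where two sets merged at step `j + 1` are at distance at least `g j`. -/
def IsCantor (r : ℕ) (g : ℕ → ℕ) : ℕ → Finset ℤ → Prop
  | 0, K => K.card ≤ r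
  | k + 1, K => ∃ K₁ K₂, K = K₁ ∪ K₂ ∧ (∀ a ∈ K₁, ∀ b ∈ K₂, a + (g k : ℤ) ≤ b) ∧
      IsCantor r g k K₁ ∧ IsCantor r g k K₂

theorem IsCantor.card_le {r : ℕ} {g : ℕ → ℕ} : ∀ {k : ℕ} {K : Finset ℤ}, IsCantor r g k K →
    K.card ≤ 2 ^ k * r
  | 0, K, h => by simpa [IsCantor] using h
  | k + 1, K, h => by
      obtain ⟨K₁, K₂, rfl, -, h₁, h₂⟩ := h
      calc (K₁ ∪ K₂).card ≤ K₁.card + K₂.card := Finset.card_union_le _ _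
        _ ≤ 2 ^ k * r + 2 ^ k * r := add_le_add h₁.card_le h₂.card_le
        _ = _ := by ring

/-- Together with `IsCantor.shift`, this covers the pieces of translates that fall into an interval;
it is the reason for asking only `card ≤ r` at the bottom level. -/
theorem IsCantor.subset {r : ℕ} {g : ℕ → ℕ} : ∀ {k : ℕ} {K K' : Finset ℤ}, IsCantor r g k K →
    K' ⊆ K → IsCantor r g k K'
  | 0, K, K', h, hK => (Finset.card_le_card hK).trans h
  | k + 1, K, K', h, hK => by
      obtain ⟨K₁, K₂, rfl, hg, h₁, h₂⟩ := h
      refine ⟨K' ∩ K₁, K' ∩ K₂, ?_, fun a ha b hb => hg a (Finset.mem_inter.1 ha).2 b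
        (Finset.mem_inter.1 hb).2, h₁.subset Finset.inter_subset_right,
        h₂.subset Finset.inter_subset_right⟩
      rw [← Finset.inter_union_distrib_left, Finset.inter_eq_left.2 hK]

theorem IsCantor.shift {r : ℕ} {g : ℕ → ℕ} (w : ℤ) : ∀ {k : ℕ} {K : Finset ℤ},
    IsCantor r g k K → IsCantor r g k (K.image (· + w))
  | 0, K, h => Finset.card_image_le.trans h
  | k + 1, K, h => by
      obtain ⟨K₁, K₂, rfl, hg, h₁, h₂⟩ := h
      refine ⟨_, _, Finset.image_union _ _, fun a ha b hb => ?_, h₁.shift w, h₂.shift w⟩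
      obtain ⟨a', ha', rfl⟩ := Finset.mem_image.1 ha
      obtain ⟨b', hb', rfl⟩ := Finset.mem_image.1 hb
      have := hg a' ha' b' hb'
      omega

/-- The length of the interval that contains `cantorSet r g k`. -/
def cantorLength (r : ℕ) (g : ℕ → ℕ) : ℕ → ℕ
  | 0 => r
  | k + 1 => 2 * cantorLength r g k + g k

/-- A set with `IsCantor r g k` and the maximal number of elements. -/
noncomputable def cantorSet (r : ℕ) (g : ℕ → ℕ) : ℕ → Finset ℤ
  | 0 => Finset.Ico 0 (r : ℤ)
  | k + 1 => cantorSet r g k ∪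
      (cantorSet r g k).image (· + ((cantorLength r g k + g k : ℕ) : ℤ))

theorem mem_cantorSet {r : ℕ} {g : ℕ → ℕ} : ∀ {k : ℕ} {a : ℤ}, a ∈ cantorSet r g k →
    0 ≤ a ∧ a < cantorLength r g k
  | 0, a, h => Finset.mem_Ico.1 h
  | k + 1, a, h => by
      simp only [cantorSet, Finset.mem_union, Finset.mem_image] at h
      rcases h with h | ⟨b, h, rfl⟩
      · have := mem_cantorSet h
        simp only [cantorLength]
        push_cast
        omega
      · have := mem_cantorSet h
        simp only [cantorLength]
        push_cast
        omega

theorem isCantor_cantorSet (r : ℕ) (g : ℕ → ℕ) : ∀ k : ℕ, IsCantor r g k (cantorSet r g k)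
  | 0 => by simp [IsCantor, cantorSet]
  | k + 1 => by
      refine ⟨_, _, rfl, fun a ha b hb => ?_, isCantor_cantorSet r g k,
        (isCantor_cantorSet r g k).shift _⟩
      obtain ⟨b', hb', rfl⟩ := Finset.mem_image.1 hb
      have h1 := mem_cantorSet ha
      have h2 := mem_cantorSet hb'
      push_cast
      omega

theorem card_cantorSet (r : ℕ) (g : ℕ → ℕ) : ∀ k : ℕ, (cantorSet r g k).card = 2 ^ k * r
  | 0 => by simp [cantorSet]
  | k + 1 => by
      have hd : Disjoint (cantorSet r g k)
          ((cantorSet r g k).image (· + ((cantorLength r g k + g k : ℕ) : ℤ))) := by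
        rw [Finset.disjoint_left]
        intro a ha hb
        obtain ⟨b', hb', rfl⟩ := Finset.mem_image.1 hb
        have h1 := mem_cantorSet ha
        have h2 := mem_cantorSet hb'
        push_cast at h1
        omega
      rw [cantorSet, Finset.card_union_of_disjoint hd,
        Finset.card_image_of_injective _ (add_left_injective _), card_cantorSet r g k]
      ring

/-- Among the `2 ^ k` pieces, the gap `g j` occurs `2 ^ (k - 1 - j)` times. -/
theorem cantorLength_eq (r : ℕ) (g : ℕ → ℕ) : ∀ k : ℕ,
    (cantorLength r g k : ℝ) = 2 ^ k * (r + ∑ j ∈ Finset.range k, (g j : ℝ) / 2 ^ (j + 1))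
  | 0 => by simp [cantorLength]
  | k + 1 => by
      rw [cantorLength, Finset.sum_range_succ]
      push_cast
      rw [cantorLength_eq r g k]
      field_simp
      ring

/-! ### Laplace transforms of sums over Cantor-like sets. -/

theorem abs_exp_sub_exp_le {x y R : ℝ} (hx : |x| ≤ R) (hy : |y| ≤ R) :
    |Real.exp x - Real.exp y| ≤ Real.exp R * |x - y| := by
  wlog h : y ≤ x generalizing x y
  · rw [abs_sub_comm, abs_sub_comm x]
    exact this hy hx (le_of_not_ge h)
  rw [abs_of_nonneg (sub_nonneg.2 (Real.exp_le_exp.2 h)), abs_of_nonneg (sub_nonneg.2 h)]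
  have h1 := Real.add_one_le_exp (y - x)
  have h2 : Real.exp y = Real.exp x * Real.exp (y - x) := by rw [← Real.exp_add]; ring_nf
  have h3 : Real.exp x ≤ Real.exp R := Real.exp_le_exp.2 ((le_abs_self x).trans hx)
  have h4 := Real.exp_pos x
  nlinarith

/-- The integer `p` separates past from future in the decoupling; it must exist also when one of the
two sets is empty. -/
theorem exists_between_of_gap {K₁ K₂ : Finset ℤ} {g : ℕ}
    (h : ∀ a ∈ K₁, ∀ b ∈ K₂, a + (g : ℤ) ≤ b) :
    ∃ p : ℤ, (∀ a ∈ K₁, a ≤ p) ∧ ∀ b ∈ K₂, p + (g : ℤ) ≤ b := by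
  rcases K₁.eq_empty_or_nonempty with rfl | h1
  · rcases K₂.eq_empty_or_nonempty with rfl | h2
    · exact ⟨0, by simp, by simp⟩
    · refine ⟨K₂.min' h2 - g, by simp, fun b hb => ?_⟩
      have := K₂.min'_le b hb
      omega
  · exact ⟨K₁.max' h1, fun a ha => K₁.le_max' a ha, fun b hb => h _ (K₁.max'_mem h1) b hb⟩

section

variable {Ω : Type*} [mΩ : MeasurableSpace Ω] {P : Measure Ω} [IsProbabilityMeasure P]
  {X : ℤ → Ω → ℝ} {c γ₁ b : ℝ}

/-- The exponential is not Lipschitz on the line, but the sum stays in `[-R * L, R * L]`; composing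
with the truncation at `R * L` changes nothing and gives the Lipschitz constant `T * exp(T * (R *
L))`. -/
theorem IsMixing.abs_integral_mul_exp_sub_le (h : IsMixing P X c γ₁ b) {p : ℤ} {i : ℕ}
    (hi : 1 ≤ i) {J : Finset ℤ} (hJ : ∀ j ∈ J, p + (i : ℤ) ≤ j) {ψ : ℤ → ℝ → ℝ}
    (hψ : ∀ j x y, |ψ j x - ψ j y| ≤ |x - y|) {R : ℝ} (hR : 0 ≤ R) (hψR : ∀ j ∈ J, ∀ x, |ψ j x| ≤ R)
    {L : ℝ} (hL : (J.card : ℝ) ≤ L) {θ T : ℝ} (hθ : |θ| ≤ T) {G : Ω → ℝ} {B : ℝ}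
    (hG : Measurable[past X p] G) (hB0 : 0 ≤ B) (hB : ∀ ω, |G ω| ≤ B) :
    |∫ ω, G ω * Real.exp (θ * ∑ j ∈ J, ψ j (X j ω)) ∂P
      - (∫ ω, G ω ∂P) * ∫ ω, Real.exp (θ * ∑ j ∈ J, ψ j (X j ω)) ∂P| ≤
      B * (T * Real.exp (T * (R * L))) * L * Real.exp (-(c * (i : ℝ) ^ γ₁)) := by
  have hT : 0 ≤ T := (abs_nonneg θ).trans hθ
  have hL0 : 0 ≤ L := (Nat.cast_nonneg _).trans hL
  have hRL : 0 ≤ R * L := by positivity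
  have hsum : ∀ x : ℤ → ℝ, |∑ j ∈ J, ψ j (x j)| ≤ R * L := fun x => by
    calc |∑ j ∈ J, ψ j (x j)| ≤ ∑ j ∈ J, |ψ j (x j)| := Finset.abs_sum_le_sum_abs _ _
      _ ≤ ∑ j ∈ J, R := Finset.sum_le_sum fun j hj => hψR j hj _
      _ = J.card * R := by rw [Finset.sum_const, nsmul_eq_mul]
      _ ≤ L * R := by gcongr
      _ = R * L := mul_comm _ _
  have hb : ∀ x, |θ * trunc (R * L) x| ≤ T * (R * L) := fun x => by
    rw [abs_mul]
    exact mul_le_mul hθ (abs_trunc_le hRL x) (abs_nonneg _) hT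
  have key := abs_integral_mul_sub_le_of_tauCoeff_le h.meas h.integrable (Real.exp_pos _).le
    (h.tau i hi) (p := p) hJ hψ (H := fun x => Real.exp (θ * trunc (R * L) x))
    (Λ := T * Real.exp (T * (R * L))) (by positivity) (fun x y => ?_) hG hB
  · have e : ∀ ω, trunc (R * L) (∑ j ∈ J, ψ j (X j ω)) = ∑ j ∈ J, ψ j (X j ω) := fun ω =>
      trunc_eq_self (hsum fun j => X j ω)
    simp only [e] at key
    refine key.trans ?_
    gcongr
  · calc _ ≤ Real.exp (T * (R * L)) * |θ * trunc (R * L) x - θ * trunc (R * L) y| :=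
          abs_exp_sub_exp_le (hb x) (hb y)
      _ ≤ Real.exp (T * (R * L)) * (T * |x - y|) := by
          rw [← mul_sub, abs_mul]
          exact mul_le_mul_of_nonneg_left (mul_le_mul hθ (abs_trunc_sub_trunc_le _ _ _)
            (abs_nonneg _) hT) (Real.exp_pos _).le
      _ = _ := by ring

theorem abs_sum_trunc_le {M L : ℝ} (hM : 0 ≤ M) {K : Finset ℤ} (hL : (K.card : ℝ) ≤ L)
    (x : ℤ → ℝ) : |∑ i ∈ K, trunc M (x i)| ≤ M * L := by
  calc |∑ i ∈ K, trunc M (x i)| ≤ ∑ i ∈ K, |trunc M (x i)| := Finset.abs_sum_le_sum_abs _ _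
    _ ≤ ∑ i ∈ K, M := Finset.sum_le_sum fun i _ => abs_trunc_le hM _
    _ = K.card * M := by rw [Finset.sum_const, nsmul_eq_mul]
    _ ≤ L * M := by gcongr
    _ = M * L := mul_comm _ _

theorem IsMixing.measurable_sum_trunc (h : IsMixing P X c γ₁ b) (M : ℝ) (K : Finset ℤ) :
    Measurable fun ω => ∑ i ∈ K, trunc M (X i ω) :=
  Finset.measurable_sum _ fun i _ => h.measurable_trunc i M

theorem IsMixing.integrable_exp_sum_trunc (h : IsMixing P X c γ₁ b) {M : ℝ} (hM : 0 ≤ M)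
    (K : Finset ℤ) (θ : ℝ) : Integrable (fun ω => Real.exp (θ * ∑ i ∈ K, trunc M (X i ω))) P := by
  refine Integrable.of_bound (C := Real.exp (|θ| * (M * K.card)))
    ((h.measurable_sum_trunc M K).const_mul θ).exp.aestronglyMeasurable
    (Filter.Eventually.of_forall fun ω => ?_)
  rw [Real.norm_of_nonneg (Real.exp_pos _).le]
  refine Real.exp_le_exp.2 ((le_abs_self _).trans ?_)
  rw [abs_mul]
  gcongr
  exact abs_sum_trunc_le hM le_rfl fun i => X i ω

theorem IsMixing.abs_integral_sum_trunc_le (h : IsMixing P X c γ₁ b) {s : ℝ} (hs : 0 < s)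
    {K : Finset ℤ} (hK : ∀ i ∈ K, 0 < i) {L : ℝ} (hL : (K.card : ℝ) ≤ L) :
    |∫ ω, ∑ i ∈ K, trunc (s ^ b) (X i ω) ∂P| ≤ L * (truncErr b * Real.exp (-(s / 2))) := by
  have := truncErr_pos b
  rw [integral_finsetSum _ fun i _ => h.integrable_trunc i (by positivity)]
  calc _ ≤ ∑ i ∈ K, |∫ ω, trunc (s ^ b) (X i ω) ∂P| := Finset.abs_sum_le_sum_abs _ _
    _ ≤ ∑ i ∈ K, truncErr b * Real.exp (-(s / 2)) :=
        Finset.sum_le_sum fun i hi => h.abs_integral_trunc_le (hK i hi) hs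
    _ = K.card * (truncErr b * Real.exp (-(s / 2))) := by rw [Finset.sum_const, nsmul_eq_mul]
    _ ≤ _ := by gcongr

/-- The bound for the Laplace transform of a sum with few terms. -/
theorem IsMixing.integral_exp_le_of_small (h : IsMixing P X c γ₁ b) (hV : truncVar P X < ∞)
    {s : ℝ} (hs : 0 < s) (hsb : 1 ≤ s ^ b) {K : Finset ℤ} (hK : ∀ i ∈ K, 0 < i) {L : ℝ}
    (hL : (K.card : ℝ) ≤ L) {θ T : ℝ} (hθ : |θ| ≤ T) (hT1 : T ≤ 1) (hT : T * (s ^ b * L) ≤ 1) :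
    ∫ ω, Real.exp (θ * ∑ i ∈ K, trunc (s ^ b) (X i ω)) ∂P ≤
      Real.exp (θ ^ 2 * (L * (truncVar P X).toReal) + (L * (truncErr b * Real.exp (-(s / 2))) +
        (L * (truncErr b * Real.exp (-(s / 2)))) ^ 2)) := by
  set M := s ^ b with hM
  have hM0 : 0 ≤ M := by linarith
  have hL0 : 0 ≤ L := (Nat.cast_nonneg _).trans hL
  have hte := truncErr_pos b
  set m := L * (truncErr b * Real.exp (-(s / 2))) with hm
  have hm0 : 0 ≤ m := by positivity
  set Y := fun ω => ∑ i ∈ K, trunc M (X i ω) with hY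
  have hYb : ∀ ω, |Y ω| ≤ M * L := fun ω => abs_sum_trunc_le hM0 hL fun i => X i ω
  have hYL : MemLp Y 2 P := MemLp.of_bound (h.measurable_sum_trunc M K).aestronglyMeasurable
    (M * L) (Filter.Eventually.of_forall hYb)
  have hYi : Integrable Y P := hYL.integrable one_le_two
  have hEY : |∫ ω, Y ω ∂P| ≤ m := h.abs_integral_sum_trunc_le hs hK hL
  have hvar : variance Y P ≤ L * (truncVar P X).toReal :=
    (h.variance_sum_trunc_le hV hsb hK).trans (by gcongr)
  have hEY2 : ∫ ω, Y ω ^ 2 ∂P ≤ L * (truncVar P X).toReal + m ^ 2 := by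
    have h1 := variance_eq_sub hYL
    simp only [Pi.pow_apply] at h1
    have h2 : (∫ ω, Y ω ∂P) ^ 2 ≤ m ^ 2 := sq_le_sq.2 (by rwa [abs_of_nonneg hm0])
    linarith
  -- `exp u ≤ 1 + u + u ^ 2` for `|u| ≤ 1`. The linear term survives integration, because the
  -- truncated variables are not exactly centered.
  have hpt : ∀ ω, Real.exp (θ * Y ω) ≤ 1 + θ * Y ω + θ ^ 2 * Y ω ^ 2 := fun ω => by
    have h1 : |θ * Y ω| ≤ 1 := by
      rw [abs_mul]
      exact (mul_le_mul hθ (hYb ω) (abs_nonneg _) ((abs_nonneg _).trans hθ)).trans hT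
    have h2 := Real.abs_exp_sub_one_sub_id_le h1
    have h3 := (abs_le.1 h2).2
    rw [mul_pow] at h3
    linarith
  calc ∫ ω, Real.exp (θ * Y ω) ∂P ≤ ∫ ω, (1 + θ * Y ω + θ ^ 2 * Y ω ^ 2) ∂P :=
        integral_mono (h.integrable_exp_sum_trunc hM0 K θ)
          (((integrable_const _).add (hYi.const_mul _)).add (hYL.integrable_sq.const_mul _)) hpt
    _ = 1 + θ * ∫ ω, Y ω ∂P + θ ^ 2 * ∫ ω, Y ω ^ 2 ∂P := by
        have hadd : Integrable (fun ω => 1 + θ * Y ω) P :=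
          (integrable_const _).add (hYi.const_mul _)
        rw [integral_add hadd (hYL.integrable_sq.const_mul _),
          integral_add (integrable_const _) (hYi.const_mul _), integral_const_mul,
          integral_const_mul]
        simp
    _ ≤ 1 + m + θ ^ 2 * (L * (truncVar P X).toReal + m ^ 2) := by
        gcongr
        refine (le_abs_self _).trans ?_
        rw [abs_mul]
        calc |θ| * |∫ ω, Y ω ∂P| ≤ 1 * m :=
              mul_le_mul (hθ.trans hT1) hEY (abs_nonneg _) zero_le_one
          _ = m := one_mul m
    _ ≤ θ ^ 2 * (L * (truncVar P X).toReal) + (m + m ^ 2) + 1 := by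
        have h1 : θ ^ 2 ≤ 1 := by
          rw [← sq_abs]
          exact pow_le_one₀ (abs_nonneg _) (hθ.trans hT1)
        nlinarith [sq_nonneg m]
    _ ≤ _ := Real.add_one_le_exp _

/-- The bound for the Laplace transform of the sums over Cantor-like sets; the truncation level
decreases with the size of the set. -/
theorem IsMixing.integral_exp_le_of_isCantor (h : IsMixing P X c γ₁ b) (hV : truncVar P X < ∞)
    (hb : 0 ≤ b) (hc : 0 < c) (hγ₁ : 0 < γ₁) {r : ℕ} (hr : 1 ≤ r) {g : ℕ → ℕ} {L M : ℕ → ℝ}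
    (hL : ∀ j, L j = 2 ^ j * r) (hM : ∀ j, M j = (L j ^ γ₁) ^ b) {T : ℝ} (hT1 : T ≤ 1) {k : ℕ}
    (h0 : T * (M 0 * L 0) ≤ 1) (h1 : ∀ j < k, T * (M (j + 1) * L (j + 1)) ≤ L j ^ γ₁ / 4)
    (h2 : ∀ j < k, 2 * (T * (M j * L j)) ≤ c / 2 * (g j : ℝ) ^ γ₁) (h3 : ∀ j < k, r ≤ g j)
    {θ : ℝ} (hθ : |θ| ≤ T) {m e : ℝ} (hm : m = r * (truncErr b * Real.exp (-((r : ℝ) ^ γ₁ / 2))))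
    (he : e = r * (truncErr b * Real.exp (-((r : ℝ) ^ γ₁ / 4)) +
      Real.exp (-(c / 2 * (r : ℝ) ^ γ₁)))) :
    ∀ j ≤ k, ∀ K : Finset ℤ, (∀ i ∈ K, 0 < i) → IsCantor r g j K →
      ∫ ω, Real.exp (θ * ∑ i ∈ K, trunc (M j) (X i ω)) ∂P ≤
        Real.exp (2 ^ j * (θ ^ 2 * (r * (truncVar P X).toReal) + (m + m ^ 2) + j * e)) := by
  have hr' : (1 : ℝ) ≤ r := by exact_mod_cast hr
  have hte := truncErr_pos b
  have hT : 0 ≤ T := (abs_nonneg θ).trans hθ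
  have hLr : ∀ j, (r : ℝ) ≤ L j := fun j => by
    rw [hL]
    exact le_mul_of_one_le_left (by linarith) (one_le_pow₀ one_le_two)
  have hL1 : ∀ j, 1 ≤ L j := fun j => hr'.trans (hLr j)
  have hLs : ∀ j, L (j + 1) = 2 * L j := fun j => by rw [hL, hL, pow_succ]; ring
  have hsp : ∀ j, 0 < L j ^ γ₁ := fun j => Real.rpow_pos_of_pos (by linarith [hL1 j]) _
  have hM1 : ∀ j, 1 ≤ M j := fun j => by
    rw [hM]
    exact Real.one_le_rpow (Real.one_le_rpow (hL1 j) hγ₁.le) hb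
  have hM0 : ∀ j, 0 ≤ M j := fun j => by linarith [hM1 j]
  have he0 : 0 ≤ e := by rw [he]; positivity
  -- `h0` makes the sums over single pieces small enough for the quadratic bound, `h1` pays for the
  -- change of truncation level, and `h2` and `h3` pay for decoupling across the gap. Each merging
  -- doubles the previous exponent and adds `2 ^ (j + 1) * e`.
  intro j
  induction j with
  | zero =>
    intro _ K hK hCK
    have hcard : (K.card : ℝ) ≤ r := by exact_mod_cast hCK
    have hL0 : L 0 = r := by rw [hL]; simp
    have := h.integral_exp_le_of_small hV (hsp 0) (by rw [← hM]; exact hM1 0) hK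
      (L := r) hcard hθ hT1 (by rw [← hM, ← hL0]; exact h0)
    rw [← hM, hL0, ← hm] at this
    simpa using this
  | succ j ih =>
    intro hj K hK hCK
    obtain ⟨K₁, K₂, rfl, hg, hC₁, hC₂⟩ := hCK
    have hjk : j < k := hj
    have hgj : 1 ≤ g j := hr.trans (h3 j hjk)
    have hK₁ : ∀ i ∈ K₁, 0 < i := fun i hi => hK i (Finset.mem_union_left _ hi)
    have hK₂ : ∀ i ∈ K₂, 0 < i := fun i hi => hK i (Finset.mem_union_right _ hi)
    have hdisj : Disjoint K₁ K₂ := Finset.disjoint_left.2 fun a ha hb => by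
      have := hg a ha a hb
      omega
    have hc₁ : (K₁.card : ℝ) ≤ L j := by rw [hL]; exact_mod_cast hC₁.card_le
    have hc₂ : (K₂.card : ℝ) ≤ L j := by rw [hL]; exact_mod_cast hC₂.card_le
    have hc : ((K₁ ∪ K₂).card : ℝ) ≤ L (j + 1) := by
      rw [Finset.card_union_of_disjoint hdisj, hLs]; push_cast; linarith
    have hLj0 : 0 ≤ L j := by linarith [hL1 j]
    have hMM : M j ≤ M (j + 1) := by
      rw [hM, hM]
      have : L j ≤ L (j + 1) := by rw [hLs]; linarith
      gcongr
    set Y := fun ω => ∑ i ∈ K₁ ∪ K₂, trunc (M (j + 1)) (X i ω) with hYdef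
    set Y₁ := fun ω => ∑ i ∈ K₁, trunc (M j) (X i ω) with hY₁
    set Y₂ := fun ω => ∑ i ∈ K₂, trunc (M j) (X i ω) with hY₂
    have hY12 : ∀ ω, Y₁ ω + Y₂ ω = ∑ i ∈ K₁ ∪ K₂, trunc (M j) (X i ω) := fun ω =>
      (Finset.sum_union hdisj).symm
    have hi12 : Integrable (fun ω => Real.exp (θ * Y₁ ω) * Real.exp (θ * Y₂ ω)) P := by
      refine (h.integrable_exp_sum_trunc (hM0 j) (K₁ ∪ K₂) θ).congr
        (Filter.Eventually.of_forall fun ω => ?_)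
      simp only
      rw [← hY12, mul_add, Real.exp_add]
    -- change of the truncation level
    have hstep1 : ∫ ω, Real.exp (θ * Y ω) ∂P ≤
        ∫ ω, Real.exp (θ * Y₁ ω) * Real.exp (θ * Y₂ ω) ∂P +
          2 * L j * (truncErr b * Real.exp (-((r : ℝ) ^ γ₁ / 4))) := by
      set R := T * (M (j + 1) * L (j + 1)) with hR
      have hdi : ∀ i, Integrable (fun ω => |trunc (M (j + 1)) (X i ω) - trunc (M j) (X i ω)|) P :=
        fun i => ((h.integrable_trunc i (hM0 _)).sub (h.integrable_trunc i (hM0 _))).abs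
      have hdom : Integrable (fun ω => Real.exp R * (T * ∑ i ∈ K₁ ∪ K₂,
          |trunc (M (j + 1)) (X i ω) - trunc (M j) (X i ω)|)) P :=
        ((integrable_finsetSum _ fun i _ => hdi i).const_mul _).const_mul _
      have hpt : ∀ ω, Real.exp (θ * Y ω) ≤ Real.exp (θ * Y₁ ω) * Real.exp (θ * Y₂ ω) +
          Real.exp R * (T * ∑ i ∈ K₁ ∪ K₂,
            |trunc (M (j + 1)) (X i ω) - trunc (M j) (X i ω)|) := fun ω => by
        have e1 : |θ * Y ω| ≤ R := by
          rw [abs_mul]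
          exact mul_le_mul hθ (abs_sum_trunc_le (hM0 _) hc fun i => X i ω) (abs_nonneg _) hT
        have e2 : |θ * (Y₁ ω + Y₂ ω)| ≤ R := by
          rw [abs_mul, hY12]
          refine mul_le_mul hθ ((abs_sum_trunc_le (hM0 _) hc fun i => X i ω).trans ?_)
            (abs_nonneg _) hT
          have := hL1 (j + 1)
          gcongr
        have e3 := (le_abs_self _).trans (abs_exp_sub_exp_le e1 e2)
        rw [← Real.exp_add, ← mul_add]
        have e4 : |θ * Y ω - θ * (Y₁ ω + Y₂ ω)| ≤ T * ∑ i ∈ K₁ ∪ K₂,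
            |trunc (M (j + 1)) (X i ω) - trunc (M j) (X i ω)| := by
          rw [← mul_sub, abs_mul, hY12, ← Finset.sum_sub_distrib]
          gcongr
          exact Finset.abs_sum_le_sum_abs _ _
        have e5 := mul_le_mul_of_nonneg_left e4 (Real.exp_pos R).le
        linarith
      refine (integral_mono (h.integrable_exp_sum_trunc (hM0 _) _ θ) (hi12.add hdom) hpt).trans ?_
      rw [integral_add' hi12 hdom, integral_const_mul, integral_const_mul,
        integral_finsetSum _ fun i _ => hdi i]
      refine add_le_add le_rfl ?_
      have e1 : ∑ i ∈ K₁ ∪ K₂, ∫ ω, |trunc (M (j + 1)) (X i ω) - trunc (M j) (X i ω)| ∂P ≤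
          L (j + 1) * (truncErr b * Real.exp (-(L j ^ γ₁ / 2))) := by
        calc _ ≤ ∑ i ∈ K₁ ∪ K₂, truncErr b * Real.exp (-(L j ^ γ₁ / 2)) := by
              refine Finset.sum_le_sum fun i hi => ?_
              have := h.integral_abs_trunc_sub_trunc_le (hK i hi) (hsp j) (M := M (j + 1))
                (by rw [← hM]; exact hMM)
              rwa [← hM] at this
          _ = (K₁ ∪ K₂).card * (truncErr b * Real.exp (-(L j ^ γ₁ / 2))) := by
              rw [Finset.sum_const, nsmul_eq_mul]
          _ ≤ _ := by gcongr
      -- The old level is `s ^ b` with `s = L j ^ γ₁`, so the part cut off has mean of order `exp(-s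
      -- / 2)`, while `h1` bounds the size of the exponentials by `exp(s / 4)`.
      calc Real.exp R * (T * _) ≤ Real.exp (L j ^ γ₁ / 4) *
            (1 * (L (j + 1) * (truncErr b * Real.exp (-(L j ^ γ₁ / 2))))) := by
            have hnn : 0 ≤ ∑ i ∈ K₁ ∪ K₂,
                ∫ ω, |trunc (M (j + 1)) (X i ω) - trunc (M j) (X i ω)| ∂P :=
              Finset.sum_nonneg fun i _ => integral_nonneg fun _ => abs_nonneg _
            exact mul_le_mul (Real.exp_le_exp.2 (h1 j hjk)) (mul_le_mul hT1 e1 hnn zero_le_one)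
              (mul_nonneg hT hnn) (Real.exp_pos _).le
        _ = 2 * L j * (truncErr b * (Real.exp (L j ^ γ₁ / 4) * Real.exp (-(L j ^ γ₁ / 2)))) := by
            rw [hLs]; ring
        _ = 2 * L j * (truncErr b * Real.exp (-(L j ^ γ₁ / 4))) := by
            rw [← Real.exp_add]; ring_nf
        _ ≤ _ := by
            gcongr
            exact hLr j
    -- decoupling of the two halves
    have hstep2 : ∫ ω, Real.exp (θ * Y₁ ω) * Real.exp (θ * Y₂ ω) ∂P ≤
        (∫ ω, Real.exp (θ * Y₁ ω) ∂P) * ∫ ω, Real.exp (θ * Y₂ ω) ∂P +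
          L j * Real.exp (-(c / 2 * (r : ℝ) ^ γ₁)) := by
      obtain ⟨p, hp1, hp2⟩ := exists_between_of_gap hg
      have hG : Measurable[past X p] fun ω => Real.exp (θ * Y₁ ω) := by
        refine Measurable.exp (Measurable.const_mul ?_ θ)
        exact Finset.measurable_sum _ fun i hi =>
          (TauMixing.measurable_trunc _).comp (measurable_past (hp1 i hi))
      have hGb : ∀ ω, |Real.exp (θ * Y₁ ω)| ≤ Real.exp (T * (M j * L j)) := fun ω => by
        rw [abs_of_pos (Real.exp_pos _)]
        refine Real.exp_le_exp.2 ((le_abs_self _).trans ?_)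
        rw [abs_mul]
        exact mul_le_mul hθ (abs_sum_trunc_le (hM0 _) hc₁ fun i => X i ω) (abs_nonneg _) hT
      have key := h.abs_integral_mul_exp_sub_le hgj hp2 (ψ := fun _ => trunc (M j))
        (fun _ => abs_trunc_sub_trunc_le _) (hM0 j) (fun _ _ => abs_trunc_le (hM0 j)) hc₂ hθ hG
        (Real.exp_pos _).le hGb
      have key2 := (abs_le.1 key).2
      -- Half of the exponent `c * g j ^ γ₁` absorbs the two exponentials; the other half remains as
      -- the error.
      have hlast : Real.exp (T * (M j * L j)) * (T * Real.exp (T * (M j * L j))) * L j *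
          Real.exp (-(c * (g j : ℝ) ^ γ₁)) ≤ L j * Real.exp (-(c / 2 * (r : ℝ) ^ γ₁)) := by
        calc _ = T * L j * Real.exp (2 * (T * (M j * L j)) - c * (g j : ℝ) ^ γ₁) := by
              rw [sub_eq_add_neg, Real.exp_add, two_mul, Real.exp_add]; ring
          _ ≤ 1 * L j * Real.exp (-(c / 2 * (r : ℝ) ^ γ₁)) := by
              gcongr
              have e1 := h2 j hjk
              have e2 : c / 2 * (r : ℝ) ^ γ₁ ≤ c / 2 * (g j : ℝ) ^ γ₁ := by
                gcongr
                exact h3 j hjk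
              linarith
          _ = _ := by rw [one_mul]
      linarith
    have ih1 := ih hjk.le K₁ hK₁ hC₁
    have ih2 := ih hjk.le K₂ hK₂ hC₂
    set a := θ ^ 2 * (r * (truncVar P X).toReal) + (m + m ^ 2) + j * e with ha
    have hm0 : 0 ≤ m := by rw [hm]; positivity
    have ha0 : 0 ≤ a := by positivity
    have hprod : (∫ ω, Real.exp (θ * Y₁ ω) ∂P) * ∫ ω, Real.exp (θ * Y₂ ω) ∂P ≤
        Real.exp (2 ^ (j + 1) * a) := by
      calc _ ≤ Real.exp (2 ^ j * a) * Real.exp (2 ^ j * a) :=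
            mul_le_mul ih1 ih2 (integral_nonneg fun _ => (Real.exp_pos _).le) (Real.exp_pos _).le
        _ = _ := by rw [← Real.exp_add]; ring_nf
    have herr : 2 * L j * (truncErr b * Real.exp (-((r : ℝ) ^ γ₁ / 4))) +
        L j * Real.exp (-(c / 2 * (r : ℝ) ^ γ₁)) ≤ 2 ^ (j + 1) * e := by
      rw [he, hL]
      have : 0 ≤ 2 ^ j * (r : ℝ) * Real.exp (-(c / 2 * (r : ℝ) ^ γ₁)) := by positivity
      rw [pow_succ]
      nlinarith [this]
    have hx : 1 ≤ Real.exp (2 ^ (j + 1) * a) := Real.one_le_exp (by positivity)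
    have hy : 0 ≤ 2 ^ (j + 1) * e := by positivity
    -- An additive error `y` becomes a factor `exp y`, because the main term is at least 1.
    calc ∫ ω, Real.exp (θ * Y ω) ∂P ≤ Real.exp (2 ^ (j + 1) * a) + 2 ^ (j + 1) * e := by linarith
      _ ≤ Real.exp (2 ^ (j + 1) * a) * (2 ^ (j + 1) * e + 1) := by nlinarith
      _ ≤ Real.exp (2 ^ (j + 1) * a) * Real.exp (2 ^ (j + 1) * e) := by
          gcongr
          exact Real.add_one_le_exp _
      _ = _ := by
          rw [← Real.exp_add, ha]
          push_cast
          ring_nf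

end

/-! ### From Cantor-like sets to intervals. -/

/-- Every sum over an interval is an average of sums over pieces of translates of a fixed set. -/
theorem exp_sum_le_average {K : Finset ℤ} {D A : ℕ} (hK : ∀ i ∈ K, 0 ≤ i ∧ i < D) {a : ℤ}
    {I : Finset ℤ} (hI : I ⊆ Finset.Ioc a (a + A)) {t θ : ℝ} (hpos : 0 < D + A)
    (hθ : θ * K.card = t * (D + A : ℕ)) (f : ℤ → ℝ) :
    Real.exp (t * ∑ i ∈ I, f i) ≤ ∑ w ∈ Finset.Ioc (a - D) (a + A),
      ((D + A : ℕ) : ℝ)⁻¹ * Real.exp (θ * ∑ i ∈ I ∩ K.image (· + w), f i) := by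
  set W := Finset.Ioc (a - D) (a + A) with hW
  have hWc : W.card = D + A := by rw [hW, Int.card_Ioc]; omega
  have hWp : (0 : ℝ) < ((D + A : ℕ) : ℝ) := by exact_mod_cast hpos
  -- The translates that contain `i` are those by `i - j` with `j ∈ K`, and all of them lie in the
  -- window `W`; so each `i` is counted `K.card` times. This explains the scaling `hθ` of the
  -- parameter before Jensen's inequality.
  have hcount : ∀ i ∈ I, ∑ w ∈ W, (if i ∈ K.image (· + w) then f i else 0) = K.card * f i := by
    intro i hi
    have hi' := Finset.mem_Ioc.1 (hI hi)
    rw [← Finset.sum_filter, Finset.sum_const, nsmul_eq_mul]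
    congr 2
    rw [← Finset.card_image_of_injective K (sub_right_injective (b := i))]
    congr 1
    ext w
    simp only [Finset.mem_filter, Finset.mem_image, hW, Finset.mem_Ioc]
    constructor
    · rintro ⟨-, j, hj, hji⟩
      exact ⟨j, hj, by omega⟩
    · rintro ⟨j, hj, hji⟩
      have := hK j hj
      exact ⟨by omega, j, hj, by omega⟩
  have hsum : ∑ w ∈ W, ∑ i ∈ I ∩ K.image (· + w), f i = K.card * ∑ i ∈ I, f i := by
    rw [Finset.mul_sum, ← Finset.sum_congr rfl hcount, Finset.sum_comm]
    refine Finset.sum_congr rfl fun w _ => ?_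
    rw [← Finset.sum_filter, Finset.filter_mem_eq_inter]
  have hj := convexOn_exp.map_sum_le (t := W) (w := fun _ => ((D + A : ℕ) : ℝ)⁻¹)
    (p := fun w => θ * ∑ i ∈ I ∩ K.image (· + w), f i) (fun _ _ => by positivity)
    (by rw [Finset.sum_const, hWc, nsmul_eq_mul, mul_inv_cancel₀ hWp.ne'])
    (fun _ _ => Set.mem_univ _)
  simp only [smul_eq_mul] at hj
  refine le_trans (le_of_eq ?_) hj
  congr 1
  rw [← Finset.mul_sum, ← Finset.mul_sum, hsum, ← mul_assoc θ, hθ]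
  field_simp

/-- The number of elements of a Cantor-like set of size of order `B`. -/
noncomputable def blockLength (γ B : ℝ) : ℕ := 2 ^ Nat.log 2 ⌊B ^ γ⌋₊ * ⌊B ^ (1 - γ)⌋₊

theorem half_le_floor {x : ℝ} (hx : 1 ≤ x) : x / 2 ≤ (⌊x⌋₊ : ℝ) := by
  have h1 := Nat.lt_floor_add_one x
  have h2 : (1 : ℝ) ≤ (⌊x⌋₊ : ℝ) := by exact_mod_cast Nat.one_le_floor_iff x |>.2 hx
  linarith

theorem two_pow_log_floor_le {x : ℝ} (hx : 1 ≤ x) : (2 : ℝ) ^ Nat.log 2 ⌊x⌋₊ ≤ x := by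
  have h1 : 1 ≤ ⌊x⌋₊ := (Nat.one_le_floor_iff x).2 hx
  have h2 := Nat.pow_log_le_self 2 (x := ⌊x⌋₊) (by omega)
  calc (2 : ℝ) ^ Nat.log 2 ⌊x⌋₊ ≤ (⌊x⌋₊ : ℝ) := by exact_mod_cast h2
    _ ≤ x := Nat.floor_le (by linarith)

theorem half_le_two_pow_log_floor {x : ℝ} : x / 2 ≤ (2 : ℝ) ^ Nat.log 2 ⌊x⌋₊ := by
  have h2 := Nat.lt_pow_succ_log_self one_lt_two ⌊x⌋₊
  have h3 : ((⌊x⌋₊ + 1 : ℕ) : ℝ) ≤ 2 ^ (Nat.log 2 ⌊x⌋₊ + 1) := by exact_mod_cast h2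
  have h4 := Nat.lt_floor_add_one x
  push_cast at h3
  rw [pow_succ] at h3
  linarith

theorem blockLength_le {γ B : ℝ} (hγ : 0 < γ) (hγ1 : γ < 1) (hB : 1 ≤ B) :
    (blockLength γ B : ℝ) ≤ B := by
  have h1 := two_pow_log_floor_le (Real.one_le_rpow hB hγ.le)
  have h2 : (⌊B ^ (1 - γ)⌋₊ : ℝ) ≤ B ^ (1 - γ) := Nat.floor_le (by positivity)
  unfold blockLength
  push_cast
  calc _ ≤ B ^ γ * B ^ (1 - γ) := by gcongr
    _ = B := by rw [← Real.rpow_add (by linarith)]; simp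

theorem le_blockLength {γ B : ℝ} (hγ1 : γ < 1) (hB : 1 ≤ B) :
    B / 4 ≤ (blockLength γ B : ℝ) := by
  have h1 := half_le_two_pow_log_floor (x := B ^ γ)
  have h2 := half_le_floor (Real.one_le_rpow hB (by linarith : 0 ≤ 1 - γ))
  have h3 : B = B ^ γ * B ^ (1 - γ) := by rw [← Real.rpow_add (by linarith)]; simp
  unfold blockLength
  push_cast
  calc B / 4 = (B ^ γ / 2) * (B ^ (1 - γ) / 2) := by
        conv_lhs => rw [h3]
        ring
    _ ≤ _ := by gcongr

theorem blockLength_pos {γ B : ℝ} (hγ1 : γ < 1) (hB : 1 ≤ B) :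
    0 < blockLength γ B := by
  have := le_blockLength hγ1 hB
  have h : (0 : ℝ) < blockLength γ B := by linarith
  exact_mod_cast h

/-- Length of a Cantor-like set with `A` elements, when the gaps are of order
`r + B * (2 ^ j * r / B) ^ (1 / γ)`. -/
theorem cantorLength_le {γ B : ℝ} (hγ : 0 < γ) (hγ1 : γ < 1) (hB : 1 ≤ B) {r k : ℕ} (hr : 1 ≤ r)
    (hA : (2 : ℝ) ^ k * r ≤ B) (hA' : B ≤ 4 * ((2 : ℝ) ^ k * r)) :
    (cantorLength r (fun j => r + ⌈B * (2 ^ j * r / B) ^ (1 / γ)⌉₊) k : ℝ) ≤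
      (3 + 4 * (1 - (2 : ℝ) ^ (1 - 1 / γ))⁻¹) * (2 ^ k * r) := by
  have hB0 : 0 < B := by linarith
  set q := (2 : ℝ) ^ (1 - 1 / γ) with hq
  have hγ' : 1 < 1 / γ := by rw [lt_div_iff₀ hγ]; linarith
  have hq0 : 0 < q := by positivity
  have hq1 : q < 1 := Real.rpow_lt_one_of_one_lt_of_neg one_lt_two (by linarith)
  have hr' : (1 : ℝ) ≤ r := by exact_mod_cast hr
  rw [cantorLength_eq]
  have hg : ∀ j ∈ Finset.range k,
      ((r + ⌈B * (2 ^ j * r / B) ^ (1 / γ)⌉₊ : ℕ) : ℝ) / 2 ^ (j + 1) ≤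
        r * (1 / 2) ^ j + B / 2 ^ k * (q ^ (k - 1 - j)) := by
    intro j hj
    have hjk : j < k := Finset.mem_range.1 hj
    have h1 : (⌈B * (2 ^ j * r / B) ^ (1 / γ)⌉₊ : ℝ) ≤ B * (2 ^ j * r / B) ^ (1 / γ) + 1 :=
      (Nat.ceil_lt_add_one (by positivity)).le
    obtain ⟨m, rfl⟩ : ∃ m, k = j + 1 + m := ⟨k - (j + 1), by omega⟩
    -- With `k = j + 1 + m`, a set of level `j` has at most `B / 2 ^ (m + 1)` elements. The exponent
    -- `1 / γ > 1` of the gap produces the extra factor `q ^ (m + 1)`, so the total length of the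
    -- gaps is a convergent geometric sum times `B`.
    have h2 : 2 ^ j * (r : ℝ) / B ≤ (2 : ℝ)⁻¹ ^ (m + 1) := by
      rw [div_le_iff₀ hB0, inv_pow, ← div_eq_inv_mul, le_div_iff₀ (by positivity)]
      calc (2 : ℝ) ^ j * r * 2 ^ (m + 1) = 2 ^ (j + 1 + m) * r := by ring
        _ ≤ B := hA
    have h3 : (2 ^ j * (r : ℝ) / B) ^ (1 / γ) ≤ 2⁻¹ ^ (m + 1) * q ^ (m + 1) := by
      calc (2 ^ j * (r : ℝ) / B) ^ (1 / γ) ≤ ((2 : ℝ)⁻¹ ^ (m + 1)) ^ (1 / γ) := by gcongr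
        _ = ((2 : ℝ)⁻¹ ^ (1 / γ)) ^ (m + 1) := by
            rw [← Real.rpow_natCast, ← Real.rpow_natCast, ← Real.rpow_mul (by positivity),
              ← Real.rpow_mul (by positivity), mul_comm]
        _ = (2⁻¹ * q) ^ (m + 1) := by
            congr 1
            rw [hq, Real.rpow_sub two_pos, Real.rpow_one, Real.inv_rpow two_pos.le]
            field_simp
        _ = _ := mul_pow _ _ _
    have h4 : q ^ (m + 1) ≤ q ^ m := pow_le_pow_of_le_one hq0.le hq1.le (by omega)
    rw [show j + 1 + m - 1 - j = m by omega]
    push_cast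
    calc ((r : ℝ) + ⌈B * (2 ^ j * r / B) ^ (1 / γ)⌉₊) / 2 ^ (j + 1)
        ≤ (r + (B * (2⁻¹ ^ (m + 1) * q ^ m) + r)) / 2 ^ (j + 1) := by
          gcongr
          calc _ ≤ B * (2 ^ j * r / B) ^ (1 / γ) + 1 := h1
            _ ≤ B * (2⁻¹ ^ (m + 1) * q ^ (m + 1)) + r := by gcongr
            _ ≤ B * (2⁻¹ ^ (m + 1) * q ^ m) + r := by gcongr
      _ = r * (1 / 2) ^ j + B / 2 ^ (j + 1 + m) * q ^ m / 2 := by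
          rw [one_div, inv_pow, inv_pow, pow_succ, pow_succ, pow_add, pow_add]
          field_simp
          ring
      _ ≤ _ := by
          have : 0 ≤ B / 2 ^ (j + 1 + m) * q ^ m := by positivity
          linarith
  have h1 : ∑ j ∈ Finset.range k, (1 / 2 : ℝ) ^ j ≤ 2 := by
    refine (Summable.sum_le_tsum _ (fun _ _ => by positivity)
      (summable_geometric_of_lt_one (by norm_num) (by norm_num))).trans ?_
    rw [tsum_geometric_of_lt_one (by norm_num) (by norm_num)]
    norm_num
  have h2 : ∑ j ∈ Finset.range k, q ^ (k - 1 - j) ≤ (1 - q)⁻¹ := by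
    rw [Finset.sum_range_reflect (fun j => q ^ j) k, ← tsum_geometric_of_lt_one hq0.le hq1]
    exact Summable.sum_le_tsum _ (fun _ _ => by positivity)
      (summable_geometric_of_lt_one hq0.le hq1)
  have hq1' : 0 < (1 - q)⁻¹ := inv_pos.2 (by linarith)
  calc 2 ^ k * ((r : ℝ) + ∑ j ∈ Finset.range k,
        ((r + ⌈B * (2 ^ j * r / B) ^ (1 / γ)⌉₊ : ℕ) : ℝ) / 2 ^ (j + 1))
      ≤ 2 ^ k * (r + ∑ j ∈ Finset.range k,
        (r * (1 / 2) ^ j + B / 2 ^ k * (q ^ (k - 1 - j)))) := by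
        gcongr with j hj
        exact hg j hj
    _ = 2 ^ k * r + 2 ^ k * r * ∑ j ∈ Finset.range k, (1 / 2 : ℝ) ^ j +
        B * ∑ j ∈ Finset.range k, q ^ (k - 1 - j) := by
        rw [Finset.sum_add_distrib, ← Finset.mul_sum, ← Finset.mul_sum]
        field_simp
        ring
    _ ≤ 2 ^ k * r + 2 ^ k * r * 2 + 4 * (2 ^ k * r) * (1 - q)⁻¹ := by gcongr
    _ = _ := by ring

/-- The truncation level for sums with `A` terms. -/
noncomputable def truncLevel (γ₁ b : ℝ) (A : ℕ) : ℝ := ((A : ℝ) ^ γ₁) ^ b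

set_option maxHeartbeats 1000000 in
/-- The bound for the Laplace transform of a sum over an interval, with an additive error. -/
theorem exists_integral_exp_block_le.{u} {c γ γ₁ b : ℝ} (hc : 0 < c) (hγ : 0 < γ) (hγ1 : γ < 1)
    (hγ₁ : 0 < γ₁) (hb : 0 ≤ b) (hγb : 1 / γ = 1 / γ₁ + b) :
    ∃ t₀ C δ : ℝ, 0 < t₀ ∧ t₀ ≤ 1 ∧ 1 ≤ C ∧ 0 < δ ∧ ∀ B : ℝ, 1 ≤ B →
      ∀ {Ω : Type u} [MeasurableSpace Ω] {P : Measure Ω} [IsProbabilityMeasure P]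
        {X : ℤ → Ω → ℝ}, IsMixing P X c γ₁ b → truncVar P X < ∞ → ∀ a : ℤ, 0 ≤ a → ∀ t : ℝ,
        |t| ≤ t₀ * B ^ (-(γ₁ * (1 / γ - 1))) →
        ∫ ω, Real.exp (t * ∑ i ∈ Finset.Ioc a (a + blockLength γ B),
          trunc (truncLevel γ₁ b (blockLength γ B)) (X i ω)) ∂P ≤
          Real.exp (C * (t ^ 2 * (blockLength γ B * (truncVar P X).toReal)) +
            C * Real.exp (-(δ * B ^ (γ₁ * (1 - γ))))) := by
  set q := (2 : ℝ) ^ (1 - 1 / γ) with hq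
  have hγ' : 1 < 1 / γ := by rw [lt_div_iff₀ hγ]; linarith
  have hq1 : q < 1 := Real.rpow_lt_one_of_one_lt_of_neg one_lt_two (by linarith)
  have hq1' : 0 < (1 - q)⁻¹ := inv_pos.2 (by linarith)
  -- `Cw` bounds the ratio of the window `D + A` to the number `A` of elements of the Cantor-like
  -- set.
  set Cw := 4 + 4 * (1 - q)⁻¹ with hCw
  have hCw1 : 1 ≤ Cw := by linarith
  -- The three entries serve, in this order, the bounds `h0` (pieces), `h2` (decoupling) and `h1`
  -- (change of level, where `L` doubles).
  set κ := min (min 1 (c / 4)) ((2 : ℝ) ^ (-γ₁) / 4) with hκ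
  have hκ0 : 0 < κ := by positivity
  have hκ1 : κ ≤ 1 := (min_le_left _ _).trans (min_le_left _ _)
  have hκ2 : κ ≤ c / 4 := (min_le_left _ _).trans (min_le_right _ _)
  have hκ3 : κ ≤ (2 : ℝ) ^ (-γ₁) / 4 := min_le_right _ _
  set δ₀ := min (1 / 4) (c / 2) * (2 : ℝ) ^ (-γ₁) with hδ₀
  have hδ₀' : 0 < δ₀ := by positivity
  set E := truncErr b with hE
  have hEp : 0 < E := truncErr_pos b
  set d := γ₁ * (1 / γ - 1) with hd
  have hd0 : 0 < d := mul_pos hγ₁ (by linarith)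
  have hη : 0 < γ₁ * (1 - γ) := mul_pos hγ₁ (by linarith)
  obtain ⟨Cp, hCp, hpoly⟩ := exists_rpow_mul_exp_neg_le 3 (c := δ₀ / 2) (by positivity) hη
  refine ⟨κ / Cw, max (Cw ^ 2) ((E + 1) ^ 2 * Cp), δ₀ / 2, by positivity,
    (div_le_one (by linarith)).2 (by linarith), le_max_of_le_left (one_le_pow₀ hCw1),
    by positivity, ?_⟩
  intro B hB Ω _ P _ X h hV a ha t ht
  have hB0 : 0 < B := by linarith
  set r := ⌊B ^ (1 - γ)⌋₊ with hr
  set k := Nat.log 2 ⌊B ^ γ⌋₊ with hk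
  set A := blockLength γ B with hA
  have hAdef : A = 2 ^ k * r := rfl
  have hAr : (A : ℝ) = 2 ^ k * r := by rw [hAdef]; push_cast; rfl
  have hA0 : 0 < A := blockLength_pos hγ1 hB
  have hA0' : (0 : ℝ) < A := by exact_mod_cast hA0
  have hAB : (A : ℝ) ≤ B := blockLength_le hγ hγ1 hB
  have hBA : B / 4 ≤ A := le_blockLength hγ1 hB
  have hB1 : 1 ≤ B ^ (1 - γ) := Real.one_le_rpow hB (by linarith)
  have hr1 : 1 ≤ r := (Nat.one_le_floor_iff _).2 hB1
  have hr1' : (1 : ℝ) ≤ r := by exact_mod_cast hr1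
  have hrB : (r : ℝ) ≤ B ^ (1 - γ) := Nat.floor_le (by positivity)
  have hrB' : B ^ (1 - γ) / 2 ≤ r := half_le_floor hB1
  set g : ℕ → ℕ := fun j => r + ⌈B * (2 ^ j * r / B) ^ (1 / γ)⌉₊ with hg
  set D := cantorLength r g k with hD
  have hDle : (D : ℝ) ≤ (3 + 4 * (1 - q)⁻¹) * A := by
    rw [hAr]
    exact cantorLength_le hγ hγ1 hB hr1 (by rw [← hAr]; exact hAB) (by rw [← hAr]; linarith)
  have hDA : ((D + A : ℕ) : ℝ) ≤ Cw * A := by push_cast; rw [hCw]; linarith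
  set T := κ * B ^ (-d) with hT
  have hT0 : 0 < T := by positivity
  have hT1 : T ≤ 1 := by
    have : B ^ (-d) ≤ 1 := Real.rpow_le_one_of_one_le_of_nonpos hB (by linarith)
    calc T ≤ 1 * 1 := by rw [hT]; gcongr
      _ = 1 := one_mul 1
  set L : ℕ → ℝ := fun j => 2 ^ j * r with hL
  set M : ℕ → ℝ := fun j => (L j ^ γ₁) ^ b with hM
  have hL0 : ∀ j, 0 < L j := fun j => by simp only [hL]; positivity
  -- Both sides equal `γ₁ / γ`. Hence the trivial bound `M j * L j` for a sum of level `j` is `L j ^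
  -- d * L j ^ γ₁`, and `T` of order `B ^ (-d)` leaves at most `κ * L j ^ γ₁`, comparable with the
  -- tail exponent.
  have hγd : γ₁ * b + 1 = d + γ₁ := by
    have : b = 1 / γ - 1 / γ₁ := by linarith
    rw [this, hd]
    field_simp
    ring
  have hML : ∀ j, M j * L j = L j ^ d * L j ^ γ₁ := fun j => by
    rw [← Real.rpow_add (hL0 j), ← hγd, Real.rpow_add (hL0 j), Real.rpow_one, hM,
      Real.rpow_mul (hL0 j).le]
  have hLk : ∀ j ≤ k, L j ≤ B := fun j hj => by
    refine le_trans ?_ (hAr ▸ hAB)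
    simp only [hL]
    gcongr
    exact one_le_two
  have hTL : ∀ j ≤ k, T * (M j * L j) ≤ κ * L j ^ γ₁ := fun j hj => by
    rw [hML, hT]
    have h1 : L j ^ d ≤ B ^ d := Real.rpow_le_rpow (hL0 j).le (hLk j hj) hd0.le
    have h2 : B ^ (-d) * B ^ d = 1 := by rw [← Real.rpow_add hB0]; simp
    calc κ * B ^ (-d) * (L j ^ d * L j ^ γ₁) ≤ κ * B ^ (-d) * (B ^ d * L j ^ γ₁) := by
          gcongr
      _ = κ * (B ^ (-d) * B ^ d) * L j ^ γ₁ := by ring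
      _ = _ := by rw [h2, mul_one]
  have h0 : T * (M 0 * L 0) ≤ 1 := by
    have e0 : L 0 = r := by simp [hL]
    rw [hML, ← Real.rpow_add (hL0 0), e0, hT]
    have e1 : (r : ℝ) ^ (d + γ₁) ≤ (B ^ (1 - γ)) ^ (d + γ₁) := by gcongr
    rw [← Real.rpow_mul hB0.le] at e1
    -- This identity dictates the size `B ^ (1 - γ)` of the pieces: `T` times the trivial bound for
    -- a piece is then of order one.
    have e2 : (1 - γ) * (d + γ₁) = d := by
      rw [hd]
      field_simp
      ring
    rw [e2] at e1
    have h2 : B ^ (-d) * B ^ d = 1 := by rw [← Real.rpow_add hB0]; simp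
    calc κ * B ^ (-d) * (r : ℝ) ^ (d + γ₁) ≤ κ * B ^ (-d) * B ^ d := by gcongr
      _ = κ := by rw [mul_assoc, h2, mul_one]
      _ ≤ 1 := hκ1
  have h1 : ∀ j < k, T * (M (j + 1) * L (j + 1)) ≤ L j ^ γ₁ / 4 := fun j hj => by
    refine (hTL (j + 1) hj).trans ?_
    have e1 : L (j + 1) = 2 * L j := by simp only [hL, pow_succ]; ring
    have e2 : (2 : ℝ) ^ (-γ₁) * 2 ^ γ₁ = 1 := by rw [← Real.rpow_add two_pos]; simp
    rw [e1, Real.mul_rpow two_pos.le (hL0 j).le]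
    calc κ * (2 ^ γ₁ * L j ^ γ₁) ≤ (2 : ℝ) ^ (-γ₁) / 4 * (2 ^ γ₁ * L j ^ γ₁) := by gcongr
      _ = ((2 : ℝ) ^ (-γ₁) * 2 ^ γ₁) * L j ^ γ₁ / 4 := by ring
      _ = _ := by rw [e2, one_mul]
  have h2 : ∀ j < k, 2 * (T * (M j * L j)) ≤ c / 2 * (g j : ℝ) ^ γ₁ := fun j hj => by
    have e1 : B * (L j / B) ^ (1 / γ) ≤ g j := by
      simp only [hg]
      push_cast
      exact (Nat.le_ceil _).trans (le_add_of_nonneg_left (by positivity))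
    -- The gaps are chosen for this identity: the mixing exponent across the gap matches `B ^ (-d)`
    -- times the trivial bound.
    have e2 : (B * (L j / B) ^ (1 / γ)) ^ γ₁ = B ^ (-d) * (M j * L j) := by
      rw [hML, ← Real.rpow_add (hL0 j), Real.mul_rpow hB0.le (by have := hL0 j; positivity),
        ← Real.rpow_mul (by have := hL0 j; positivity), Real.div_rpow (hL0 j).le hB0.le]
      have e3 : 1 / γ * γ₁ = d + γ₁ := by rw [hd]; ring
      rw [e3, Real.rpow_add hB0, Real.rpow_neg hB0.le]
      field_simp
    have e4 : B ^ (-d) * (M j * L j) ≤ (g j : ℝ) ^ γ₁ := by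
      rw [← e2]
      have := hL0 j
      gcongr
    have e5 : 0 ≤ (g j : ℝ) ^ γ₁ := by positivity
    calc 2 * (T * (M j * L j)) = 2 * κ * (B ^ (-d) * (M j * L j)) := by rw [hT]; ring
      _ ≤ 2 * κ * (g j : ℝ) ^ γ₁ := by gcongr
      _ ≤ _ := by
        gcongr
        linarith
  have h3 : ∀ j < k, r ≤ g j := fun j _ => Nat.le_add_right _ _
  set θ := t * (D + A : ℕ) / A with hθdef
  have hθt : |θ| ≤ Cw * |t| := by
    rw [hθdef, abs_div, abs_mul, abs_of_pos hA0', div_le_iff₀ hA0', Nat.abs_cast]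
    calc |t| * ((D + A : ℕ) : ℝ) ≤ |t| * (Cw * A) := by gcongr
      _ = _ := by ring
  have hθT : |θ| ≤ T := by
    refine hθt.trans ?_
    calc Cw * |t| ≤ Cw * (κ / Cw * B ^ (-d)) := by gcongr
      _ = T := by rw [hT]; field_simp
  have hmain := h.integral_exp_le_of_isCantor hV hb hc hγ₁ hr1 (g := g) (L := L) (M := M)
    (fun _ => rfl) (fun _ => rfl) hT1 h0 h1 h2 h3 hθT rfl rfl k le_rfl
  set m := (r : ℝ) * (truncErr b * Real.exp (-((r : ℝ) ^ γ₁ / 2))) with hm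
  set e := (r : ℝ) * (truncErr b * Real.exp (-((r : ℝ) ^ γ₁ / 4)) +
      Real.exp (-(c / 2 * (r : ℝ) ^ γ₁))) with he
  set V := (truncVar P X).toReal with hVdef
  have hV0 : 0 ≤ V := ENNReal.toReal_nonneg
  set Q := Real.exp (2 ^ k * (θ ^ 2 * (r * V) + (m + m ^ 2) + k * e)) with hQ
  set Mt := truncLevel γ₁ b A with hMt
  have hMk : M k = Mt := by
    simp only [hM, hMt, truncLevel, hL]
    rw [hAr]
  have hMt0 : 0 ≤ Mt := by rw [hMt]; unfold truncLevel; positivity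
  set I := Finset.Ioc a (a + (A : ℤ)) with hI
  have hIpos : ∀ i ∈ I, 0 < i := fun i hi => by
    have := Finset.mem_Ioc.1 hi
    omega
  have hcant := isCantor_cantorSet r g k
  have hstep : ∫ ω, Real.exp (t * ∑ i ∈ I, trunc Mt (X i ω)) ∂P ≤ Q := by
    have hDApos : (0 : ℝ) < ((D + A : ℕ) : ℝ) := by
      have : 0 < D + A := by omega
      exact_mod_cast this
    have hpt : ∀ ω, Real.exp (t * ∑ i ∈ I, trunc Mt (X i ω)) ≤
        ∑ w ∈ Finset.Ioc (a - D) (a + A), ((D + A : ℕ) : ℝ)⁻¹ *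
          Real.exp (θ * ∑ i ∈ I ∩ (cantorSet r g k).image (· + w), trunc Mt (X i ω)) := fun ω => by
      refine exp_sum_le_average (D := D) (fun i hi => mem_cantorSet hi) subset_rfl (by omega) ?_
        (fun i => trunc Mt (X i ω))
      rw [card_cantorSet, ← hAdef, hθdef]
      field_simp
    have hint : ∀ w ∈ Finset.Ioc (a - D) (a + A), Integrable (fun ω => ((D + A : ℕ) : ℝ)⁻¹ *
        Real.exp (θ * ∑ i ∈ I ∩ (cantorSet r g k).image (· + w), trunc Mt (X i ω))) P :=
      fun w _ => (h.integrable_exp_sum_trunc hMt0 _ θ).const_mul _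
    refine (integral_mono (h.integrable_exp_sum_trunc hMt0 I t)
      (integrable_finsetSum _ hint) hpt).trans ?_
    rw [integral_finsetSum _ hint]
    calc _ ≤ ∑ w ∈ Finset.Ioc (a - D) (a + A), ((D + A : ℕ) : ℝ)⁻¹ * Q := by
          refine Finset.sum_le_sum fun w _ => ?_
          rw [integral_const_mul]
          refine mul_le_mul_of_nonneg_left ?_ (by positivity)
          rw [← hMk]
          exact hmain _ (fun i hi => hIpos i (Finset.mem_inter.1 hi).1)
            ((hcant.shift w).subset Finset.inter_subset_right)
      _ = Q := by
          rw [Finset.sum_const, Int.card_Ioc, nsmul_eq_mul,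
            show (a + (A : ℤ) - (a - D)).toNat = D + A by omega]
          field_simp
  refine hstep.trans (Real.exp_le_exp.2 ?_)
  set F := Real.exp (-(δ₀ * B ^ (γ₁ * (1 - γ)))) with hF
  have hF0 : 0 < F := Real.exp_pos _
  have hF1 : F ≤ 1 := Real.exp_le_one_iff.2 (by
    have : 0 ≤ δ₀ * B ^ (γ₁ * (1 - γ)) := by positivity
    linarith)
  have hrg : (2 : ℝ) ^ (-γ₁) * B ^ (γ₁ * (1 - γ)) ≤ (r : ℝ) ^ γ₁ := by
    calc (2 : ℝ) ^ (-γ₁) * B ^ (γ₁ * (1 - γ)) = (B ^ (1 - γ) / 2) ^ γ₁ := by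
          rw [Real.div_rpow (by positivity) two_pos.le, ← Real.rpow_mul hB0.le, Real.rpow_neg
            two_pos.le, mul_comm γ₁]
          field_simp
      _ ≤ _ := by gcongr
  have hFr : ∀ x : ℝ, min (1 / 4) (c / 2) ≤ x → Real.exp (-(x * (r : ℝ) ^ γ₁)) ≤ F := fun x hx => by
    refine Real.exp_le_exp.2 (neg_le_neg ?_)
    calc δ₀ * B ^ (γ₁ * (1 - γ)) =
          min (1 / 4) (c / 2) * ((2 : ℝ) ^ (-γ₁) * B ^ (γ₁ * (1 - γ))) := by rw [hδ₀]; ring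
      _ ≤ min (1 / 4) (c / 2) * (r : ℝ) ^ γ₁ := by gcongr
      _ ≤ _ := by gcongr
  have hF2 := hFr (1 / 2) ((min_le_left _ _).trans (by norm_num))
  have hF4 := hFr (1 / 4) (min_le_left _ _)
  have hFc := hFr (c / 2) (min_le_right _ _)
  rw [one_div_mul_eq_div] at hF2 hF4
  have hrB1 : (r : ℝ) ≤ B := by
    refine hrB.trans ?_
    conv_rhs => rw [← Real.rpow_one B]
    exact Real.rpow_le_rpow_of_exponent_le hB (by linarith)
  have hkB : (2 : ℝ) ^ k ≤ B := by
    refine (two_pow_log_floor_le (Real.one_le_rpow hB hγ.le)).trans ?_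
    conv_rhs => rw [← Real.rpow_one B]
    exact Real.rpow_le_rpow_of_exponent_le hB hγ1.le
  have hkB' : (k : ℝ) ≤ B := by
    refine le_trans ?_ hkB
    exact_mod_cast (Nat.lt_two_pow_self (n := k)).le
  have hm1 : m ≤ B * E * F := by
    rw [hm, mul_assoc B]
    gcongr
  have hm0 : 0 ≤ m := by rw [hm]; positivity
  have he1 : e ≤ B * (E + 1) * F := by
    rw [he, mul_assoc B]
    have : E * Real.exp (-((r : ℝ) ^ γ₁ / 4)) + Real.exp (-(c / 2 * (r : ℝ) ^ γ₁)) ≤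
        (E + 1) * F := by
      rw [add_mul, one_mul]
      gcongr
    gcongr
  have he0 : 0 ≤ e := by rw [he]; positivity
  -- The number of pieces, their size and the number of mergings are each at most `B`; the resulting
  -- `B ^ 3` costs half of the rate `δ₀`.
  have herr : 2 ^ k * ((m + m ^ 2) + k * e) ≤ (E + 1) ^ 2 * (B ^ 3 * F) := by
    have e1 : m ^ 2 ≤ B ^ 2 * E ^ 2 * F := by
      calc m ^ 2 ≤ (B * E * F) ^ 2 := by gcongr
        _ = B ^ 2 * E ^ 2 * F * F := by ring
        _ ≤ B ^ 2 * E ^ 2 * F * 1 := by gcongr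
        _ = _ := mul_one _
    have e2 : k * e ≤ B * (B * (E + 1) * F) := by gcongr
    have e3 : m ≤ B ^ 2 * E * F := hm1.trans (by gcongr; nlinarith)
    calc 2 ^ k * ((m + m ^ 2) + k * e) ≤
          B * ((B ^ 2 * E * F + B ^ 2 * E ^ 2 * F) + B * (B * (E + 1) * F)) := by gcongr
      _ = (E ^ 2 + 2 * E + 1) * (B ^ 3 * F) := by ring
      _ = _ := by ring
  have hpB : B ^ 3 * F ≤ Cp * Real.exp (-(δ₀ / 2 * B ^ (γ₁ * (1 - γ)))) := by
    have e1 : F = Real.exp (-(δ₀ / 2 * B ^ (γ₁ * (1 - γ)))) *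
        Real.exp (-(δ₀ / 2 * B ^ (γ₁ * (1 - γ)))) := by
      rw [← Real.exp_add, hF]; ring_nf
    have e2 := hpoly B hB
    rw [show (3 : ℝ) = ((3 : ℕ) : ℝ) by norm_num, Real.rpow_natCast] at e2
    rw [e1, ← mul_assoc]
    gcongr
  have hθ2 : θ ^ 2 ≤ Cw ^ 2 * t ^ 2 := by
    rw [← sq_abs θ, ← sq_abs t, ← mul_pow]
    gcongr
  calc 2 ^ k * (θ ^ 2 * (r * V) + (m + m ^ 2) + k * e)
      = θ ^ 2 * (A * V) + 2 ^ k * ((m + m ^ 2) + k * e) := by rw [hAr]; ring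
    _ ≤ Cw ^ 2 * t ^ 2 * (A * V) +
        (E + 1) ^ 2 * (Cp * Real.exp (-(δ₀ / 2 * B ^ (γ₁ * (1 - γ))))) := by
        have e1 : 0 ≤ (A : ℝ) * V := by positivity
        exact add_le_add (mul_le_mul_of_nonneg_right hθ2 e1)
          (herr.trans (mul_le_mul_of_nonneg_left hpB (by positivity)))
    _ = Cw ^ 2 * (t ^ 2 * (A * V)) +
        (E + 1) ^ 2 * Cp * Real.exp (-(δ₀ / 2 * B ^ (γ₁ * (1 - γ)))) := by ring
    _ ≤ _ := by
        gcongr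
        · exact le_max_left _ _
        · exact le_max_right _ _

/-! ### Centered sums: a bound quadratic in the parameter. -/

/-- Termwise comparison of power series: `l ^ (2 * n) ≤ l ^ 2` for `n ≥ 1`, and the constant terms
are set equal by the added `1 - l ^ 2`. -/
theorem cosh_mul_sub_one_le {l u : ℝ} (hl : |l| ≤ 1) :
    Real.cosh (l * u) - 1 ≤ l ^ 2 * (Real.cosh u - 1) := by
  have h1 := Real.hasSum_cosh (l * u)
  have h2 := ((Real.hasSum_cosh u).mul_left (l ^ 2)).add (hasSum_ite_eq 0 (1 - l ^ 2))
  have hl2 : l ^ 2 ≤ 1 := by rw [← sq_abs]; exact pow_le_one₀ (abs_nonneg _) hl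
  have h3 := hasSum_le (fun n => ?_) h1 h2
  · linarith
  · rcases Nat.eq_zero_or_pos n with rfl | hn
    · simp
    · rw [if_neg hn.ne', add_zero, mul_pow, mul_div_assoc]
      have h4 : l ^ (2 * n) ≤ l ^ 2 := by
        rw [pow_mul]
        exact pow_le_of_le_one (sq_nonneg l) hl2 hn.ne'
      have h5 : 0 ≤ u ^ (2 * n) / ((2 * n).factorial : ℝ) := by
        rw [pow_mul]; positivity
      exact mul_le_mul_of_nonneg_right h4 h5

/-- From `exp(-u) ≥ 1 - u` one gets `exp u - 1 - u ≤ 2 (cosh u - 1)`; `cosh_mul_sub_one_le` then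
moves from `t * y` to `s * y` with the factor `(t / s) ^ 2`. -/
theorem exp_mul_sub_le {t s y : ℝ} (hs : 0 < s) (hts : |t| ≤ s) :
    Real.exp (t * y) ≤ 1 + t * y + (t / s) ^ 2 * (Real.exp (s * y) + Real.exp (-s * y) - 2) := by
  have h1 : |t / s| ≤ 1 := by
    rw [abs_div, abs_of_pos hs]
    exact (div_le_one hs).2 hts
  have h2 := cosh_mul_sub_one_le (u := s * y) h1
  rw [show t / s * (s * y) = t * y by field_simp, Real.cosh_eq, Real.cosh_eq] at h2
  have h3 := Real.add_one_le_exp (-(t * y))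
  rw [neg_mul]
  nlinarith

/-- Interpolation of a bound for the Laplace transform of a centered variable. -/
theorem integral_exp_le_of_endpoints {Ω : Type*} [MeasurableSpace Ω] {P : Measure Ω}
    [IsProbabilityMeasure P] {Y : Ω → ℝ} (hY : Integrable Y P) (hY0 : ∫ ω, Y ω ∂P = 0)
    (hexp : ∀ t, Integrable (fun ω => Real.exp (t * Y ω)) P) {s Q R : ℝ} (hs : 0 < s)
    (hQ : 0 ≤ Q) (hQR : Q ≤ R) (h1 : ∫ ω, Real.exp (s * Y ω) ∂P ≤ Real.exp Q)
    (h2 : ∫ ω, Real.exp (-s * Y ω) ∂P ≤ Real.exp Q) {t : ℝ} (ht : |t| ≤ s) :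
    ∫ ω, Real.exp (t * Y ω) ∂P ≤ Real.exp (2 * Real.exp R * (t / s) ^ 2 * Q) := by
  have i1 : Integrable (fun ω => Real.exp (s * Y ω) + Real.exp (-s * Y ω) - 2) P :=
    ((hexp s).add (hexp (-s))).sub (integrable_const _)
  have i2 : Integrable (fun ω => 1 + t * Y ω) P := (integrable_const _).add (hY.const_mul t)
  -- Uses `exp Q - 1 ≤ Q * exp Q ≤ Q * exp R`.
  have e1 : ∫ ω, (Real.exp (s * Y ω) + Real.exp (-s * Y ω) - 2) ∂P ≤ 2 * (Real.exp R * Q) := by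
    have i3 : Integrable (fun ω => Real.exp (s * Y ω) + Real.exp (-s * Y ω)) P :=
      (hexp s).add (hexp (-s))
    rw [integral_sub i3 (integrable_const _), integral_add (hexp s) (hexp (-s))]
    simp only [integral_const, probReal_univ, smul_eq_mul, one_mul]
    have e2 := Real.add_one_le_exp (-Q)
    have e3 : Real.exp Q ≤ Real.exp R := Real.exp_le_exp.2 hQR
    have e4 : Real.exp Q * Real.exp (-Q) = 1 := by rw [← Real.exp_add]; simp
    have e5 := Real.exp_pos Q
    nlinarith
  calc ∫ ω, Real.exp (t * Y ω) ∂P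
      ≤ ∫ ω, (1 + t * Y ω + (t / s) ^ 2 * (Real.exp (s * Y ω) + Real.exp (-s * Y ω) - 2)) ∂P :=
        integral_mono (hexp t) (i2.add (i1.const_mul _)) fun ω => exp_mul_sub_le hs ht
    _ = 1 + (t / s) ^ 2 * ∫ ω, (Real.exp (s * Y ω) + Real.exp (-s * Y ω) - 2) ∂P := by
        rw [integral_add i2 (i1.const_mul _), integral_add (integrable_const _) (hY.const_mul t),
          integral_const_mul, integral_const_mul, hY0]
        simp
    _ ≤ 1 + (t / s) ^ 2 * (2 * (Real.exp R * Q)) := by gcongr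
    _ = 2 * Real.exp R * (t / s) ^ 2 * Q + 1 := by ring
    _ ≤ _ := Real.add_one_le_exp _

/-- The centered truncated variable `φ_M(X_i) - E φ_M(X_i)`. -/
noncomputable def centered {Ω : Type*} [MeasurableSpace Ω] (P : Measure Ω) (X : ℤ → Ω → ℝ) (M : ℝ)
    (i : ℤ) (x : ℝ) : ℝ :=
  trunc M x - ∫ ω, trunc M (X i ω) ∂P

theorem abs_centered_sub_centered_le {Ω : Type*} [MeasurableSpace Ω] {P : Measure Ω}
    {X : ℤ → Ω → ℝ} (M : ℝ) (i : ℤ) (x y : ℝ) :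
    |centered P X M i x - centered P X M i y| ≤ |x - y| := by
  unfold centered
  rw [sub_sub_sub_cancel_right]
  exact abs_trunc_sub_trunc_le M x y

theorem measurable_centered {Ω : Type*} [MeasurableSpace Ω] {P : Measure Ω}
    {X : ℤ → Ω → ℝ} (M : ℝ) (i : ℤ) : Measurable (centered P X M i) :=
  (measurable_trunc M).sub_const _

section

variable {Ω : Type*} [mΩ : MeasurableSpace Ω] {P : Measure Ω} [IsProbabilityMeasure P]
  {X : ℤ → Ω → ℝ} {c γ₁ b : ℝ}

theorem abs_centered_le {M : ℝ} (hM : 0 ≤ M) (i : ℤ) (x : ℝ) :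
    |centered P X M i x| ≤ 2 * M := by
  have h1 : |∫ ω, trunc M (X i ω) ∂P| ≤ M := by
    have := norm_integral_le_of_norm_le_const (μ := P) (f := fun ω => trunc M (X i ω)) (C := M)
      (Filter.Eventually.of_forall fun ω => abs_trunc_le hM _)
    simpa using this
  calc |centered P X M i x| ≤ |trunc M x| + |∫ ω, trunc M (X i ω) ∂P| := abs_sub _ _
    _ ≤ M + M := add_le_add (abs_trunc_le hM x) h1
    _ = 2 * M := by ring

theorem IsMixing.integral_sum_centered (h : IsMixing P X c γ₁ b) {M : ℝ} (hM : 0 ≤ M)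
    (K : Finset ℤ) : ∫ ω, ∑ i ∈ K, centered P X M i (X i ω) ∂P = 0 := by
  unfold centered
  have hi : ∀ i ∈ K, Integrable (fun ω => trunc M (X i ω) - ∫ ω, trunc M (X i ω) ∂P) P :=
    fun i _ => (h.integrable_trunc i hM).sub (integrable_const _)
  rw [integral_finsetSum _ hi]
  refine Finset.sum_eq_zero fun i _ => ?_
  rw [integral_sub (h.integrable_trunc i hM) (integrable_const _)]
  simp

theorem IsMixing.sum_centered_eq (h : IsMixing P X c γ₁ b) {M : ℝ} (hM : 0 ≤ M) (K : Finset ℤ)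
    (ω : Ω) : ∑ i ∈ K, centered P X M i (X i ω) =
      ∑ i ∈ K, trunc M (X i ω) - ∫ ω, ∑ i ∈ K, trunc M (X i ω) ∂P := by
  unfold centered
  rw [Finset.sum_sub_distrib, integral_finsetSum _ fun i _ => h.integrable_trunc i hM]

end

theorem exists_mul_exp_neg_le (p C : ℝ) {c c' δ : ℝ} (hC : 0 ≤ C) (hc : c' < c) (hδ : 0 < δ) :
    ∃ C' : ℝ, 0 < C' ∧ ∀ x : ℝ, 1 ≤ x →
      C * x ^ p * Real.exp (-(c * x ^ δ)) ≤ C' * Real.exp (-(c' * x ^ δ)) := by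
  obtain ⟨K, hK, h⟩ := exists_rpow_mul_exp_neg_le p (sub_pos.2 hc) hδ
  refine ⟨(C + 1) * K, by positivity, fun x hx => ?_⟩
  have e : Real.exp (-(c * x ^ δ)) =
      Real.exp (-((c - c') * x ^ δ)) * Real.exp (-(c' * x ^ δ)) := by
    rw [← Real.exp_add]; ring_nf
  rw [e]
  calc C * x ^ p * (Real.exp (-((c - c') * x ^ δ)) * Real.exp (-(c' * x ^ δ)))
      = C * (x ^ p * Real.exp (-((c - c') * x ^ δ))) * Real.exp (-(c' * x ^ δ)) := by ring
    _ ≤ (C + 1) * K * Real.exp (-(c' * x ^ δ)) := by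
        gcongr
        · linarith
        · exact h x hx

set_option maxHeartbeats 1000000 in
/-- The bound for the Laplace transform of a centered sum over an interval. -/
theorem exists_integral_exp_centered_le.{u} {c γ γ₁ b : ℝ} (hc : 0 < c) (hγ : 0 < γ) (hγ1 : γ < 1)
    (hγ₁ : 0 < γ₁) (hb : 0 ≤ b) (hγb : 1 / γ = 1 / γ₁ + b) :
    ∃ t₀ K δ : ℝ, 0 < t₀ ∧ t₀ ≤ 1 ∧ 0 < K ∧ 0 < δ ∧ ∀ B : ℝ, 1 ≤ B →
      ∀ {Ω : Type u} [MeasurableSpace Ω] {P : Measure Ω} [IsProbabilityMeasure P]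
        {X : ℤ → Ω → ℝ}, IsMixing P X c γ₁ b → truncVar P X < ∞ → ∀ a : ℤ, 0 ≤ a → ∀ t : ℝ,
        |t| ≤ t₀ * B ^ (-(γ₁ * (1 / γ - 1))) →
        ∫ ω, Real.exp (t * ∑ i ∈ Finset.Ioc a (a + blockLength γ B),
          centered P X (truncLevel γ₁ b (blockLength γ B)) i (X i ω)) ∂P ≤
          Real.exp (K * t ^ 2 * (blockLength γ B *
            ((truncVar P X).toReal + Real.exp (-(δ * B ^ (γ₁ * (1 - γ))))))) := by
  obtain ⟨t₀, C, δ, ht₀, ht₀1, hC, hδ, hblock⟩ :=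
    exists_integral_exp_block_le.{u} hc hγ hγ1 hγ₁ hb hγb
  set w := γ₁ * (1 - γ) with hw
  have hw0 : 0 < w := mul_pos hγ₁ (by linarith)
  set d := γ₁ * (1 / γ - 1) with hd
  have hγ' : 1 < 1 / γ := by rw [lt_div_iff₀ hγ]; linarith
  have hd0 : 0 < d := mul_pos hγ₁ (by linarith)
  set E := truncErr b with hE
  have hEp : 0 < E := truncErr_pos b
  -- The second entry controls the mean of the truncated sum, of order `exp(-A ^ γ₁ / 2)` up to a
  -- factor `B`, through `A ≥ B / 4`.
  set δ₁ := min δ ((4 : ℝ) ^ (-γ₁) / 2) with hδ₁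
  have hδ₁0 : 0 < δ₁ := by positivity
  obtain ⟨C₂, hC₂, hp1⟩ := exists_mul_exp_neg_le 1 E (c := δ₁) (c' := δ₁ / 2) hEp.le
    (by linarith) hw0
  set C₃ := C + C₂ with hC₃
  obtain ⟨C₄, hC₄, hp2⟩ := exists_mul_exp_neg_le (2 * d) (C₃ / t₀ ^ 2) (c := δ₁ / 2)
    (c' := δ₁ / 4) (by positivity) (by linarith) hw0
  have hC₃0 : 0 < C₃ := by positivity
  set K := 2 * Real.exp (1 + C₃) * ((1 + C₃) * C + C₄) with hK
  have he1 : 1 ≤ Real.exp (1 + C₃) := Real.one_le_exp (by linarith)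
  have hK0 : 0 < K := by positivity
  refine ⟨t₀, K, δ₁ / 4, ht₀, ht₀1, hK0, by positivity, ?_⟩
  intro B hB Ω _ P _ X h hV a ha t ht
  have hB0 : 0 < B := by linarith
  set A := blockLength γ B with hA
  have hA0 : 0 < A := blockLength_pos hγ1 hB
  have hA1 : (1 : ℝ) ≤ A := by exact_mod_cast hA0
  have hAB : (A : ℝ) ≤ B := blockLength_le hγ hγ1 hB
  have hBA : B / 4 ≤ A := le_blockLength hγ1 hB
  set M := truncLevel γ₁ b A with hM
  have hM0 : 0 ≤ M := by rw [hM]; unfold truncLevel; positivity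
  set V := (truncVar P X).toReal with hVd
  have hV0 : 0 ≤ V := ENNReal.toReal_nonneg
  set I := Finset.Ioc a (a + (A : ℤ)) with hI
  have hIpos : ∀ i ∈ I, 0 < i := fun i hi => by
    have := Finset.mem_Ioc.1 hi
    omega
  have hIc : I.card = A := by rw [hI, Int.card_Ioc]; omega
  set Y := fun ω => ∑ i ∈ I, centered P X M i (X i ω) with hY
  set m := ∫ ω, ∑ i ∈ I, trunc M (X i ω) ∂P with hm
  have hYeq : ∀ ω, Y ω = ∑ i ∈ I, trunc M (X i ω) - m := h.sum_centered_eq hM0 I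
  have hY0 : ∫ ω, Y ω ∂P = 0 := h.integral_sum_centered hM0 I
  have hYe : ∀ s ω, Real.exp (s * Y ω) =
      Real.exp (-(s * m)) * Real.exp (s * ∑ i ∈ I, trunc M (X i ω)) := fun s ω => by
    rw [hYeq, ← Real.exp_add]; ring_nf
  have hexp : ∀ s, Integrable (fun ω => Real.exp (s * Y ω)) P := fun s => by
    simp only [hYe]
    exact (h.integrable_exp_sum_trunc hM0 I s).const_mul _
  have hYi : Integrable Y P := integrable_finsetSum _ fun i _ =>
    (h.integrable_trunc i hM0).sub (integrable_const _)
  have hBd1 : B ^ (-d) ≤ 1 := Real.rpow_le_one_of_one_le_of_nonpos hB (by linarith)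
  set s₀ := t₀ * B ^ (-d) with hs₀
  have hs₀0 : 0 < s₀ := by positivity
  have hs₀1 : s₀ ≤ 1 := by
    calc s₀ ≤ 1 * 1 := by rw [hs₀]; gcongr
      _ = 1 := one_mul 1
  set F := Real.exp (-(δ₁ / 2 * B ^ w)) with hF
  have hF0 : 0 < F := Real.exp_pos _
  have hF1 : F ≤ 1 := Real.exp_le_one_iff.2 (by
    have : 0 ≤ δ₁ / 2 * B ^ w := by positivity
    linarith)
  have hBw : B ^ w ≤ B ^ γ₁ := Real.rpow_le_rpow_of_exponent_le hB (by rw [hw]; nlinarith)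
  have hmF : |m| ≤ C₂ * F := by
    refine le_trans ?_ (hp1 B hB)
    have h1 := h.abs_integral_sum_trunc_le (s := (A : ℝ) ^ γ₁) (by positivity) hIpos (L := B)
      (by rw [hIc]; exact hAB)
    refine h1.trans ?_
    have h2 : B ^ γ₁ * 4 ^ (-γ₁) ≤ (A : ℝ) ^ γ₁ := by
      calc B ^ γ₁ * 4 ^ (-γ₁) = (B / 4) ^ γ₁ := by
            rw [Real.div_rpow hB0.le (by norm_num), Real.rpow_neg (by norm_num)]; rfl
        _ ≤ _ := by gcongr
    have h3 : δ₁ * B ^ w ≤ (A : ℝ) ^ γ₁ / 2 := by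
      calc δ₁ * B ^ w ≤ (4 : ℝ) ^ (-γ₁) / 2 * B ^ γ₁ := by
            gcongr
            exact min_le_right _ _
        _ = B ^ γ₁ * 4 ^ (-γ₁) / 2 := by ring
        _ ≤ _ := by gcongr
    calc B * (E * Real.exp (-((A : ℝ) ^ γ₁ / 2))) ≤ B * (E * Real.exp (-(δ₁ * B ^ w))) := by
          gcongr
      _ = _ := by rw [Real.rpow_one]; ring
  set q := C * (A * V) with hq
  have hq0 : 0 ≤ q := by positivity
  have hdirect : ∀ s, |s| ≤ s₀ → ∫ ω, Real.exp (s * Y ω) ∂P ≤ Real.exp (s ^ 2 * q + C₃ * F) := by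
    intro s hs
    simp only [hYe]
    rw [integral_const_mul]
    have h1 := hblock B hB h hV a ha s hs
    calc _ ≤ Real.exp (C₂ * F) * Real.exp (C * (s ^ 2 * (A * V)) +
          C * Real.exp (-(δ * B ^ w))) := by
          gcongr
          calc -(s * m) ≤ |s * m| := neg_le_abs _
            _ = |s| * |m| := abs_mul _ _
            _ ≤ 1 * (C₂ * F) := by
              gcongr
              exact hs.trans hs₀1
            _ = _ := one_mul _
      _ ≤ Real.exp (C₂ * F) * Real.exp (C * (s ^ 2 * (A * V)) + C * F) := by
          have h3 : δ₁ / 2 ≤ δ := by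
            have : δ₁ ≤ δ := min_le_left _ _
            linarith
          have h4 : Real.exp (-(δ * B ^ w)) ≤ F := by rw [hF]; gcongr
          gcongr
      _ = _ := by
          rw [← Real.exp_add, hq, hC₃]
          ring_nf
  have hC3F : C₃ * F ≤ C₃ := mul_le_of_le_one_right hC₃0.le hF1
  have hfin : C₃ * F / s₀ ^ 2 ≤ C₄ * Real.exp (-(δ₁ / 4 * B ^ w)) := by
    refine le_trans (le_of_eq ?_) (hp2 B hB)
    have h1 : B ^ (2 * d) * (B ^ (-d)) ^ 2 = 1 := by
      rw [← Real.rpow_natCast, ← Real.rpow_mul hB0.le, ← Real.rpow_add hB0]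
      rw [show 2 * d + -d * ((2 : ℕ) : ℝ) = 0 by push_cast; ring, Real.rpow_zero]
    have h2 : B ^ (2 * d) = 1 / (B ^ (-d)) ^ 2 := by
      rw [eq_div_iff (by positivity)]; exact h1
    rw [← hF, hs₀, mul_pow, h2]
    field_simp
  set ε := Real.exp (-(δ₁ / 4 * B ^ w)) with hε
  have hε0 : 0 < ε := Real.exp_pos _
  have hAε : ε ≤ A * ε := le_mul_of_one_le_left hε0.le hA1
  have hAV : 0 ≤ (A : ℝ) * V := by positivity
  have hgoal : 2 * Real.exp (1 + C₃) * (t ^ 2 * ((1 + C₃) * q + C₃ * F / s₀ ^ 2)) ≤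
      K * t ^ 2 * (A * (V + ε)) := by
    have h1 : (1 + C₃) * q + C₃ * F / s₀ ^ 2 ≤ ((1 + C₃) * C + C₄) * (A * (V + ε)) := by
      have h2 : (1 + C₃) * q ≤ (1 + C₃) * C * (A * (V + ε)) := by
        rw [hq, ← mul_assoc]
        gcongr
        linarith
      have h3 : C₄ * ε ≤ C₄ * (A * (V + ε)) := by
        gcongr
        nlinarith
      linarith
    calc _ ≤ 2 * Real.exp (1 + C₃) * (t ^ 2 * (((1 + C₃) * C + C₄) * (A * (V + ε)))) := by
          gcongr
      _ = _ := by rw [hK]; ring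
  have hs2 : 0 ≤ C₃ * F / s₀ ^ 2 := by positivity
  -- If `t ^ 2 * q ≥ 1`, the additive error is absorbed by the main term. Otherwise the bound is
  -- interpolated from the endpoints `s` and `-s`, where `s` is the smaller of `s₀` and `1 / √q`:
  -- there the exponent is bounded, and `1 / s ^ 2 ≤ 1 / s₀ ^ 2 + q`. The power `B ^ (2 * d)` hidden
  -- in `1 / s₀ ^ 2` is absorbed by `F`.
  rcases le_or_gt 1 (t ^ 2 * q) with hcase | hcase
  · refine (hdirect t ht).trans (Real.exp_le_exp.2 (le_trans ?_ hgoal))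
    have h1 : t ^ 2 * q + C₃ * F ≤ (1 + C₃) * (t ^ 2 * q) := by nlinarith
    have h2 : 0 ≤ t ^ 2 * ((1 + C₃) * q + C₃ * F / s₀ ^ 2) := by positivity
    have h3 : (1 + C₃) * (t ^ 2 * q) ≤ t ^ 2 * ((1 + C₃) * q + C₃ * F / s₀ ^ 2) := by
      have : 0 ≤ t ^ 2 * (C₃ * F / s₀ ^ 2) := by positivity
      linarith
    nlinarith
  · obtain ⟨s, hs, hss₀, hts, hsq, hsi⟩ : ∃ s, 0 < s ∧ s ≤ s₀ ∧ |t| ≤ s ∧ s ^ 2 * q ≤ 1 ∧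
        1 / s ^ 2 ≤ 1 / s₀ ^ 2 + q := by
      rcases le_or_gt (s₀ ^ 2 * q) 1 with h1 | h1
      · exact ⟨s₀, hs₀0, le_rfl, ht, h1, by linarith⟩
      · have hqp : 0 < q := by
          by_contra hcon
          have : q = 0 := le_antisymm (not_lt.1 hcon) hq0
          rw [this] at h1
          linarith
        have hsq : (1 / Real.sqrt q) ^ 2 = 1 / q := by
          rw [div_pow, Real.sq_sqrt hq0, one_pow]
        refine ⟨1 / Real.sqrt q, by positivity, ?_, ?_, ?_, ?_⟩
        · refine le_of_sq_le_sq ?_ hs₀0.le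
          rw [hsq, div_le_iff₀ hqp]
          exact h1.le
        · refine le_of_sq_le_sq ?_ (by positivity)
          rw [hsq, sq_abs, le_div_iff₀ hqp]
          exact hcase.le
        · rw [hsq]; field_simp; exact le_rfl
        · rw [hsq, one_div_one_div]
          have : 0 < 1 / s₀ ^ 2 := by positivity
          linarith
    have hQ0 : 0 ≤ s ^ 2 * q + C₃ * F := by positivity
    have hkey := integral_exp_le_of_endpoints hYi hY0 hexp hs hQ0 (R := 1 + C₃) (by linarith)
      (hdirect s (by rwa [abs_of_pos hs]))
      (by
        have := hdirect (-s) (by rwa [abs_neg, abs_of_pos hs])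
        rwa [neg_sq] at this) hts
    refine hkey.trans (Real.exp_le_exp.2 (le_trans ?_ hgoal))
    rw [mul_assoc]
    refine mul_le_mul_of_nonneg_left ?_ (by positivity)
    calc (t / s) ^ 2 * (s ^ 2 * q + C₃ * F) = t ^ 2 * (q + C₃ * F * (1 / s ^ 2)) := by
          field_simp
      _ ≤ t ^ 2 * (q + C₃ * F * (1 / s₀ ^ 2 + q)) := by gcongr
      _ ≤ t ^ 2 * ((1 + C₃) * q + C₃ * F / s₀ ^ 2) := by
          refine mul_le_mul_of_nonneg_left ?_ (sq_nonneg t)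
          rw [mul_add, mul_one_div]
          have : C₃ * F * q ≤ C₃ * q := mul_le_mul_of_nonneg_right hC3F hq0
          linarith

/-! ### Maximal inequalities for sums over blocks of one parity. -/

/-- A maximal inequality for partial sums under a one-step bound on the event that the partial sums
have not yet entered `S`. -/
theorem measureReal_exists_mem_le {Ω : Type*} [MeasurableSpace Ω] {P : Measure Ω}
    [IsProbabilityMeasure P] {U : ℕ → Ω → ℝ} (hU : ∀ k, Measurable (U k)) {u₀ : ℝ}
    (hU0 : ∀ ω, U 0 ω = u₀) {S : Set ℝ} (hS : MeasurableSet S) {f : ℝ → ℝ} (hf0 : ∀ u, 0 ≤ f u)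
    (hfi : ∀ k, Integrable (fun ω => f (U k ω)) P) {s : ℝ} (hs : ∀ u ∈ S, s ≤ f u)
    {m d : ℝ} (hm : 1 ≤ m) (hd : 0 ≤ d) {N : ℕ}
    (hstep : ∀ k < N, ∫ ω, {ω | ∃ j ≤ k, U j ω ∈ S}ᶜ.indicator (fun ω => f (U (k + 1) ω)) ω ∂P ≤
      m * ∫ ω, {ω | ∃ j ≤ k, U j ω ∈ S}ᶜ.indicator (fun ω => f (U k ω)) ω ∂P + d) (hs0 : 0 ≤ s) :
    s * P.real {ω | ∃ j ≤ N, U j ω ∈ S} ≤ m ^ N * (f u₀ + N * d) := by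
  set E : ℕ → Set Ω := fun k => {ω | ∃ j ≤ k, U j ω ∈ S} with hE
  have hEm : ∀ k, MeasurableSet (E k) := fun k => by
    have : E k = ⋃ j ∈ Finset.range (k + 1), U j ⁻¹' S := by
      ext ω; simp [hE]
    rw [this]
    exact Finset.measurableSet_biUnion _ fun j _ => hU j hS
  set a : ℕ → ℝ := fun k => ∫ ω, (E k)ᶜ.indicator (fun ω => f (U k ω)) ω ∂P with ha
  have ha0 : ∀ k, 0 ≤ a k := fun k => integral_nonneg fun ω =>
    Set.indicator_nonneg (fun _ _ => hf0 _) _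
  -- This is the mean of `f (U k)` with its value replaced by `s` once `S` has been entered. A path
  -- that enters at step `k + 1` has `f ≥ s`, so the replacement only decreases the mean.
  have key : ∀ k ≤ N, a k + s * P.real (E k) ≤ m ^ k * (f u₀ + k * d) := by
    intro k
    induction k with
    | zero =>
      intro _
      simp only [pow_zero, Nat.cast_zero, zero_mul, add_zero, one_mul]
      by_cases h0 : u₀ ∈ S
      · have : E 0 = Set.univ := by ext ω; simp [hE, hU0, h0]
        simp [ha, this, hs _ h0]
      · have : E 0 = ∅ := by ext ω; simp [hE, hU0, h0]
        simp [ha, this, hU0]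
    | succ k ih =>
      intro hk
      have h1 : a (k + 1) + s * P.real (E (k + 1)) ≤
          ∫ ω, (E k)ᶜ.indicator (fun ω => f (U (k + 1) ω)) ω ∂P + s * P.real (E k) := by
        have e1 : ∀ j, s * P.real (E j) = ∫ ω, (E j).indicator (fun _ => s) ω ∂P := fun j => by
          rw [integral_indicator_const _ (hEm j), smul_eq_mul, mul_comm]
        have i1 : ∀ j, Integrable ((E j).indicator fun _ => s) P := fun j =>
          (integrable_const _).indicator (hEm j)
        have i2 : ∀ j, Integrable ((E j)ᶜ.indicator fun ω => f (U (k + 1) ω)) P := fun j =>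
          (hfi _).indicator (hEm j).compl
        rw [e1, e1, ha]
        simp only
        rw [← integral_add (i2 _) (i1 _), ← integral_add (i2 _) (i1 _)]
        refine integral_mono ((i2 _).add (i1 _)) ((i2 _).add (i1 _)) fun ω => ?_
        simp only
        by_cases hk1 : ω ∈ E k
        · have hk2 : ω ∈ E (k + 1) := by
            obtain ⟨j, hj, hjS⟩ := hk1
            exact ⟨j, by omega, hjS⟩
          simp [hk1, hk2]
        · by_cases hk2 : ω ∈ E (k + 1)
          · have h3 : U (k + 1) ω ∈ S := by
              obtain ⟨j, hj, hjS⟩ := hk2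
              rcases Nat.lt_or_ge j (k + 1) with h4 | h4
              · exact absurd ⟨j, by omega, hjS⟩ hk1
              · rwa [← le_antisymm hj h4]
            simp [hk1, hk2, hs _ h3]
          · simp [hk1, hk2]
      have h2 := hstep k hk
      have h3 := ih (by omega)
      have hmk : 1 ≤ m ^ (k + 1) := one_le_pow₀ hm
      have hp : 0 ≤ s * P.real (E k) := by positivity
      calc a (k + 1) + s * P.real (E (k + 1)) ≤ m * a k + d + s * P.real (E k) := by linarith
        _ ≤ m * (a k + s * P.real (E k)) + d := by nlinarith
        _ ≤ m * (m ^ k * (f u₀ + k * d)) + m ^ (k + 1) * d := by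
            gcongr
            exact le_mul_of_one_le_left hd hmk
        _ = _ := by push_cast; ring
  have := key N le_rfl
  linarith [ha0 N]

/-- The sum of the centered truncated variables over the `k`-th of the blocks of length `A` whose
number has the same parity as `π`. -/
noncomputable def blockSum {Ω : Type*} [MeasurableSpace Ω] (P : Measure Ω) (X : ℤ → Ω → ℝ) (M : ℝ)
    (A π k : ℕ) (ω : Ω) : ℝ :=
  ∑ i ∈ Finset.Ioc (((2 * k + π) * A : ℕ) : ℤ) ((((2 * k + π) * A : ℕ) : ℤ) + A),
    centered P X M i (X i ω)

theorem measurable_blockSum_past {Ω : Type*} [MeasurableSpace Ω] {P : Measure Ω}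
    {X : ℤ → Ω → ℝ} {M : ℝ} {A π k : ℕ} {p : ℤ}
    (hp : (((2 * k + π) * A : ℕ) : ℤ) + A ≤ p) :
    Measurable[past X p] (blockSum P X M A π k) := by
  unfold blockSum
  refine Finset.measurable_sum _ fun i hi => ?_
  exact (measurable_centered M i).comp
    (measurable_past ((Finset.mem_Ioc.1 hi).2.trans hp))

/-- The blocks before the `k`-th of the same parity end at least `A` before its start; the skipped
block of the other parity is the gap. -/
theorem measurable_sum_blockSum_past {Ω : Type*} [MeasurableSpace Ω] {P : Measure Ω}
    {X : ℤ → Ω → ℝ} {M : ℝ} {A π j k : ℕ} (hjk : j ≤ k) :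
    Measurable[past X ((((2 * k + π) * A : ℕ) : ℤ) - A)]
      (fun ω => ∑ q ∈ Finset.range j, blockSum P X M A π q ω) := by
  refine Finset.measurable_sum _ fun q hq => measurable_blockSum_past ?_
  have hqk : q + 1 ≤ k := (Finset.mem_range.1 hq).trans_le hjk
  have : (2 * q + π) * A + 2 * A ≤ (2 * k + π) * A := by
    calc (2 * q + π) * A + 2 * A = (2 * (q + 1) + π) * A := by ring
      _ ≤ _ := by gcongr
  push_cast at this ⊢
  zify at this
  linarith

theorem measurableSet_exists_mem_past {Ω : Type*} [MeasurableSpace Ω] {P : Measure Ω}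
    {X : ℤ → Ω → ℝ} {M : ℝ} {A π k : ℕ} {S : Set ℝ} (hS : MeasurableSet S) :
    MeasurableSet[past X ((((2 * k + π) * A : ℕ) : ℤ) - A)]
      {ω | ∃ j ≤ k, ∑ q ∈ Finset.range j, blockSum P X M A π q ω ∈ S} := by
  have : {ω | ∃ j ≤ k, ∑ q ∈ Finset.range j, blockSum P X M A π q ω ∈ S} =
      ⋃ j ∈ Finset.range (k + 1),
        (fun ω => ∑ q ∈ Finset.range j, blockSum P X M A π q ω) ⁻¹' S := by
    ext ω; simp
  rw [this]
  exact Finset.measurableSet_biUnion _ fun j hj =>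
    measurable_sum_blockSum_past (Nat.lt_succ_iff.1 (Finset.mem_range.1 hj)) hS

section

variable {Ω : Type*} [mΩ : MeasurableSpace Ω] {P : Measure Ω} [IsProbabilityMeasure P]
  {X : ℤ → Ω → ℝ} {c γ₁ b : ℝ}

theorem IsMixing.measurable_blockSum (h : IsMixing P X c γ₁ b) (M : ℝ) (A π k : ℕ) :
    Measurable (blockSum P X M A π k) :=
  (measurable_blockSum_past le_rfl).mono (past_le h.meas _) le_rfl

theorem abs_sum_centered_le {M : ℝ} (hM : 0 ≤ M) {J : Finset ℤ} {L : ℝ} (hL : (J.card : ℝ) ≤ L)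
    (x : ℤ → ℝ) : |∑ i ∈ J, centered P X M i (x i)| ≤ 2 * M * L := by
  calc _ ≤ ∑ i ∈ J, |centered P X M i (x i)| := Finset.abs_sum_le_sum_abs _ _
    _ ≤ ∑ i ∈ J, 2 * M := Finset.sum_le_sum fun i _ => abs_centered_le hM i _
    _ = J.card * (2 * M) := by rw [Finset.sum_const, nsmul_eq_mul]
    _ ≤ L * (2 * M) := by gcongr
    _ = _ := by ring

theorem card_block (a : ℤ) (A : ℕ) : (Finset.Ioc a (a + A)).card = A := by
  rw [Int.card_Ioc]; omega

theorem abs_blockSum_le {M : ℝ} (hM : 0 ≤ M) (A π k : ℕ) (ω : Ω) :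
    |blockSum P X M A π k ω| ≤ 2 * M * A :=
  abs_sum_centered_le hM (by rw [card_block]) fun i => X i ω

theorem abs_sum_blockSum_le {M : ℝ} (hM : 0 ≤ M) (A π k : ℕ) (ω : Ω) :
    |∑ q ∈ Finset.range k, blockSum P X M A π q ω| ≤ k * (2 * M * A) := by
  calc _ ≤ ∑ q ∈ Finset.range k, |blockSum P X M A π q ω| := Finset.abs_sum_le_sum_abs _ _
    _ ≤ ∑ q ∈ Finset.range k, 2 * M * A := Finset.sum_le_sum fun q _ => abs_blockSum_le hM A π q ω
    _ = _ := by rw [Finset.sum_const, nsmul_eq_mul, Finset.card_range]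

/-- First-entry argument with `f u = exp(θ * u)`. Before entry this function is at most `exp y`, so
decoupling the next block costs at most `exp y` times a small quantity, and the final division by
`exp y` removes that factor. -/
theorem IsMixing.measureReal_exists_exp_le (h : IsMixing P X c γ₁ b) {M : ℝ} (hM : 0 ≤ M) {A : ℕ}
    (hA : 1 ≤ A) (π N : ℕ) (y : ℝ) (θ : ℝ) {m : ℝ} (hm : 1 ≤ m)
    (hlap : ∀ a : ℤ, 0 ≤ a → ∫ ω, Real.exp (θ * ∑ i ∈ Finset.Ioc a (a + A),
      centered P X M i (X i ω)) ∂P ≤ m) :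
    P.real {ω | ∃ j ≤ N, y ≤ θ * ∑ q ∈ Finset.range j, blockSum P X M A π q ω} ≤
      m ^ N * (Real.exp (-y) + N * (|θ| * Real.exp (|θ| * (2 * M * A)) * A *
        Real.exp (-(c * (A : ℝ) ^ γ₁)))) := by
  set δ := |θ| * Real.exp (|θ| * (2 * M * A)) * A * Real.exp (-(c * (A : ℝ) ^ γ₁)) with hδ
  have hδ0 : 0 ≤ δ := by positivity
  set S : Set ℝ := {u | y ≤ θ * u} with hS
  have hSm : MeasurableSet S := measurableSet_le measurable_const (measurable_id.const_mul θ)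
  set U : ℕ → Ω → ℝ := fun k ω => ∑ q ∈ Finset.range k, blockSum P X M A π q ω with hU
  have hUm : ∀ k, Measurable (U k) := fun k =>
    Finset.measurable_sum _ fun q _ => h.measurable_blockSum M A π q
  have hexpi : ∀ k, Integrable (fun ω => Real.exp (θ * U k ω)) P := fun k => by
    refine Integrable.of_bound (C := Real.exp (|θ| * (k * (2 * M * A))))
      ((hUm k).const_mul θ).exp.aestronglyMeasurable (Filter.Eventually.of_forall fun ω => ?_)
    rw [Real.norm_of_nonneg (Real.exp_pos _).le]
    refine Real.exp_le_exp.2 ((le_abs_self _).trans ?_)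
    rw [abs_mul]
    gcongr
    exact abs_sum_blockSum_le hM A π k ω
  have hstep : ∀ k < N, ∫ ω, {ω | ∃ j ≤ k, U j ω ∈ S}ᶜ.indicator
      (fun ω => Real.exp (θ * U (k + 1) ω)) ω ∂P ≤
      m * ∫ ω, {ω | ∃ j ≤ k, U j ω ∈ S}ᶜ.indicator (fun ω => Real.exp (θ * U k ω)) ω ∂P +
        Real.exp y * δ := by
    intro k _
    set E := {ω | ∃ j ≤ k, U j ω ∈ S} with hE
    set p : ℤ := (((2 * k + π) * A : ℕ) : ℤ) - A with hp
    set G := Eᶜ.indicator fun ω => Real.exp (θ * U k ω) with hG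
    have hEm : MeasurableSet[past X p] E := measurableSet_exists_mem_past hSm
    have hUp : Measurable[past X p] fun ω => Real.exp (θ * U k ω) :=
      ((measurable_sum_blockSum_past le_rfl).const_mul θ).exp
    have hGm : Measurable[past X p] G := hUp.indicator hEm.compl
    have hG0 : ∀ ω, 0 ≤ G ω := fun ω => Set.indicator_nonneg (fun _ _ => (Real.exp_pos _).le) _
    have hGb : ∀ ω, |G ω| ≤ Real.exp y := fun ω => by
      rw [abs_of_nonneg (hG0 ω)]
      by_cases hω : ω ∈ Eᶜ
      · rw [hG, Set.indicator_of_mem hω]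
        refine Real.exp_le_exp.2 ?_
        by_contra hcon
        exact hω ⟨k, le_rfl, (not_le.1 hcon).le⟩
      · rw [hG, Set.indicator_of_notMem hω]
        exact (Real.exp_pos y).le
    have e1 : ∀ ω, Eᶜ.indicator (fun ω => Real.exp (θ * U (k + 1) ω)) ω =
        G ω * Real.exp (θ * blockSum P X M A π k ω) := fun ω => by
      by_cases hω : ω ∈ Eᶜ
      · rw [hG, Set.indicator_of_mem hω, Set.indicator_of_mem hω, ← Real.exp_add, ← mul_add, hU]
        simp only
        rw [Finset.sum_range_succ]
      · rw [hG, Set.indicator_of_notMem hω, Set.indicator_of_notMem hω, zero_mul]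
    simp only [e1]
    have key := h.abs_integral_mul_exp_sub_le (p := p) hA
      (J := Finset.Ioc (((2 * k + π) * A : ℕ) : ℤ) ((((2 * k + π) * A : ℕ) : ℤ) + A))
      (fun j hj => by
        have := (Finset.mem_Ioc.1 hj).1
        rw [hp]
        linarith)
      (ψ := centered P X M) (abs_centered_sub_centered_le M)
      (R := 2 * M) (by positivity) (fun j _ => abs_centered_le hM j) (L := A)
      (by rw [card_block]) (θ := θ) le_rfl hGm (Real.exp_pos y).le hGb
    have key2 := (abs_le.1 key).2
    have hl := hlap (((2 * k + π) * A : ℕ) : ℤ) (by positivity)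
    have h3 : (∫ ω, G ω ∂P) * ∫ ω, Real.exp (θ * ∑ i ∈ Finset.Ioc (((2 * k + π) * A : ℕ) : ℤ)
        ((((2 * k + π) * A : ℕ) : ℤ) + A), centered P X M i (X i ω)) ∂P ≤ (∫ ω, G ω ∂P) * m :=
      mul_le_mul_of_nonneg_left hl (integral_nonneg hG0)
    have h4 : Real.exp y * (|θ| * Real.exp (|θ| * (2 * M * A))) * A *
        Real.exp (-(c * (A : ℝ) ^ γ₁)) = Real.exp y * δ := by rw [hδ]; ring
    rw [h4] at key2
    unfold blockSum
    linarith
  have hmax := measureReal_exists_mem_le hUm (u₀ := 0) (fun ω => by simp [hU]) hSm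
    (f := fun u => Real.exp (θ * u)) (fun u => (Real.exp_pos _).le) hexpi (s := Real.exp y)
    (fun u hu => Real.exp_le_exp.2 hu) hm (by positivity) hstep (Real.exp_pos y).le
  rw [mul_zero, Real.exp_zero] at hmax
  have hey : Real.exp (-y) * Real.exp y = 1 := by rw [← Real.exp_add]; simp
  calc _ = Real.exp (-y) * (Real.exp y * P.real {ω | ∃ j ≤ N, U j ω ∈ S}) := by
        rw [← mul_assoc, hey, one_mul]; rfl
    _ ≤ Real.exp (-y) * (m ^ N * (1 + N * (Real.exp y * δ))) := by gcongr
    _ = m ^ N * (Real.exp (-y) + N * ((Real.exp (-y) * Real.exp y) * δ)) := by ring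
    _ = _ := by rw [hey, one_mul]

/-- First-entry argument with `f u = u ^ 2`. Before entry `|U k| ≤ y`, and the next block is
centered, so the cross term is bounded by the decoupling error alone. -/
theorem IsMixing.measureReal_exists_sq_le (h : IsMixing P X c γ₁ b) {M : ℝ} (hM : 0 ≤ M) {A : ℕ}
    (hA : 1 ≤ A) (π N : ℕ) {y : ℝ} (hy : 0 < y) {v : ℝ}
    (hvar : ∀ a : ℤ, 0 ≤ a → ∫ ω, (∑ i ∈ Finset.Ioc a (a + A),
      centered P X M i (X i ω)) ^ 2 ∂P ≤ v) :
    y ^ 2 * P.real {ω | ∃ j ≤ N, y ≤ |∑ q ∈ Finset.range j, blockSum P X M A π q ω|} ≤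
      N * (v + 2 * y * (A * Real.exp (-(c * (A : ℝ) ^ γ₁)))) := by
  set δ := A * Real.exp (-(c * (A : ℝ) ^ γ₁)) with hδ
  have hδ0 : 0 ≤ δ := by positivity
  have hv0 : 0 ≤ v := (integral_nonneg fun ω => sq_nonneg _).trans (hvar 0 le_rfl)
  set S : Set ℝ := {u | y ≤ |u|} with hS
  have hSm : MeasurableSet S := measurableSet_le measurable_const measurable_id.abs
  set U : ℕ → Ω → ℝ := fun k ω => ∑ q ∈ Finset.range k, blockSum P X M A π q ω with hU
  have hUm : ∀ k, Measurable (U k) := fun k =>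
    Finset.measurable_sum _ fun q _ => h.measurable_blockSum M A π q
  have hsqi : ∀ k, Integrable (fun ω => U k ω ^ 2) P := fun k => by
    refine Integrable.of_bound (C := (k * (2 * M * A)) ^ 2)
      ((hUm k).pow_const 2).aestronglyMeasurable (Filter.Eventually.of_forall fun ω => ?_)
    rw [norm_pow, Real.norm_eq_abs]
    gcongr
    exact abs_sum_blockSum_le hM A π k ω
  have hstep : ∀ k < N, ∫ ω, {ω | ∃ j ≤ k, U j ω ∈ S}ᶜ.indicator (fun ω => U (k + 1) ω ^ 2) ω ∂P ≤
      1 * ∫ ω, {ω | ∃ j ≤ k, U j ω ∈ S}ᶜ.indicator (fun ω => U k ω ^ 2) ω ∂P +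
        (v + 2 * y * δ) := by
    intro k _
    set E := {ω | ∃ j ≤ k, U j ω ∈ S} with hE
    set p : ℤ := (((2 * k + π) * A : ℕ) : ℤ) - A with hp
    set Z := blockSum P X M A π k with hZ
    have hZm : Measurable Z := h.measurable_blockSum M A π k
    have hZb : ∀ ω, |Z ω| ≤ 2 * M * A := abs_blockSum_le hM A π k
    set G := Eᶜ.indicator fun ω => U k ω with hG
    have hEm : MeasurableSet[past X p] E := measurableSet_exists_mem_past hSm
    have hEm' : MeasurableSet E := past_le h.meas p _ hEm
    have hUp : Measurable[past X p] fun ω => U k ω := measurable_sum_blockSum_past le_rfl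
    have hGm : Measurable[past X p] G := hUp.indicator hEm.compl
    have hGm' : Measurable G := hGm.mono (past_le h.meas p) le_rfl
    have hGb : ∀ ω, |G ω| ≤ y := fun ω => by
      by_cases hω : ω ∈ Eᶜ
      · rw [hG, Set.indicator_of_mem hω]
        by_contra hcon
        exact hω ⟨k, le_rfl, (not_le.1 hcon).le⟩
      · rw [hG, Set.indicator_of_notMem hω, abs_zero]
        exact hy.le
    have i1 : Integrable (Eᶜ.indicator fun ω => U k ω ^ 2) P := (hsqi k).indicator hEm'.compl
    have i2 : Integrable (fun ω => G ω * Z ω) P := by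
      refine Integrable.of_bound (C := y * (2 * M * A)) (hGm'.mul hZm).aestronglyMeasurable
        (Filter.Eventually.of_forall fun ω => ?_)
      rw [norm_mul]
      exact mul_le_mul (hGb ω) (hZb ω) (abs_nonneg _) hy.le
    have i3 : Integrable (fun ω => Z ω ^ 2) P := by
      refine Integrable.of_bound (C := (2 * M * A) ^ 2) (hZm.pow_const 2).aestronglyMeasurable
        (Filter.Eventually.of_forall fun ω => ?_)
      rw [norm_pow, Real.norm_eq_abs]
      have := hZb ω
      gcongr
    have i12 : Integrable (fun ω => Eᶜ.indicator (fun ω => U k ω ^ 2) ω + 2 * (G ω * Z ω)) P :=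
      i1.add (i2.const_mul 2)
    have hpt : ∀ ω, Eᶜ.indicator (fun ω => U (k + 1) ω ^ 2) ω ≤
        Eᶜ.indicator (fun ω => U k ω ^ 2) ω + 2 * (G ω * Z ω) + Z ω ^ 2 := fun ω => by
      by_cases hω : ω ∈ Eᶜ
      · rw [hG, Set.indicator_of_mem hω, Set.indicator_of_mem hω, Set.indicator_of_mem hω, hU]
        simp only
        rw [Finset.sum_range_succ]
        exact le_of_eq (by ring)
      · rw [hG, Set.indicator_of_notMem hω, Set.indicator_of_notMem hω,
          Set.indicator_of_notMem hω]
        nlinarith [sq_nonneg (Z ω)]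
    have key := abs_integral_mul_sub_le_of_tauCoeff_le h.meas h.integrable (Real.exp_pos _).le
      (h.tau A hA) (p := p)
      (J := Finset.Ioc (((2 * k + π) * A : ℕ) : ℤ) ((((2 * k + π) * A : ℕ) : ℤ) + A))
      (fun j hj => by
        have := (Finset.mem_Ioc.1 hj).1
        rw [hp]
        linarith)
      (ψ := centered P X M) (abs_centered_sub_centered_le M) (H := fun x => x) zero_le_one
      (by simp) hGm hGb
    rw [h.integral_sum_centered hM, mul_zero, sub_zero, card_block] at key
    have key2 := (abs_le.1 key).2
    have hvk : ∫ ω, Z ω ^ 2 ∂P ≤ v := hvar (((2 * k + π) * A : ℕ) : ℤ) (by positivity)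
    have hGZ : ∫ ω, G ω * Z ω ∂P ≤ y * δ := by
      refine key2.trans (le_of_eq ?_)
      rw [hδ]; ring
    calc _ ≤ ∫ ω, (Eᶜ.indicator (fun ω => U k ω ^ 2) ω + 2 * (G ω * Z ω) + Z ω ^ 2) ∂P :=
          integral_mono ((hsqi (k + 1)).indicator hEm'.compl) (i12.add i3) hpt
      _ = ∫ ω, Eᶜ.indicator (fun ω => U k ω ^ 2) ω ∂P + 2 * ∫ ω, G ω * Z ω ∂P +
          ∫ ω, Z ω ^ 2 ∂P := by
          rw [integral_add i12 i3, integral_add i1 (i2.const_mul 2), integral_const_mul]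
      _ ≤ _ := by linarith
  have hmax := measureReal_exists_mem_le hUm (u₀ := 0) (fun ω => by simp [hU]) hSm
    (f := fun u => u ^ 2) (fun u => sq_nonneg u) hsqi (s := y ^ 2)
    (fun u hu => by
      rw [← sq_abs u]
      exact pow_le_pow_left₀ hy.le hu 2) le_rfl (by positivity) hstep (sq_nonneg y)
  rw [one_pow, one_mul, zero_pow two_ne_zero, zero_add] at hmax
  exact hmax

end

/-! ### From partial sums to block sums. -/

/-- A sum over consecutive blocks is the sum over the even blocks plus the sum over the odd ones. -/
theorem sum_Ioc_eq_even_add_odd (f : ℤ → ℝ) (A : ℕ) : ∀ q : ℕ,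
    ∑ i ∈ Finset.Ioc 0 ((q * A : ℕ) : ℤ), f i =
      ∑ k ∈ Finset.range ((q + 1) / 2),
        ∑ i ∈ Finset.Ioc (((2 * k + 0) * A : ℕ) : ℤ) ((((2 * k + 0) * A : ℕ) : ℤ) + A), f i +
      ∑ k ∈ Finset.range (q / 2),
        ∑ i ∈ Finset.Ioc (((2 * k + 1) * A : ℕ) : ℤ) ((((2 * k + 1) * A : ℕ) : ℤ) + A), f i
  | 0 => by simp
  | q + 1 => by
      have hsplit : ∑ i ∈ Finset.Ioc 0 (((q + 1) * A : ℕ) : ℤ), f i =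
          ∑ i ∈ Finset.Ioc 0 ((q * A : ℕ) : ℤ), f i +
            ∑ i ∈ Finset.Ioc ((q * A : ℕ) : ℤ) (((q * A : ℕ) : ℤ) + A), f i := by
        rw [← Finset.sum_union (Finset.disjoint_left.2 fun i h1 h2 => by
          have := Finset.mem_Ioc.1 h1
          have := Finset.mem_Ioc.1 h2
          omega)]
        congr 1
        rw [show (((q + 1) * A : ℕ) : ℤ) = ((q * A : ℕ) : ℤ) + A by push_cast; ring]
        ext i
        simp only [Finset.mem_union, Finset.mem_Ioc]
        omega
      rw [hsplit, sum_Ioc_eq_even_add_odd f A q]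
      rcases Nat.even_or_odd' q with ⟨k, rfl | rfl⟩
      · rw [show (2 * k + 1 + 1) / 2 = k + 1 by omega, show (2 * k + 1) / 2 = k by omega,
          show 2 * k / 2 = k by omega, Finset.sum_range_succ]
        simp only [add_zero]
        ring
      · rw [show (2 * k + 1 + 1 + 1) / 2 = k + 1 by omega, show (2 * k + 1 + 1) / 2 = k + 1 by omega,
          show (2 * k + 1) / 2 = k by omega, Finset.sum_range_succ (fun k =>
            ∑ i ∈ Finset.Ioc (((2 * k + 1) * A : ℕ) : ℤ) ((((2 * k + 1) * A : ℕ) : ℤ) + A), f i) k]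
        ring

section

variable {Ω : Type*} [mΩ : MeasurableSpace Ω] {P : Measure Ω} [IsProbabilityMeasure P]
  {X : ℤ → Ω → ℝ} {c γ₁ b : ℝ}

/-- If the variables are not truncated, then a large partial sum forces a large sum over the even
or over the odd blocks. -/
theorem exists_blockSum_of_partialSum {M : ℝ} (hM : 0 ≤ M) {A n : ℕ} (hA : 1 ≤ A)
    {x μ : ℝ} (hMA : 2 * M * A ≤ x / 4) (hμ : ∀ i : ℤ, 0 < i → |∫ ω, trunc M (X i ω) ∂P| ≤ μ)
    (hμx : n * μ ≤ x / 4) {ω : Ω} (hω : ∀ i : ℕ, 1 ≤ i → i ≤ n → |X i ω| ≤ M)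
    (hx : ∃ j ∈ Finset.Icc 1 n, x ≤ |partialSum X j ω|) :
    (∃ j ≤ n / A, x / 4 ≤ |∑ q ∈ Finset.range j, blockSum P X M A 0 q ω|) ∨
      ∃ j ≤ n / A, x / 4 ≤ |∑ q ∈ Finset.range j, blockSum P X M A 1 q ω| := by
  obtain ⟨j, hj, hjx⟩ := hx
  obtain ⟨hj1, hjn⟩ := Finset.mem_Icc.1 hj
  -- The level `x` is split into quarters: even blocks, odd blocks, the incomplete last block (fewer
  -- than `A` terms, each at most `2 * M`) and the means of the truncated variables.
  by_contra hcon
  push Not at hcon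
  set q := j / A with hq
  have hqn : q ≤ n / A := Nat.div_le_div_right hjn
  have hqA : q * A ≤ j := Nat.div_mul_le_self j A
  have hqA' : j < q * A + A := by
    have := Nat.lt_div_mul_add (a := j) (b := A) (by omega)
    exact this
  have h0 := hcon.1 ((q + 1) / 2) (le_trans (by lia) hqn)
  have h1 := hcon.2 (q / 2) ((Nat.div_le_self q 2).trans hqn)
  have hps : partialSum X j ω = ∑ i ∈ Finset.Ioc 0 (j : ℤ), X i ω := by
    unfold partialSum
    rw [← Finset.sum_image (s := Finset.Icc 1 j) (g := fun i : ℕ => (i : ℤ)) (f := fun i => X i ω)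
      (fun a _ b _ h => Int.ofNat_inj.1 h)]
    congr 1
    ext i
    simp only [Finset.mem_image, Finset.mem_Icc, Finset.mem_Ioc]
    constructor
    · rintro ⟨a, ha, rfl⟩
      omega
    · rintro ⟨ha, ha'⟩
      exact ⟨i.toNat, by omega, by omega⟩
  have hX : ∀ i ∈ Finset.Ioc 0 (j : ℤ), X i ω =
      centered P X M i (X i ω) + ∫ ω, trunc M (X i ω) ∂P := fun i hi => by
    have hi' := Finset.mem_Ioc.1 hi
    have h2 := hω i.toNat (by omega) (by omega)
    rw [Int.toNat_of_nonneg hi'.1.le] at h2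
    unfold centered
    rw [sub_add_cancel, trunc_eq_self h2]
  rw [hps, Finset.sum_congr rfl hX, Finset.sum_add_distrib] at hjx
  have hmean : |∑ i ∈ Finset.Ioc 0 (j : ℤ), ∫ ω, trunc M (X i ω) ∂P| ≤ x / 4 := by
    refine le_trans ?_ hμx
    have hμ0 : 0 ≤ μ := (abs_nonneg _).trans (hμ 1 one_pos)
    calc _ ≤ ∑ i ∈ Finset.Ioc 0 (j : ℤ), |∫ ω, trunc M (X i ω) ∂P| :=
          Finset.abs_sum_le_sum_abs _ _
      _ ≤ ∑ i ∈ Finset.Ioc 0 (j : ℤ), μ :=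
          Finset.sum_le_sum fun i hi => hμ i (Finset.mem_Ioc.1 hi).1
      _ = j * μ := by rw [Finset.sum_const, nsmul_eq_mul, Int.card_Ioc]; simp
      _ ≤ n * μ := by gcongr
  have hrem : |∑ i ∈ Finset.Ioc ((q * A : ℕ) : ℤ) (j : ℤ), centered P X M i (X i ω)| ≤ x / 4 := by
    refine (abs_sum_centered_le hM (L := A) ?_ fun i => X i ω).trans hMA
    rw [Int.card_Ioc]
    exact_mod_cast (by omega : ((j : ℤ) - ((q * A : ℕ) : ℤ)).toNat ≤ A)
  have hsplit : ∑ i ∈ Finset.Ioc 0 (j : ℤ), centered P X M i (X i ω) =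
      ∑ i ∈ Finset.Ioc 0 ((q * A : ℕ) : ℤ), centered P X M i (X i ω) +
        ∑ i ∈ Finset.Ioc ((q * A : ℕ) : ℤ) (j : ℤ), centered P X M i (X i ω) := by
    rw [← Finset.sum_union (Finset.disjoint_left.2 fun i h1 h2 => by
      have := Finset.mem_Ioc.1 h1
      have := Finset.mem_Ioc.1 h2
      omega)]
    congr 1
    ext i
    simp only [Finset.mem_union, Finset.mem_Ioc]
    omega
  rw [hsplit, sum_Ioc_eq_even_add_odd] at hjx
  unfold blockSum at h0 h1
  have := abs_lt.1 h0
  have := abs_lt.1 h1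
  have := abs_le.1 hrem
  have := abs_le.1 hmean
  rcases le_abs.1 hjx with h | h <;> linarith

/-- Outside an event of probability at most `n * exp(1 - s)`, none of the variables up to time `n`
is affected by the truncation at `s ^ b`. -/
theorem IsMixing.measureReal_exists_partialSum_le (h : IsMixing P X c γ₁ b) {s : ℝ} (hs : 0 < s)
    {A n : ℕ} (hA : 1 ≤ A) {x : ℝ} (hMA : 2 * s ^ b * A ≤ x / 4)
    (hμx : n * (truncErr b * Real.exp (-(s / 2))) ≤ x / 4) :
    P.real {ω | ∃ j ∈ Finset.Icc 1 n, x ≤ |partialSum X j ω|} ≤ n * Real.exp (1 - s) +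
      P.real {ω | ∃ j ≤ n / A, x / 4 ≤ |∑ q ∈ Finset.range j, blockSum P X (s ^ b) A 0 q ω|} +
      P.real {ω | ∃ j ≤ n / A, x / 4 ≤ |∑ q ∈ Finset.range j, blockSum P X (s ^ b) A 1 q ω|} := by
  set T : Set Ω := ⋃ i ∈ Finset.Icc 1 n, {ω | s ^ b < |X ((i : ℕ) : ℤ) ω|} with hT
  have hTle : P.real T ≤ n * Real.exp (1 - s) := by
    calc P.real T ≤ ∑ i ∈ Finset.Icc 1 n, P.real {ω | s ^ b < |X ((i : ℕ) : ℤ) ω|} :=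
          measureReal_biUnion_finset_le _ _
      _ ≤ ∑ i ∈ Finset.Icc 1 n, Real.exp (1 - s) := by
          refine Finset.sum_le_sum fun i hi => h.tail i ?_ s hs
          have := (Finset.mem_Icc.1 hi).1
          omega
      _ = _ := by rw [Finset.sum_const, Nat.card_Icc, nsmul_eq_mul]; simp
  set E : ℕ → Set Ω := fun π => {ω | ∃ j ≤ n / A,
    x / 4 ≤ |∑ q ∈ Finset.range j, blockSum P X (s ^ b) A π q ω|} with hE
  have hsub : {ω | ∃ j ∈ Finset.Icc 1 n, x ≤ |partialSum X j ω|} ⊆ T ∪ E 0 ∪ E 1 := by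
    intro ω hω
    by_cases hωT : ω ∈ T
    · exact Or.inl (Or.inl hωT)
    · have h1 : ∀ i : ℕ, 1 ≤ i → i ≤ n → |X i ω| ≤ s ^ b := fun i hi hin => by
        by_contra hcon
        refine hωT ?_
        simp only [hT, Set.mem_iUnion]
        exact ⟨i, Finset.mem_Icc.2 ⟨hi, hin⟩, not_le.1 hcon⟩
      rcases exists_blockSum_of_partialSum (by positivity) hA hMA
        (fun i hi => h.abs_integral_trunc_le hi hs) hμx h1 hω with h2 | h2
      · exact Or.inl (Or.inr h2)
      · exact Or.inr h2
  calc _ ≤ P.real (T ∪ E 0 ∪ E 1) := measureReal_mono hsub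
    _ ≤ P.real T + P.real (E 0) + P.real (E 1) := by
        refine (measureReal_union_le _ _).trans ?_
        gcongr
        exact measureReal_union_le _ _
    _ ≤ _ := by gcongr

theorem IsMixing.integral_sq_sum_centered_le (h : IsMixing P X c γ₁ b) (hV : truncVar P X < ∞)
    {M : ℝ} (hM : 1 ≤ M) {K : Finset ℤ} (hK : ∀ i ∈ K, 0 < i) :
    ∫ ω, (∑ i ∈ K, centered P X M i (X i ω)) ^ 2 ∂P ≤ K.card * (truncVar P X).toReal := by
  have hM0 : 0 ≤ M := by linarith
  refine le_trans (le_of_eq ?_) (h.variance_sum_trunc_le hV hM hK)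
  rw [variance_eq_integral (h.measurable_sum_trunc M K).aemeasurable]
  refine integral_congr_ae (Filter.Eventually.of_forall fun ω => ?_)
  simp only
  rw [h.sum_centered_eq hM0]

/-- Two-sided exponential inequality for the sums over the even or the odd blocks. -/
theorem IsMixing.measureReal_exists_abs_blockSum_le (h : IsMixing P X c γ₁ b) {M : ℝ} (hM : 0 ≤ M)
    {A n : ℕ} (hA : 1 ≤ A) (π : ℕ) (y : ℝ) {t v : ℝ} (ht : 0 < t) (ht1 : t ≤ 1) (hv : 0 ≤ v)
    (hlap : ∀ θ : ℝ, |θ| = t → ∀ a : ℤ, 0 ≤ a → ∫ ω, Real.exp (θ * ∑ i ∈ Finset.Ioc a (a + A),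
      centered P X M i (X i ω)) ∂P ≤ Real.exp (A * v)) :
    P.real {ω | ∃ j ≤ n / A, y ≤ |∑ q ∈ Finset.range j, blockSum P X M A π q ω|} ≤
      2 * (Real.exp (n * v) * (Real.exp (-(t * y)) +
        n * (Real.exp (t * (2 * M * A)) * Real.exp (-(c * (A : ℝ) ^ γ₁))))) := by
  set N := n / A with hN
  have hNA : (N : ℝ) * A ≤ n := by exact_mod_cast Nat.div_mul_le_self n A
  have hpow : Real.exp (A * v) ^ N ≤ Real.exp (n * v) := by
    rw [← Real.exp_nat_mul, ← mul_assoc]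
    exact Real.exp_le_exp.2 (mul_le_mul_of_nonneg_right hNA hv)
  set D := Real.exp (t * (2 * M * A)) * Real.exp (-(c * (A : ℝ) ^ γ₁)) with hD
  have hD0 : 0 < D := by positivity
  have hone : ∀ θ : ℝ, |θ| = t →
      P.real {ω | ∃ j ≤ N, t * y ≤ θ * ∑ q ∈ Finset.range j, blockSum P X M A π q ω} ≤
        Real.exp (n * v) * (Real.exp (-(t * y)) + n * D) := by
    intro θ hθ
    refine (h.measureReal_exists_exp_le hM hA π N (t * y) θ (Real.one_le_exp (by positivity))
      (hlap θ hθ)).trans ?_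
    rw [hθ]
    refine mul_le_mul hpow (add_le_add le_rfl ?_) (by positivity) (Real.exp_pos _).le
    calc (N : ℝ) * (t * Real.exp (t * (2 * M * A)) * A * Real.exp (-(c * (A : ℝ) ^ γ₁)))
        = t * ((N * A) * D) := by rw [hD]; ring
      _ ≤ 1 * (n * D) := by gcongr
      _ = n * D := one_mul _
  have hsub : {ω | ∃ j ≤ N, y ≤ |∑ q ∈ Finset.range j, blockSum P X M A π q ω|} ⊆
      {ω | ∃ j ≤ N, t * y ≤ t * ∑ q ∈ Finset.range j, blockSum P X M A π q ω} ∪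
      {ω | ∃ j ≤ N, t * y ≤ -t * ∑ q ∈ Finset.range j, blockSum P X M A π q ω} := by
    rintro ω ⟨j, hj, hy⟩
    rcases le_abs.1 hy with h1 | h1
    · exact Or.inl ⟨j, hj, by gcongr⟩
    · refine Or.inr ⟨j, hj, ?_⟩
      rw [neg_mul, ← mul_neg]
      gcongr
  calc _ ≤ _ := measureReal_mono hsub
    _ ≤ _ := measureReal_union_le _ _
    _ ≤ _ := add_le_add (hone t (abs_of_pos ht)) (hone (-t) (by rw [abs_neg, abs_of_pos ht]))
    _ = _ := by ring

end

/-! ### Choice of the block length and of the Laplace parameter. -/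

set_option maxHeartbeats 1000000 in
/-- An exponential inequality and a second moment inequality for the maximum of the partial sums. -/
theorem exists_measureReal_partialSum_le.{u} {c γ γ₁ b : ℝ} (hc : 0 < c) (hγ : 0 < γ) (hγ1 : γ < 1)
    (hγ₁ : 0 < γ₁) (hb : 0 ≤ b) (hγb : 1 / γ = 1 / γ₁ + b) :
    ∃ x₀ κ κ₂ K δ : ℝ, 8 ≤ x₀ ∧ 0 < κ ∧ 0 < κ₂ ∧ 0 < K ∧ 0 < δ ∧
      ∀ {Ω : Type u} [MeasurableSpace Ω] {P : Measure Ω} [IsProbabilityMeasure P]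
        {X : ℤ → Ω → ℝ}, IsMixing P X c γ₁ b → truncVar P X < ∞ → ∀ n : ℕ, 1 ≤ n →
        ∀ x : ℝ, x₀ ≤ x → (n : ℝ) ≤ Real.exp (κ₂ * x ^ γ) →
        P.real {ω | ∃ j ∈ Finset.Icc 1 n, x ≤ |partialSum X j ω|} ≤
          n * Real.exp (-(κ * x ^ γ)) + 4 * Real.exp (-(x ^ 2 / (K * (n *
            ((truncVar P X).toReal + Real.exp (-(δ * x ^ (γ * (1 - γ))))))))) ∧
        P.real {ω | ∃ j ∈ Finset.Icc 1 n, x ≤ |partialSum X j ω|} ≤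
          n * Real.exp (-(κ * x ^ γ)) + K * (n * (truncVar P X).toReal) / x ^ 2 := by
  obtain ⟨t₀, K, δ, ht₀, ht₀1, hK, hδ, hlap⟩ :=
    exists_integral_exp_centered_le.{u} hc hγ hγ1 hγ₁ hb hγb
  set g := (4 : ℝ) ^ (-γ₁) with hg
  have hg0 : 0 < g := by positivity
  -- In the decoupling error the exponentials contribute at most `3 * τ * z`, which must fit into
  -- half of `c * g * z`.
  set τ := min t₀ (c * g / 6) with hτ
  have hτ0 : 0 < τ := by positivity
  have hτt : τ ≤ t₀ := min_le_left _ _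
  have hτc : τ ≤ c * g / 6 := min_le_right _ _
  set κ₀ := min g (min τ (c * g / 2)) with hκ₀
  have hκ₀0 : 0 < κ₀ := by positivity
  have hκg : κ₀ ≤ g := min_le_left _ _
  have hκτ : κ₀ ≤ τ := (min_le_right _ _).trans (min_le_left _ _)
  have hκc : κ₀ ≤ c * g / 2 := (min_le_right _ _).trans (min_le_right _ _)
  set E := truncErr b with hE
  have hE0 : 0 < E := truncErr_pos b
  -- The first entry makes the means of the truncated variables harmless, the second makes `z ≥ 6 /
  -- κ₀`, so that the factor 12 collected from all error terms is absorbed by half of the exponent.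
  set x₀ := max (4 * E) (8 * (max 1 (6 / κ₀)) ^ (1 / γ)) with hx₀
  have hmax1 : 1 ≤ max 1 (6 / κ₀) := le_max_left _ _
  have hx₀8 : 8 ≤ x₀ := by
    refine le_trans ?_ (le_max_right _ _)
    have : 1 ≤ (max 1 (6 / κ₀)) ^ (1 / γ) := Real.one_le_rpow hmax1 (by positivity)
    linarith
  set h8 := (8 : ℝ) ^ (-γ) with hh8
  have h80 : 0 < h8 := by positivity
  refine ⟨x₀, κ₀ / 2 * h8, g * h8 / 2, max (64 * K) 32, δ * (8 : ℝ) ^ (-(γ * (1 - γ))), hx₀8,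
    by positivity, by positivity, by positivity, by positivity, ?_⟩
  intro Ω _ P _ X h hV n hn x hx hnx
  have hx8 : 8 ≤ x := hx₀8.trans hx
  have hx0 : 0 < x := by linarith
  have hy1 : 1 ≤ x / 8 := by rw [le_div_iff₀ (by norm_num)]; linarith
  have hy0 : 0 < x / 8 := by linarith
  set z := (x / 8) ^ γ with hz
  have hz0 : 0 < z := by positivity
  have hzx : z = h8 * x ^ γ := by
    rw [hz, hh8, Real.div_rpow hx0.le (by norm_num), Real.rpow_neg (by norm_num)]
    field_simp
  have hz6 : 6 / κ₀ ≤ z := by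
    have h1 : (max 1 (6 / κ₀)) ^ (1 / γ) ≤ x / 8 := by
      rw [le_div_iff₀ (by norm_num)]
      have := (le_max_right (4 * E) (8 * (max 1 (6 / κ₀)) ^ (1 / γ))).trans hx
      linarith
    have h2 : ((max 1 (6 / κ₀)) ^ (1 / γ)) ^ γ ≤ z := by rw [hz]; gcongr
    rw [← Real.rpow_mul (by positivity), one_div_mul_cancel hγ.ne', Real.rpow_one] at h2
    exact (le_max_right _ _).trans h2
  -- With this size the trivial bound `s ^ b * A` for a block is at most `x / 8`, the tail exponent
  -- `B ^ γ₁` equals `z`, and so does `B ^ (-d) * (x / 8)`, where `B ^ (-d)` is the scale of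
  -- admissible Laplace parameters.
  set B := (x / 8) ^ (γ / γ₁) with hB
  have hB1 : 1 ≤ B := Real.one_le_rpow hy1 (by positivity)
  have hB0 : 0 < B := by linarith
  have hBz : B ^ γ₁ = z := by
    rw [hB, ← Real.rpow_mul hy0.le, hz]
    congr 1
    field_simp
  have hBx : B ^ (γ₁ / γ) = x / 8 := by
    rw [hB, ← Real.rpow_mul hy0.le, show γ / γ₁ * (γ₁ / γ) = 1 by field_simp, Real.rpow_one]
  set d := γ₁ * (1 / γ - 1) with hd
  have hBd : B ^ (-d) * (x / 8) = z := by
    rw [← hBx, ← Real.rpow_add hB0, ← hBz]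
    congr 1
    rw [hd]
    field_simp
    ring
  set A := blockLength γ B with hA
  have hA0 : 0 < A := blockLength_pos hγ1 hB1
  have hA1 : (1 : ℝ) ≤ A := by exact_mod_cast hA0
  have hAB : (A : ℝ) ≤ B := blockLength_le hγ hγ1 hB1
  have hBA : B / 4 ≤ A := le_blockLength hγ1 hB1
  set s := (A : ℝ) ^ γ₁ with hs
  have hs1 : 1 ≤ s := Real.one_le_rpow hA1 hγ₁.le
  have hs0 : 0 < s := by linarith
  have hgs : g * z ≤ s := by
    rw [← hBz, hg, hs]
    calc (4 : ℝ) ^ (-γ₁) * B ^ γ₁ = (B / 4) ^ γ₁ := by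
          rw [Real.div_rpow hB0.le (by norm_num), Real.rpow_neg (by norm_num)]
          field_simp
      _ ≤ _ := by gcongr
  have hM1 : 1 ≤ s ^ b := Real.one_le_rpow hs1 hb
  have hM0 : 0 ≤ s ^ b := by linarith
  have hMA : s ^ b * A ≤ x / 8 := by
    rw [← hBx, hs, ← Real.rpow_mul (by positivity)]
    calc (A : ℝ) ^ (γ₁ * b) * A = (A : ℝ) ^ (γ₁ * b + 1) := by
          rw [Real.rpow_add (by linarith), Real.rpow_one]
      _ = (A : ℝ) ^ (γ₁ / γ) := by
          congr 1
          rw [show b = 1 / γ - 1 / γ₁ by linarith]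
          field_simp
          ring
      _ ≤ _ := by gcongr
  have hn0 : (1 : ℝ) ≤ n := by exact_mod_cast hn
  have hμx : n * (E * Real.exp (-(s / 2))) ≤ x / 4 := by
    have h1 : (n : ℝ) * Real.exp (-(s / 2)) ≤ 1 := by
      calc (n : ℝ) * Real.exp (-(s / 2)) ≤
            Real.exp (g * h8 / 2 * x ^ γ) * Real.exp (-(s / 2)) := by gcongr
        _ = Real.exp (g * z / 2 - s / 2) := by rw [← Real.exp_add, hzx]; ring_nf
        _ ≤ 1 := Real.exp_le_one_iff.2 (by linarith)
    have h2 : 4 * E ≤ x := (le_max_left _ _).trans hx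
    calc n * (E * Real.exp (-(s / 2))) = E * (n * Real.exp (-(s / 2))) := by ring
      _ ≤ E * 1 := by gcongr
      _ ≤ x / 4 := by linarith
  have hmain := h.measureReal_exists_partialSum_le hs0 hA0 (n := n) (x := x) (by linarith) hμx
  set p := P.real {ω | ∃ j ∈ Finset.Icc 1 n, x ≤ |partialSum X j ω|} with hp
  set V := (truncVar P X).toReal with hVd
  have hV0 : 0 ≤ V := ENNReal.toReal_nonneg
  have hεeq : Real.exp (-(δ * (8 : ℝ) ^ (-(γ * (1 - γ))) * x ^ (γ * (1 - γ)))) =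
      Real.exp (-(δ * B ^ (γ₁ * (1 - γ)))) := by
    congr 2
    rw [mul_assoc]
    congr 1
    rw [hB, ← Real.rpow_mul hy0.le, show γ / γ₁ * (γ₁ * (1 - γ)) = γ * (1 - γ) by field_simp,
      Real.div_rpow hx0.le (by norm_num), Real.rpow_neg (by norm_num)]
    field_simp
  rw [hεeq]
  set W := V + Real.exp (-(δ * B ^ (γ₁ * (1 - γ)))) with hW
  have hW0 : 0 < W := by positivity
  set F := Real.exp (-(κ₀ * z)) with hF
  have hF0 : 0 < F := Real.exp_pos _
  have htail : Real.exp (1 - s) ≤ 4 * F := by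
    have h1 : Real.exp 1 ≤ 4 := by have := Real.exp_one_lt_d9; linarith
    rw [sub_eq_add_neg, Real.exp_add]
    gcongr
    exact Real.exp_le_exp.2 (neg_le_neg ((mul_le_mul_of_nonneg_right hκg hz0.le).trans hgs))
  have hFfin : 12 * F ≤ Real.exp (-(κ₀ / 2 * h8 * x ^ γ)) := by
    have h1 : F = Real.exp (-(κ₀ / 2 * h8 * x ^ γ)) * Real.exp (-(κ₀ * z / 2)) := by
      rw [← Real.exp_add, hF, hzx]; ring_nf
    have h2 : 3 ≤ κ₀ * z / 2 := by
      rw [div_le_iff₀ hκ₀0] at hz6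
      linarith
    have h3 : 12 * Real.exp (-(κ₀ * z / 2)) ≤ 1 := by
      rw [Real.exp_neg, mul_inv_le_iff₀ (Real.exp_pos _), one_mul]
      have h4 : (12 : ℝ) ≤ Real.exp 3 := by
        have h5 := Real.exp_one_gt_d9
        have h6 : Real.exp 3 = Real.exp 1 ^ 3 := by rw [← Real.exp_nat_mul]; norm_num
        rw [h6]
        calc (12 : ℝ) ≤ 2.5 ^ 3 := by norm_num
          _ ≤ Real.exp 1 ^ 3 := by gcongr; linarith
      exact h4.trans (Real.exp_le_exp.2 h2)
    rw [h1]
    have h5 := Real.exp_pos (-(κ₀ / 2 * h8 * x ^ γ))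
    nlinarith
  have hcs : Real.exp (-(c * s)) ≤ F := by
    refine Real.exp_le_exp.2 (neg_le_neg ?_)
    calc κ₀ * z ≤ c * g / 2 * z := by gcongr
      _ ≤ c * (g * z) := by nlinarith [mul_pos (mul_pos hc hg0) hz0]
      _ ≤ c * s := by gcongr
  constructor
  -- The second entry gives `n * v ≤ t * x / 8`, half of the gain `t * x / 4`. The first is the
  -- limit of the Laplace bound; when it is the smaller one, the term `exp(-τ * z)` is absorbed by
  -- `F`.
  · set t := min (τ * B ^ (-d)) (x / (8 * K * (n * W))) with ht
    have hnW : 0 < n * W := by positivity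
    have ht0 : 0 < t := by positivity
    have htτ : t ≤ τ * B ^ (-d) := min_le_left _ _
    have htW : t ≤ x / (8 * K * (n * W)) := min_le_right _ _
    have hBd1 : B ^ (-d) ≤ 1 := by
      refine Real.rpow_le_one_of_one_le_of_nonpos hB1 ?_
      have : 1 < 1 / γ := by rw [lt_div_iff₀ hγ]; linarith
      have : 0 < d := mul_pos hγ₁ (by linarith)
      linarith
    have ht1 : t ≤ 1 := by
      calc t ≤ τ * B ^ (-d) := htτ
        _ ≤ 1 * 1 := mul_le_mul (hτt.trans ht₀1) hBd1 (by positivity) zero_le_one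
        _ = 1 := one_mul 1
    have htx : t * (x / 8) ≤ τ * z := by
      calc t * (x / 8) ≤ τ * B ^ (-d) * (x / 8) := by gcongr
        _ = τ * z := by rw [mul_assoc, hBd]
    set v := K * t ^ 2 * W with hv
    have hv0 : 0 ≤ v := by positivity
    have hnv : n * v ≤ t * (x / 8) := by
      rw [le_div_iff₀ (by positivity)] at htW
      calc n * v = t * (t * (8 * K * (n * W))) / 8 := by rw [hv]; ring
        _ ≤ t * x / 8 := by gcongr
        _ = _ := by ring
    have hlapθ : ∀ θ : ℝ, |θ| = t → ∀ a : ℤ, 0 ≤ a →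
        ∫ ω, Real.exp (θ * ∑ i ∈ Finset.Ioc a (a + A), centered P X (s ^ b) i (X i ω)) ∂P ≤
          Real.exp (A * v) := by
      intro θ hθ a ha
      have h1 := hlap B hB1 h hV a ha θ (by
        rw [hθ]
        exact htτ.trans (by gcongr))
      refine h1.trans (le_of_eq ?_)
      rw [← sq_abs θ, hθ, hv]
      congr 1
      ring
    set Q := Real.exp (-(x ^ 2 / (64 * K * (n * W)))) with hQ
    have hQ1 : Real.exp (-(t * (x / 8))) ≤ F + Q := by
      rcases min_choice (τ * B ^ (-d)) (x / (8 * K * (n * W))) with h1 | h1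
      · have h2 : t * (x / 8) = τ * z := by rw [ht, h1, mul_assoc, hBd]
        rw [h2]
        have h3 : Real.exp (-(τ * z)) ≤ F := by rw [hF]; gcongr
        have := Real.exp_pos (-(x ^ 2 / (64 * K * (n * W))))
        linarith
      · have h2 : t * (x / 8) = x ^ 2 / (64 * K * (n * W)) := by
          rw [ht, h1]
          field_simp
          norm_num
        rw [h2]
        linarith
    have hblk : ∀ π : ℕ, P.real {ω | ∃ j ≤ n / A,
        x / 4 ≤ |∑ q ∈ Finset.range j, blockSum P X (s ^ b) A π q ω|} ≤
          2 * (F + Q + n * F) := by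
      intro π
      refine (h.measureReal_exists_abs_blockSum_le hM0 hA0 (n := n) π (x / 4) ht0 ht1 hv0
        hlapθ).trans ?_
      have h1 : Real.exp (n * v) * Real.exp (-(t * (x / 4))) ≤ F + Q := by
        refine le_trans ?_ hQ1
        rw [← Real.exp_add]
        exact Real.exp_le_exp.2 (by linarith)
      have h2 : Real.exp (n * v) * (Real.exp (t * (2 * s ^ b * A)) * Real.exp (-(c * s))) ≤ F := by
        rw [← Real.exp_add, ← Real.exp_add]
        refine Real.exp_le_exp.2 ?_
        have h3 : t * (2 * s ^ b * A) ≤ t * (2 * (x / 8)) := by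
          refine mul_le_mul_of_nonneg_left ?_ ht0.le
          linarith
        have h4 : c * (g * z) ≤ c * s := by gcongr
        have h5 : κ₀ * z ≤ c * g / 2 * z := by gcongr
        have h6 : τ * z ≤ c * g / 6 * z := by gcongr
        linarith
      have h3 : (n : ℝ) * (Real.exp (n * v) *
          (Real.exp (t * (2 * s ^ b * A)) * Real.exp (-(c * s)))) ≤ n * F := by gcongr
      rw [mul_add]
      refine mul_le_mul_of_nonneg_left ?_ zero_le_two
      refine add_le_add h1 (le_trans (le_of_eq ?_) h3)
      ring
    have hQfin : Q ≤ Real.exp (-(x ^ 2 / (max (64 * K) 32 * (n * W)))) := by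
      rw [hQ]
      gcongr
      exact le_max_left _ _
    have h1 := hblk 0
    have h2 := hblk 1
    have h3 : (n : ℝ) * Real.exp (1 - s) ≤ n * (4 * F) := by gcongr
    have h4 : (n : ℝ) * (12 * F) ≤ n * Real.exp (-(κ₀ / 2 * h8 * x ^ γ)) := by gcongr
    have h5 : F ≤ n * F := le_mul_of_one_le_left hF0.le hn0
    linarith
  · have hvar : ∀ a : ℤ, 0 ≤ a →
        ∫ ω, (∑ i ∈ Finset.Ioc a (a + A), centered P X (s ^ b) i (X i ω)) ^ 2 ∂P ≤ A * V := by
      intro a ha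
      have := h.integral_sq_sum_centered_le hV hM1 (K := Finset.Ioc a (a + A)) fun i hi => by
        have := Finset.mem_Ioc.1 hi
        omega
      rwa [card_block] at this
    have hNA : ((n / A : ℕ) : ℝ) * A ≤ n := by exact_mod_cast Nat.div_mul_le_self n A
    have hblk : ∀ π : ℕ, P.real {ω | ∃ j ≤ n / A,
        x / 4 ≤ |∑ q ∈ Finset.range j, blockSum P X (s ^ b) A π q ω|} ≤
          16 * (n * V) / x ^ 2 + n * F := by
      intro π
      have h1 := h.measureReal_exists_sq_le hM0 hA0 π (n / A) (y := x / 4) (by linarith) hvar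
      set pr := P.real {ω | ∃ j ≤ n / A,
        x / 4 ≤ |∑ q ∈ Finset.range j, blockSum P X (s ^ b) A π q ω|} with hpr
      have h2 : ((n / A : ℕ) : ℝ) * (A * V + 2 * (x / 4) * (A * Real.exp (-(c * s)))) ≤
          n * V + x / 2 * (n * F) := by
        calc _ = ((n / A : ℕ) : ℝ) * A * V +
              x / 2 * (((n / A : ℕ) : ℝ) * A * Real.exp (-(c * s))) := by ring
          _ ≤ n * V + x / 2 * (n * F) := by gcongr
      have h3 : x ^ 2 * pr ≤ 16 * (n * V) + x ^ 2 * (n * F) := by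
        have h4 : 8 * x * (n * F) ≤ x * x * (n * F) := by gcongr
        have h5 := h1.trans h2
        linarith
      rw [div_add' _ _ _ (by positivity), le_div_iff₀ (by positivity)]
      linarith
    have h1 := hblk 0
    have h2 := hblk 1
    have h3 : (n : ℝ) * Real.exp (1 - s) ≤ n * (4 * F) := by gcongr
    have h4 : (n : ℝ) * (12 * F) ≤ n * Real.exp (-(κ₀ / 2 * h8 * x ^ γ)) := by gcongr
    have h5 : 0 ≤ n * F := by positivity
    have h6 : 32 * (n * V) / x ^ 2 ≤ max (64 * K) 32 * (n * V) / x ^ 2 := by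
      gcongr
      exact le_max_right _ _
    have h7 : 16 * (n * V) / x ^ 2 + 16 * (n * V) / x ^ 2 = 32 * (n * V) / x ^ 2 := by ring
    linarith

/-! ### Explicit leading constants and conclusion. -/

/-- Combination of an exponential and a second moment bound that makes the leading constants
explicit. -/
theorem le_add_exp_add_exp_of_bounds {p a x v e K : ℝ} (hK : 0 < K) (hx : 0 < x) (hv : 0 ≤ v)
    (he : 0 < e) (ha : 0 ≤ a) (hp : p ≤ 1) (h1 : p ≤ a + 4 * Real.exp (-(x ^ 2 / (K * (v + e)))))
    (h2 : p ≤ a + K * v / x ^ 2) :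
    p ≤ a + 2 * Real.exp (-x ^ 2 / (4 * K * (1 + v))) + Real.exp (-(x ^ 2 / (8 * K * e))) := by
  have hthird := Real.exp_pos (-(x ^ 2 / (8 * K * e)))
  -- For `e ≤ v` the exponential is at most `q ^ 2`, and `4 * q ^ 2 ≤ 2 * q` unless `q > 1 / 2`,
  -- when the claim is trivial. For `e > v` it is at most `ρ ^ 4`, and `4 * ρ ^ 4 ≤ ρ` if `ρ ≤ 1 /
  -- 2`. The remaining case, `ρ > 1 / 2` with the middle exponential below `1 / 2`, forces `x ^ 2 >
  -- 2 * K * (1 + v)`; then the second moment bound is below `a + ρ`.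
  rcases le_or_gt e v with hcase | hcase
  · set q := Real.exp (-x ^ 2 / (4 * K * (1 + v))) with hq
    have hq2 : Real.exp (-(x ^ 2 / (K * (v + e)))) ≤ q ^ 2 := by
      rw [hq, ← Real.exp_nat_mul]
      refine Real.exp_le_exp.2 ?_
      have e1 : ((2 : ℕ) : ℝ) * (-x ^ 2 / (4 * K * (1 + v))) = -(x ^ 2 / (K * (2 * (1 + v)))) := by
        push_cast
        field_simp
        norm_num
      rw [e1]
      gcongr
      linarith
    rcases le_or_gt (1 / 2) q with h3 | h3
    · linarith
    · have := Real.exp_pos (-x ^ 2 / (4 * K * (1 + v)))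
      nlinarith
  · set ρ := Real.exp (-(x ^ 2 / (8 * K * e))) with hρ
    have hρ4 : Real.exp (-(x ^ 2 / (K * (v + e)))) ≤ ρ ^ 4 := by
      rw [hρ, ← Real.exp_nat_mul]
      refine Real.exp_le_exp.2 ?_
      have e1 : ((4 : ℕ) : ℝ) * -(x ^ 2 / (8 * K * e)) = -(x ^ 2 / (K * (2 * e))) := by
        push_cast
        field_simp
        norm_num
      rw [e1]
      gcongr
      linarith
    have hsec := Real.exp_pos (-x ^ 2 / (4 * K * (1 + v)))
    rcases le_or_gt ρ (1 / 2) with h3 | h3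
    · have : 4 * ρ ^ 4 ≤ ρ := by
        have h4 : ρ ^ 3 ≤ (1 / 2) ^ 3 := by gcongr
        nlinarith
      linarith
    · rcases le_or_gt (1 / 2) (Real.exp (-x ^ 2 / (4 * K * (1 + v)))) with h4 | h4
      · linarith
      · have h5 := Real.add_one_le_exp (-x ^ 2 / (4 * K * (1 + v)))
        have h6 : 1 / 2 < x ^ 2 / (4 * K * (1 + v)) := by
          rw [neg_div] at h5 h4
          linarith
        rw [lt_div_iff₀ (by positivity)] at h6
        have h7 : K * v / x ^ 2 ≤ 1 / 2 := by
          rw [div_le_iff₀ (by positivity)]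
          nlinarith [mul_nonneg hK.le hv]
        linarith

/-- The substitution `t = s ^ (1 / γ₂)`; for `γ₂ = ∞` every level is 1, and exceeding it has
probability zero. -/
theorem isMixing_of_tailBound {Ω : Type*} [MeasurableSpace Ω] {P : Measure Ω}
    [IsProbabilityMeasure P] {X : ℤ → Ω → ℝ} {c γ₁ : ℝ} {γ₂ : ℝ≥0∞} (hγ₂ : 0 < γ₂)
    (hX : ∀ j, Measurable (X j)) (hint : ∀ j, Integrable (X j) P ∧ ∫ ω, X j ω ∂P = 0)
    (hτ : ∀ x : ℝ, 1 ≤ x → tauCoeff P X ⌊x⌋₊ ≤ ENNReal.ofReal (Real.exp (-c * x ^ γ₁)))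
    (htail : TailBound P X γ₂) : IsMixing P X c γ₁ (1 / γ₂).toReal where
  meas := hX
  integrable j := (hint j).1
  mean j := (hint j).2
  tau i hi := by
    have := hτ i (by exact_mod_cast hi)
    rwa [Nat.floor_natCast, neg_mul] at this
  tail k hk s hs := by
    by_cases h : γ₂ = ∞
    · have h1 : P.real {ω | s ^ (1 / γ₂).toReal < |X k ω|} = 0 := by
        rw [h]
        simp only [one_div, ENNReal.inv_top, ENNReal.toReal_zero, Real.rpow_zero]
        rw [measureReal_eq_zero_iff]
        have h2 := htail.1 h k hk
        rw [ae_iff] at h2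
        simpa only [not_le] using h2
      rw [h1]
      exact (Real.exp_pos _).le
    · have h0 : 0 < γ₂.toReal := ENNReal.toReal_pos hγ₂.ne' h
      have h1 := htail.2 h (s ^ (1 / γ₂).toReal) (by positivity) k hk
      rw [← Real.rpow_mul hs.le] at h1
      have h2 : (1 / γ₂).toReal * γ₂.toReal = 1 := by
        rw [one_div, ENNReal.toReal_inv, inv_mul_cancel₀ h0.ne']
      rwa [h2, Real.rpow_one] at h1

end TauMixing

theorem theorem1 (c γ γ₁ : ℝ) (hc : 0 < c) (hγ : 0 < γ) (hγ1 : γ < 1) (hγ₁ : 0 < γ₁) :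
    ∃ C₁ C₂ C₃ C₄ : ℝ, 0 < C₁ ∧ 0 < C₂ ∧ 0 < C₃ ∧ 0 < C₄ ∧
      ∀ γ₂ : ℝ≥0∞, 0 < γ₂ → 1 / γ = 1 / γ₁ + (1 / γ₂).toReal →
      ∀ {Ω : Type*} [MeasurableSpace Ω] (P : Measure Ω) [IsProbabilityMeasure P] (X : ℤ → Ω → ℝ),
        (∀ j, Measurable (X j)) →
        (∀ j, Integrable (X j) P ∧ ∫ ω, X j ω ∂P = 0) →
        (∀ x : ℝ, 1 ≤ x →
          TauMixing.tauCoeff P X ⌊x⌋₊ ≤ ENNReal.ofReal (Real.exp (-c * x ^ γ₁))) →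
        TauMixing.TailBound P X γ₂ →
        TauMixing.truncVar P X < ∞ ∧
        ∀ n : ℕ, 4 ≤ n → ∀ x : ℝ, 0 < x →
          P.real {ω | ∃ j ∈ Finset.Icc 1 n, x ≤ |TauMixing.partialSum X j ω|} ≤
            n * Real.exp (-x ^ γ / C₁)
            + 2 * Real.exp (-x ^ 2 / (C₂ * (1 + n * (TauMixing.truncVar P X).toReal)))
            + (if 1 < x then
                Real.exp (-(x ^ 2 / (C₃ * n)) *
                  Real.exp (x ^ (γ * (1 - γ)) / (C₄ * Real.log x ^ γ)))
              else 0) := by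
  -- The value of `1 / γ₂` is determined by `γ` and `γ₁`, so the constants do not depend on `γ₂`; if
  -- `β < 0`, no `γ₂` is admissible.
  set β := 1 / γ - 1 / γ₁ with hβ
  rcases lt_or_ge β 0 with hneg | hb
  · refine ⟨1, 1, 1, 1, one_pos, one_pos, one_pos, one_pos, fun γ₂ _ hγ₂ => ?_⟩
    have : 0 ≤ (1 / γ₂).toReal := ENNReal.toReal_nonneg
    linarith
  obtain ⟨x₀, κ, κ₂, K, δ, hx₀, hκ, hκ₂, hK, hδ, hmain⟩ :=
    TauMixing.exists_measureReal_partialSum_le hc hγ hγ1 hγ₁ hb (by rw [hβ]; ring)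
  set C₁ := max (max (1 / κ) (1 / κ₂)) (x₀ ^ γ) with hC₁
  have hC₁0 : 0 < C₁ := lt_max_of_lt_left (lt_max_of_lt_left (by positivity))
  have hC₁κ : 1 / κ ≤ C₁ := (le_max_left _ _).trans (le_max_left _ _)
  have hC₁κ₂ : 1 / κ₂ ≤ C₁ := (le_max_right _ _).trans (le_max_left _ _)
  have hC₁x : x₀ ^ γ ≤ C₁ := le_max_right _ _
  refine ⟨C₁, 4 * K, 8 * K, 1 / δ, hC₁0, by positivity, by positivity, by positivity, ?_⟩
  intro γ₂ hγ₂ hγeq Ω _ P _ X hX hint hτ htail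
  have hβ₂ : (1 / γ₂).toReal = β := by rw [hβ]; linarith
  have h := TauMixing.isMixing_of_tailBound hγ₂ hX hint hτ htail
  rw [hβ₂] at h
  have hV := h.truncVar_lt_top hc hγ₁
  refine ⟨hV, fun n hn x hx => ?_⟩
  set V := (TauMixing.truncVar P X).toReal with hVd
  have hV0 : 0 ≤ V := ENNReal.toReal_nonneg
  have hn4 : (4 : ℝ) ≤ n := by exact_mod_cast hn
  set p := P.real {ω | ∃ j ∈ Finset.Icc 1 n, x ≤ |TauMixing.partialSum X j ω|} with hp
  have hp1 : p ≤ 1 := measureReal_le_one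
  have hthird : 0 ≤ (if 1 < x then Real.exp (-(x ^ 2 / (8 * K * n)) *
      Real.exp (x ^ (γ * (1 - γ)) / (1 / δ * Real.log x ^ γ))) else 0) := by
    split_ifs
    · exact (Real.exp_pos _).le
    · exact le_rfl
  have hsecond := Real.exp_pos (-x ^ 2 / (4 * K * (1 + n * V)))
  -- For small `x` the first term alone exceeds 1: it is at least `n * exp(-1)`, and `n ≥ 4 > e`.
  rcases lt_or_ge x x₀ with hxx | hxx
  · have h1 : x ^ γ / C₁ ≤ 1 := by
      rw [div_le_one hC₁0]
      exact (Real.rpow_le_rpow hx.le hxx.le hγ.le).trans hC₁x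
    have h2 : Real.exp (-1) ≤ Real.exp (-x ^ γ / C₁) := by
      refine Real.exp_le_exp.2 ?_
      rw [neg_div]
      linarith
    have h3 : 1 ≤ 4 * Real.exp (-1) := by
      rw [Real.exp_neg, ← div_eq_mul_inv, le_div_iff₀ (Real.exp_pos _)]
      have := Real.exp_one_lt_d9
      linarith
    have h4 : 4 * Real.exp (-1) ≤ n * Real.exp (-x ^ γ / C₁) := by gcongr
    linarith
  have hx1 : 1 < x := by linarith
  have hxγ : 0 < x ^ γ := Real.rpow_pos_of_pos hx γ
  -- For such large `n` the first term is again at least 1.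
  rcases lt_or_ge (Real.exp (κ₂ * x ^ γ)) n with hnx | hnx
  · have h1 : 1 ≤ n * Real.exp (-x ^ γ / C₁) := by
      have h2 : x ^ γ / C₁ ≤ κ₂ * x ^ γ := by
        rw [div_le_iff₀ hC₁0]
        rw [div_le_iff₀ hκ₂] at hC₁κ₂
        nlinarith
      calc 1 = Real.exp (κ₂ * x ^ γ) * Real.exp (-(κ₂ * x ^ γ)) := by
            rw [← Real.exp_add]; simp
        _ ≤ n * Real.exp (-x ^ γ / C₁) := by
            rw [neg_div]
            gcongr
    linarith
  obtain ⟨hm1, hm2⟩ := hmain h hV n (by omega) x hxx hnx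
  set ε := Real.exp (-(δ * x ^ (γ * (1 - γ)))) with hε
  have hε0 : 0 < ε := Real.exp_pos _
  have hnε : 0 < n * ε := by positivity
  rw [mul_add] at hm1
  have hcomb := TauMixing.le_add_exp_add_exp_of_bounds hK hx (by positivity) hnε (by positivity)
    hp1 hm1 hm2
  have hfirst : n * Real.exp (-(κ * x ^ γ)) ≤ n * Real.exp (-x ^ γ / C₁) := by
    have h2 : x ^ γ / C₁ ≤ κ * x ^ γ := by
      rw [div_le_iff₀ hC₁0]
      rw [div_le_iff₀ hκ] at hC₁κ
      nlinarith
    rw [neg_div]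
    gcongr
  have hlast : Real.exp (-(x ^ 2 / (8 * K * (n * ε)))) ≤ Real.exp (-(x ^ 2 / (8 * K * n)) *
      Real.exp (x ^ (γ * (1 - γ)) / (1 / δ * Real.log x ^ γ))) := by
    -- Since `x ≥ 8 > e`, the logarithm only weakens the bound already obtained.
    have hlog : 1 ≤ Real.log x := by
      rw [Real.le_log_iff_exp_le hx]
      have := Real.exp_one_lt_d9
      linarith
    have hlogγ : 1 ≤ Real.log x ^ γ := Real.one_le_rpow hlog hγ.le
    have h1 : x ^ (γ * (1 - γ)) / (1 / δ * Real.log x ^ γ) ≤ δ * x ^ (γ * (1 - γ)) := by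
      have h3 : 0 < x ^ (γ * (1 - γ)) := Real.rpow_pos_of_pos hx _
      calc x ^ (γ * (1 - γ)) / (1 / δ * Real.log x ^ γ) ≤
            x ^ (γ * (1 - γ)) / (1 / δ * 1) := by gcongr
        _ = _ := by field_simp
    have h2 : x ^ 2 / (8 * K * (n * ε)) =
        x ^ 2 / (8 * K * n) * Real.exp (δ * x ^ (γ * (1 - γ))) := by
      rw [hε, Real.exp_neg]
      field_simp
    rw [h2, neg_mul]
    gcongr
  rw [if_pos hx1]
  linarith
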